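/- Let $(M,\mathbf g)$ be a smooth pseudo-Riemannian manifold of finite dimension and arbitrary signature (in particular a 4-dimensional Lorentzian manifold of signature $(1,3)$), and let $\nabla$ be its Levi-Civita connection. Let $g$ be the induced metric on $T^*M$, and let $\mathcal{C}\ell(T^*M)$ be the Clifford bundle of differential forms, with $ab+ba=2g(a,b)$ for 1-forms $a,b$. Identify it as a vector bundle with $\bigwedge T^*M$, write $\langle\cdot\rangle_k$ for the $k$-form part, and let $\nabla$ act on its sections by the induced covariant derivative on differential forms. Let $\{e_\alpha\}$ be an arbitrary smooth frame on an open set $U\subset M$ with dual coframe $\{\theta^\alpha\}$, put $g^{\alpha\beta}=g(\theta^\alpha,\theta^\beta)$ and $\nabla_{e_\alpha}e_\beta=\gamma^\rho_{\alpha\beta}e_\rho$, and define the Dirac operator, the covariant D'Alembertian and the Ricci operator by $$\partial=\theta^\alpha\nabla_{e_\alpha},\qquad \partial\cdot\partial=g^{\alpha\beta}(\nabla_{e_\alpha}\nabla_{e_\beta}-\gamma^\rho_{\alpha\beta}\nabla_{e_\rho}),\qquad \partial\wedge\partial=(\theta^\alpha\wedge\theta^\beta)(\nabla_{e_\alpha}\nabla_{e_\beta}-\gamma^\rho_{\alpha\beta}\nabla_{e_\rho}).$$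 Let $R(e_\alpha,e_\beta)e_\rho=R_\rho{}^\mu{}_{\alpha\beta}e_\mu$ with $R(X,Y)=\nabla_X\nabla_Y-\nabla_Y\nabla_X-\nabla_{[X,Y]}$, let $\mathcal R_\rho^\mu=\tfrac12R_\rho{}^\mu{}_{\alpha\beta}\,\theta^\alpha\wedge\theta^\beta$ be the curvature 2-forms, and let the Ricci tensor be taken with the sign convention $R_{\mu\beta}=R_\mu{}^\alpha{}_{\beta\alpha}$, with $R^\mu_\beta=g^{\mu\nu}R_{\nu\beta}$. Then on $U$: 1. For every smooth section $F$ of $\mathcal{C}\ell(T^*M)$ over $U$, $\partial^2F=\theta^\alpha\theta^\beta(\nabla_{e_\alpha}\nabla_{e_\beta}-\gamma^\rho_{\alpha\beta}\nabla_{e_\rho})F$, and $\partial\cdot\partial$ and $\partial\wedge\partial$ are its 0-form and 2-form parts, that is, they arise when $\theta^\alpha\theta^\beta$ is replaced by $\langle\theta^\alpha\theta^\beta\rangle_0$ and by $\langle\theta^\alpha\theta^\beta\rangle_2$; so $\partial^2F=(\partial\cdot\partial)F+(\partial\wedge\partial)F$. The operators $\partial$, $\partial\cdot\partial$ and $\partial\wedge\partial$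 do not depend on the frame. 2. For every $\mu$, $(\partial\wedge\partial)\theta^\mu=\mathcal R^\mu$, where $\mathcal R^\mu=R^\mu_\beta\theta^\beta$ are the Ricci 1-forms; moreover $R^\mu_\beta=g^{\rho\alpha}R_\rho{}^\mu{}_{\alpha\beta}$. 3. For every $\mu$, $(\partial\wedge\partial)\theta^\mu=-\mathcal R_\rho^\mu\theta^\rho$ (Clifford product), and its 3-form part vanishes, which is the first Bianchi identity: $\mathcal R_\rho^\mu\wedge\theta^\rho=0$. Equivalently $(\partial\wedge\partial)\wedge\theta^\mu:=\theta^\alpha\wedge\theta^\beta\wedge(\nabla_{e_\alpha}\nabla_{e_\beta}-\gamma^\rho_{\alpha\beta}\nabla_{e_\rho})\theta^\mu=0$. 4. In particular, if $\{e_{\mathbf a}\}_{\mathbf a=0,1,2,3}$ is a tetrad, $\mathbf g(e_{\mathbf a},e_{\mathbf b})=\eta_{\mathbf{ab}}=\mathrm{diag}(1,-1,-1,-1)$, with cotetrad $\{\theta^{\mathbf a}\}$, then $(\partial\wedge\partial)\theta^{\mathbf a}=\mathcal R^{\mathbf a}=\sum_{\mathbf b}\eta^{\mathbf{aa}}R_{\mathbf{ab}}\,\theta^{\mathbf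 b}$ (no sum over $\mathbf a$). -/

import Mathlib

open Set Bundle
open scoped Manifold ContDiff Topology

noncomputable section

/-! ### Multilinear algebra -/

/-- The algebra homomorphism `Λ V → (Λ V)[ε]`, `ε² = 0`, with `v ↦ v + ε A v`. -/
def exteriorDualLift {V : Type*} [AddCommGroup V] [Module ℝ V] (A : V →ₗ[ℝ] V) :
    ExteriorAlgebra ℝ V →ₐ[ℝ] TrivSqZeroExt (ExteriorAlgebra ℝ V) (ExteriorAlgebra ℝ V) :=
  ExteriorAlgebra.lift ℝ
    ⟨{  toFun := fun v => TrivSqZeroExt.inl (ExteriorAlgebra.ι ℝ v) +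
          TrivSqZeroExt.inr (ExteriorAlgebra.ι ℝ (A v))
        map_add' := fun v w => by ext <;> simp
        map_smul' := fun c v => by ext <;> simp },
      fun v => by
        ext
        · simp
        · simp⟩

/-- The unique derivation of the exterior algebra `Λ V` that extends the endomorphism `A` of `V`:
`v₁ ∧ ⋯ ∧ vₖ ↦ ∑ i, v₁ ∧ ⋯ ∧ A vᵢ ∧ ⋯ ∧ vₖ`. It is the `ε`-part of `exteriorDualLift A`. -/
def exteriorDerivation {V : Type*} [AddCommGroup V] [Module ℝ V] (A : V →ₗ[ℝ] V) :
    ExteriorAlgebra ℝ V →ₗ[ℝ] ExteriorAlgebra ℝ V :=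
  { toFun := fun a => (exteriorDualLift A a).snd
    map_add' := fun a b => by simp
    map_smul' := fun c a => by simp }

/-- Checks: `exteriorDerivation A` kills scalars, extends `A` and obeys the Leibniz rule. -/
theorem exteriorDerivation_one {V : Type*} [AddCommGroup V] [Module ℝ V] (A : V →ₗ[ℝ] V) :
    exteriorDerivation A 1 = 0 := by
  change ((exteriorDualLift A) 1).snd = 0
  simp

theorem exteriorDerivation_ι {V : Type*} [AddCommGroup V] [Module ℝ V] (A : V →ₗ[ℝ] V) (v : V) :
    exteriorDerivation A (ExteriorAlgebra.ι ℝ v) = ExteriorAlgebra.ι ℝ (A v) := by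
  change ((exteriorDualLift A) (ExteriorAlgebra.ι ℝ v)).snd = _
  rw [exteriorDualLift, ExteriorAlgebra.lift_ι_apply]
  simp

theorem exteriorDualLift_fst {V : Type*} [AddCommGroup V] [Module ℝ V] (A : V →ₗ[ℝ] V)
    (a : ExteriorAlgebra ℝ V) : (exteriorDualLift A a).fst = a := by
  have h : (TrivSqZeroExt.fstHom ℝ (ExteriorAlgebra ℝ V) (ExteriorAlgebra ℝ V)).comp
      (exteriorDualLift A) = AlgHom.id ℝ _ := by
    apply ExteriorAlgebra.hom_ext
    ext v
    change ((exteriorDualLift A) (ExteriorAlgebra.ι ℝ v)).fst = _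
    rw [exteriorDualLift, ExteriorAlgebra.lift_ι_apply]
    simp
  exact congrArg (fun f => f a) h

theorem exteriorDerivation_mul {V : Type*} [AddCommGroup V] [Module ℝ V] (A : V →ₗ[ℝ] V)
    (a b : ExteriorAlgebra ℝ V) :
    exteriorDerivation A (a * b) = exteriorDerivation A a * b + a * exteriorDerivation A b := by
  change (exteriorDualLift A (a * b)).snd =
    (exteriorDualLift A a).snd * b + a * (exteriorDualLift A b).snd
  rw [map_mul, TrivSqZeroExt.snd_mul, exteriorDualLift_fst, exteriorDualLift_fst]
  simp [add_comm]

/-- The exterior product on a Clifford algebra, through the canonical linear isomorphism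
between the Clifford algebra and the exterior algebra. -/
def cliffordWedge {V : Type*} [AddCommGroup V] [Module ℝ V] {Q : QuadraticForm ℝ V}
    (a b : CliffordAlgebra Q) : CliffordAlgebra Q :=
  (CliffordAlgebra.equivExterior Q).symm
    (CliffordAlgebra.equivExterior Q a * CliffordAlgebra.equivExterior Q b)

/-- `⟨a⟩ₖ`, the `k`-form part of an element of a Clifford algebra. -/
def cliffordGrade {V : Type*} [AddCommGroup V] [Module ℝ V] {Q : QuadraticForm ℝ V}
    (k : ℕ) (a : CliffordAlgebra Q) : CliffordAlgebra Q :=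
  (CliffordAlgebra.equivExterior Q).symm
    (GradedRing.proj (fun i : ℕ => ⋀[ℝ]^i V) k (CliffordAlgebra.equivExterior Q a))

/-! ### Pseudo-Riemannian metrics and the Levi-Civita connection -/

/-- Smooth pseudo-Riemannian metrics (of any signature) on a manifold `M` modelled on `E`. -/
structure PseudoRiemannianMetric (E : Type*) [NormedAddCommGroup E] [NormedSpace ℝ E]
    (M : Type*) [TopologicalSpace M] [ChartedSpace E M] [IsManifold 𝓘(ℝ, E) ∞ M] where
  val (x : M) : TangentSpace 𝓘(ℝ, E) x →L[ℝ] TangentSpace 𝓘(ℝ, E) x →L[ℝ] ℝ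
  symm (x : M) (v w : TangentSpace 𝓘(ℝ, E) x) : val x v w = val x w v
  nondegenerate (x : M) (v : TangentSpace 𝓘(ℝ, E) x) (hv : ∀ w, val x v w = 0) : v = 0
  contMDiff : ContMDiff 𝓘(ℝ, E) (𝓘(ℝ, E).prod 𝓘(ℝ, E →L[ℝ] E →L[ℝ] ℝ)) ∞
    (fun x : M => TotalSpace.mk' (E →L[ℝ] E →L[ℝ] ℝ)
      (E := fun x : M => TangentSpace 𝓘(ℝ, E) x →L[ℝ] TangentSpace 𝓘(ℝ, E) x →L[ℝ] ℝ) x (val x))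

/-- The cotangent space at `x`. -/
abbrev Cotangent {E : Type*} [NormedAddCommGroup E] [NormedSpace ℝ E]
    {M : Type*} [TopologicalSpace M] [ChartedSpace E M] (x : M) : Type _ :=
  Module.Dual ℝ (TangentSpace 𝓘(ℝ, E) x)

section Geometry

variable {E : Type*} [NormedAddCommGroup E] [NormedSpace ℝ E] [FiniteDimensional ℝ E]
  {M : Type*} [TopologicalSpace M] [ChartedSpace E M] [IsManifold 𝓘(ℝ, E) ∞ M]

instance tangentSpace_finiteDimensional (x : M) :
    FiniteDimensional ℝ (TangentSpace 𝓘(ℝ, E) x) :=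
  inferInstanceAs (FiniteDimensional ℝ E)

/-- `∇` is the Levi-Civita connection of `g`: a smooth connection on `TM` with `T(∇) = 0` and
`∇g = 0`, i.e. `v(g(Y, Z)) = g(∇_v Y, Z) + g(Y, ∇_v Z)`. (Here `cov Y x v` is `(∇_v Y)(x)`.) -/
structure IsLeviCivita (g : PseudoRiemannianMetric E M)
    (cov : CovariantDerivative 𝓘(ℝ, E) E (TangentSpace 𝓘(ℝ, E) : M → Type _)) : Prop where
  smooth (U : Set M) (hU : IsOpen U) : ContMDiffCovariantDerivativeOn E ∞ cov.toFun U
  torsion_eq_zero : cov.torsion = 0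
  metric_compatible (x : M) (v : TangentSpace 𝓘(ℝ, E) x) (Y Z : Π x : M, TangentSpace 𝓘(ℝ, E) x)
    (hY : MDiffAt (T% Y) x) (hZ : MDiffAt (T% Z) x) :
    mvfderiv 𝓘(ℝ, E) (fun y => g.val y (Y y) (Z y)) x v =
      g.val x (cov Y x v) (Z x) + g.val x (Y x) (cov Z x v)

/-- The curvature `R(X, Y) Z = ∇_X ∇_Y Z - ∇_Y ∇_X Z - ∇_[X, Y] Z`. -/
def curvature (cov : CovariantDerivative 𝓘(ℝ, E) E (TangentSpace 𝓘(ℝ, E) : M → Type _))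
    (X Y Z : Π x : M, TangentSpace 𝓘(ℝ, E) x) (x : M) : TangentSpace 𝓘(ℝ, E) x :=
  cov (fun y => cov Z y (Y y)) x (X x) - cov (fun y => cov Z y (X y)) x (Y x)
    - cov Z x (VectorField.mlieBracket 𝓘(ℝ, E) X Y x)

/-- `e` is a smooth frame of `TM` on the open set `U` and `θ` is its dual coframe on `U`
(both are arbitrary outside `U`). -/
structure IsFrameOn {ι : Type*} [DecidableEq ι] (U : Set M)
    (e : ι → Π x : M, TangentSpace 𝓘(ℝ, E) x) (θ : ι → Π x : M, Cotangent (E := E) x) :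
    Prop where
  isOpen : IsOpen U
  frame : IsLocalFrameOn 𝓘(ℝ, E) E ∞ e U
  dual (x : M) (hx : x ∈ U) (μ ν : ι) : θ μ x (e ν x) = if μ = ν then 1 else 0

/-- The connection coefficients `γ^ρ_{αβ}`, with `∇_{e_α} e_β = γ^ρ_{αβ} e_ρ`. -/
def connectionCoeff {ι : Type*}
    (cov : CovariantDerivative 𝓘(ℝ, E) E (TangentSpace 𝓘(ℝ, E) : M → Type _))
    (e : ι → Π x : M, TangentSpace 𝓘(ℝ, E) x) (θ : ι → Π x : M, Cotangent (E := E) x)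
    (ρ α β : ι) (x : M) : ℝ :=
  θ ρ x (cov (e β) x (e α x))

/-- The components `R_ρ^μ_{αβ}` of the Riemann tensor, with
`R(e_α, e_β) e_ρ = R_ρ^μ_{αβ} e_μ`. -/
def riemannCoeff {ι : Type*}
    (cov : CovariantDerivative 𝓘(ℝ, E) E (TangentSpace 𝓘(ℝ, E) : M → Type _))
    (e : ι → Π x : M, TangentSpace 𝓘(ℝ, E) x) (θ : ι → Π x : M, Cotangent (E := E) x)
    (ρ μ α β : ι) (x : M) : ℝ :=
  θ μ x (curvature cov (e α) (e β) (e ρ) x)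

/-- The components of the Ricci tensor, with the sign convention `R_{μβ} = R_μ^α_{βα}`, i.e.
`Ric(Y, Z) = tr (X ↦ R(Z, X) Y)`. -/
def ricciCoeff {ι : Type*} [Fintype ι]
    (cov : CovariantDerivative 𝓘(ℝ, E) E (TangentSpace 𝓘(ℝ, E) : M → Type _))
    (e : ι → Π x : M, TangentSpace 𝓘(ℝ, E) x) (θ : ι → Π x : M, Cotangent (E := E) x)
    (μ β : ι) (x : M) : ℝ :=
  ∑ α, riemannCoeff cov e θ μ α β α x

namespace PseudoRiemannianMetric

variable (g : PseudoRiemannianMetric E M)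

/-- The metric at `x` as a bilinear form on `T_x M`. -/
def bilin (x : M) : LinearMap.BilinForm ℝ (TangentSpace 𝓘(ℝ, E) x) :=
  LinearMap.mk₂ ℝ (fun v w => g.val x v w) (by simp) (by simp) (by simp) (by simp)

theorem bilin_nondegenerate (x : M) : (g.bilin x).Nondegenerate := by
  refine ⟨fun v hv => g.nondegenerate x v hv, fun v hv => g.nondegenerate x v fun w => ?_⟩
  rw [g.symm]
  exact hv w

/-- The index-raising isomorphism `T*_x M ≃ T_x M`, the inverse of `v ↦ g(v, ·)`. -/
def sharp (x : M) : Cotangent (E := E) x ≃ₗ[ℝ] TangentSpace 𝓘(ℝ, E) x :=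
  ((g.bilin x).toDual (g.bilin_nondegenerate x)).symm

/-- The metric on the cotangent space `T*_x M`. -/
def cometric (x : M) : LinearMap.BilinForm ℝ (Cotangent (E := E) x) :=
  (g.bilin x).compl₁₂ (g.sharp x).toLinearMap (g.sharp x).toLinearMap

/-- The fibre at `x` of the Clifford bundle of differential forms `Cℓ(T*M)`. -/
abbrev Cl (x : M) : Type _ := CliffordAlgebra (g.cometric x).toQuadraticMap

/-- A `1`-form field as a section of the Clifford bundle. -/
def oneForm (α : Π x : M, Cotangent (E := E) x) (x : M) : g.Cl x :=
  CliffordAlgebra.ι (g.cometric x).toQuadraticMap (α x)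

/-- The canonical isomorphism of `Cℓ(T*_x M)` with `Λ T*_x M`. -/
def toForm (x : M) : g.Cl x ≃ₗ[ℝ] ExteriorAlgebra ℝ (Cotangent (E := E) x) :=
  CliffordAlgebra.equivExterior (g.cometric x).toQuadraticMap

/-- A section of the Clifford bundle, as a multiform with components in the coordinate coframe of
the chart at `x₀`: a function with values in `Λ E*`, meaningful on the domain of that chart. -/
def localRep (F : Π x : M, g.Cl x) (x₀ x : M) : ExteriorAlgebra ℝ (Module.Dual ℝ E) :=
  ExteriorAlgebra.map
    (((trivializationAt E (TangentSpace 𝓘(ℝ, E)) x₀).symmL ℝ x).toLinearMap.dualMap)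
    (g.toForm x (F x))

/-- `F` is a smooth section of the Clifford bundle on `U`: its components in the coordinate
coframes are smooth. -/
def SmoothOn (F : Π x : M, g.Cl x) (U : Set M) : Prop :=
  ∀ (x₀ : M) (φ : ExteriorAlgebra ℝ (Module.Dual ℝ E) →ₗ[ℝ] ℝ),
    ContMDiffOn 𝓘(ℝ, E) 𝓘(ℝ, ℝ) ∞ (fun x => φ (g.localRep F x₀ x))
      (U ∩ (trivializationAt E (TangentSpace 𝓘(ℝ, E) : M → Type _) x₀).baseSet)

/-- The derivative at `x` along `v` of the components of `F` in the coordinate coframe at `x`. -/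
def componentDeriv (F : Π x : M, g.Cl x) (x : M) (v : TangentSpace 𝓘(ℝ, E) x) :
    ExteriorAlgebra ℝ (Module.Dual ℝ E) :=
  let b := (Module.finBasis ℝ (Module.Dual ℝ E)).ExteriorAlgebra
  ∑ s, mvfderiv 𝓘(ℝ, E) (fun y => b.coord s (g.localRep F x y)) x v • b s

end PseudoRiemannianMetric

/-- The vector field with value `w` at `x` and constant components in the chart at `x`. -/
def constField (x : M) (w : TangentSpace 𝓘(ℝ, E) x) (y : M) : TangentSpace 𝓘(ℝ, E) y :=
  (trivializationAt E (TangentSpace 𝓘(ℝ, E)) x).symmL ℝ y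
    ((trivializationAt E (TangentSpace 𝓘(ℝ, E)) x).continuousLinearMapAt ℝ x w)

theorem mdifferentiableAt_constField (x : M) (w : TangentSpace 𝓘(ℝ, E) x) :
    MDiffAt (T% (constField x w)) x := by
  refine (FiberBundle.mdifferentiableAt_extend 𝓘(ℝ, E) E w).congr_of_eventuallyEq ?_
  have hx := FiberBundle.mem_baseSet_trivializationAt' (F := E)
    (E := (TangentSpace 𝓘(ℝ, E) : M → Type _)) x
  filter_upwards [(trivializationAt E (TangentSpace 𝓘(ℝ, E)) x).open_baseSet.mem_nhds hx]
    with y hy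
  simp only [constField, FiberBundle.extend]
  rw [Trivialization.symmL_apply _ hy, Trivialization.continuousLinearMapAt_apply,
    Trivialization.linearMapAt_apply, if_pos hx]

/-- The endomorphism `w ↦ ∇_v W` of `T_x M`, where `W` is the vector field with `W(x) = w` and
constant components in the chart at `x`. -/
def connectionEnd (cov : CovariantDerivative 𝓘(ℝ, E) E (TangentSpace 𝓘(ℝ, E) : M → Type _))
    (x : M) (v : TangentSpace 𝓘(ℝ, E) x) :
    TangentSpace 𝓘(ℝ, E) x →ₗ[ℝ] TangentSpace 𝓘(ℝ, E) x where
  toFun w := cov (constField x w) x v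
  map_add' w w' := by
    have h : constField x (w + w') = constField x w + constField x w' := by
      funext y
      simp [constField]
    rw [h, cov.isCovariantDerivativeOnUniv.add (mdifferentiableAt_constField x w)
      (mdifferentiableAt_constField x w')]
    rfl
  map_smul' c w := by
    have h : constField x (c • w) = (fun _ : M => c) • constField x w := by
      funext y
      simp [constField]
    rw [h, cov.isCovariantDerivativeOnUniv.leibniz (mdifferentiableAt_constField x w)
      mdifferentiableAt_const]
    simp [mvfderiv]

namespace PseudoRiemannianMetric

variable (g : PseudoRiemannianMetric E M)
  (cov : CovariantDerivative 𝓘(ℝ, E) E (TangentSpace 𝓘(ℝ, E) : M → Type _))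

/-- The covariant derivative `(∇_v F)(x)` of a section of the Clifford bundle: the derivative of
its components in the coordinate coframe `dxⁱ` at `x`, plus the derivation that extends
`dxⁱ ↦ ∇_v dxⁱ = - dxⁱ(∇_v ·)`. -/
def cliffordCov (F : Π x : M, g.Cl x) (x : M) (v : TangentSpace 𝓘(ℝ, E) x) : g.Cl x :=
  (g.toForm x).symm
    (ExteriorAlgebra.map
        (((trivializationAt E (TangentSpace 𝓘(ℝ, E)) x).continuousLinearMapAt ℝ x
          ).toLinearMap.dualMap) (g.componentDeriv F x v)
      + exteriorDerivation (-(connectionEnd cov x v).dualMap) (g.toForm x (F x)))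

variable {ι : Type*} [Fintype ι] (e : ι → Π x : M, TangentSpace 𝓘(ℝ, E) x)
  (θ : ι → Π x : M, Cotangent (E := E) x)

/-- The Dirac operator `∂ = θ^α ∇_{e_α}`. -/
def dirac (F : Π x : M, g.Cl x) (x : M) : g.Cl x :=
  ∑ α, g.oneForm (θ α) x * g.cliffordCov cov F x (e α x)

/-- `(∇_{e_α} ∇_{e_β} - γ^ρ_{αβ} ∇_{e_ρ}) F`. -/
def secondCov (α β : ι) (F : Π x : M, g.Cl x) (x : M) : g.Cl x :=
  g.cliffordCov cov (fun y => g.cliffordCov cov F y (e β y)) x (e α x)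
    - ∑ ρ, connectionCoeff cov e θ ρ α β x • g.cliffordCov cov F x (e ρ x)

/-- The covariant D'Alembertian `∂ · ∂ = g^{αβ} (∇_{e_α} ∇_{e_β} - γ^ρ_{αβ} ∇_{e_ρ})`. -/
def dAlembertian (F : Π x : M, g.Cl x) (x : M) : g.Cl x :=
  ∑ α, ∑ β, g.cometric x (θ α x) (θ β x) • g.secondCov cov e θ α β F x

/-- The Ricci operator `∂ ∧ ∂ = θ^α ∧ θ^β (∇_{e_α} ∇_{e_β} - γ^ρ_{αβ} ∇_{e_ρ})`. -/
def ricciOp (F : Π x : M, g.Cl x) (x : M) : g.Cl x :=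
  ∑ α, ∑ β, cliffordWedge (g.oneForm (θ α) x) (g.oneForm (θ β) x) * g.secondCov cov e θ α β F x

/-- The exterior part `(∂ ∧ ∂) ∧ = θ^α ∧ θ^β ∧ (∇_{e_α} ∇_{e_β} - γ^ρ_{αβ} ∇_{e_ρ})` of the Ricci
operator. -/
def ricciOpWedge (F : Π x : M, g.Cl x) (x : M) : g.Cl x :=
  ∑ α, ∑ β, cliffordWedge (cliffordWedge (g.oneForm (θ α) x) (g.oneForm (θ β) x))
    (g.secondCov cov e θ α β F x)

/-- The curvature `2`-forms `ℛ_ρ^μ = ½ R_ρ^μ_{αβ} θ^α ∧ θ^β`. -/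
def curvatureForm (ρ μ : ι) (x : M) : g.Cl x :=
  (1 / 2 : ℝ) • ∑ α, ∑ β, riemannCoeff cov e θ ρ μ α β x •
    cliffordWedge (g.oneForm (θ α) x) (g.oneForm (θ β) x)

/-- The mixed components `R^μ_β = g^{μν} R_{νβ}` of the Ricci tensor. -/
def ricciMixed (μ β : ι) (x : M) : ℝ :=
  ∑ ν, g.cometric x (θ μ x) (θ ν x) * ricciCoeff cov e θ ν β x

/-- The Ricci `1`-forms `ℛ^μ = R^μ_β θ^β`. -/
def ricciForm (μ : ι) (x : M) : Cotangent (E := E) x :=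
  ∑ β, ricciMixed g cov e θ μ β x • θ β x

end PseudoRiemannianMetric

end Geometry

/-- `η = diag(1, -1, -1, -1)`. -/
def minkowski : Matrix (Fin 4) (Fin 4) ℝ := Matrix.diagonal ![1, -1, -1, -1]

end

/-!
Every tensorial statement below is reduced to the second covariant derivative
`∇²_{v, Y} F = ∇_v ∇_Y F - ∇_{∇_v Y} F` (`hessian`), which is linear in `v` and tensorial in `Y`
(`hessian_sum_smul`); `∇²_{e_α, e_β}` is the operator `∇_{e_α} ∇_{e_β} - γ^ρ_{αβ} ∇_{e_ρ}`. Hence a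
contraction of `∇²_{αβ}` with any bilinear function of `θ^α` and `θ^β` is independent of the frame
(`secondCov_contract_eq`).

The square of the Dirac operator. Clifford multiplication by a one-form is the exterior product plus
the interior product with the metrically dual vector (`ι_mul_eq`). The covariant derivative is a
derivation of the exterior product, and a metric connection commutes with raising indices
(`sharp_formCov`), so it also obeys the Leibniz rule for the Clifford product with a one-form
(`cliffordCov_oneForm_mul`). In `∂² F` the terms with `∇ θ^β = - γ^β_{·ρ} θ^ρ` then combine with
`∇_α ∇_β F` to `θ^α θ^β ∇²_{αβ} F` (`dirac_dirac`), and `θ^α θ^β = θ^α ∧ θ^β + g^{αβ}` splits the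
result.

The Ricci operator on a coframe. As `θ^α ∧ θ^β` is antisymmetric, only the commutator
`(∇²_{αβ} - ∇²_{βα}) θ^μ = - R_ρ^μ_{αβ} θ^ρ` matters (`secondCov_sub_secondCov`; this uses that the
torsion vanishes), so `(∂ ∧ ∂) θ^μ = - ℛ_ρ^μ θ^ρ`. In the expansion
`(θ^α ∧ θ^β) θ^ρ = θ^α ∧ θ^β ∧ θ^ρ + g^{βρ} θ^α - g^{αρ} θ^β` (`wedge_mul_ι`) the `3`-form part drops
out by the first Bianchi identity (`IsLeviCivita.first_bianchi`), which is the Jacobi identity for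
vector fields, and the one-form part is `g^{ρα} R_ρ^μ_{αβ} θ^β`. This is the Ricci form because the
Riemann tensor is antisymmetric in each of its pairs of indices (`ricciMixed_eq`); the antisymmetry
in the metric pair comes from differentiating `g(Z, W)` twice, with
`[X, Y] f = X (Y f) - Y (X f)` (`mvfderiv_mlieBracket`) read off from the Jacobi identity for
`X`, `Y`, `f Z`.

Exterior and Clifford algebras carry no norm in Mathlib, so smoothness and derivatives of functions
with values in them are expressed through linear functionals (`FunSmoothOn`, `vecDeriv`).
-/

open Set Bundle
open scoped Manifold ContDiff Topology

noncomputable section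

set_option linter.unusedSectionVars false

/-! ### Calculus with values in a finite-dimensional space without a norm -/

section VectorValued

variable {E : Type*} [NormedAddCommGroup E] [NormedSpace ℝ E]
  {M : Type*} [TopologicalSpace M] [ChartedSpace E M]
  {V₁ V₂ V₃ : Type*} [AddCommGroup V₁] [Module ℝ V₁] [AddCommGroup V₂] [Module ℝ V₂]
  [AddCommGroup V₃] [Module ℝ V₃]

variable (E) in
/-- Smoothness on `U` of a function with values in a real vector space that carries no norm:
all linear functionals of it are smooth. -/
def FunSmoothOn (f : M → V₁) (U : Set M) : Prop :=
  ∀ φ : V₁ →ₗ[ℝ] ℝ, ContMDiffOn 𝓘(ℝ, E) 𝓘(ℝ, ℝ) ∞ (fun x => φ (f x)) U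

/-- The derivative along `v` of a function with values in a finite-dimensional real vector space
that carries no norm, taken component by component. -/
def vecDeriv [FiniteDimensional ℝ V₁] (f : M → V₁) (x : M) (v : TangentSpace 𝓘(ℝ, E) x) : V₁ :=
  ∑ s, mvfderiv 𝓘(ℝ, E) (fun y => (Module.finBasis ℝ V₁).coord s (f y)) x v •
    Module.finBasis ℝ V₁ s

theorem mvfderiv_congr_of_eventuallyEq {f h : M → ℝ} {x : M} (H : f =ᶠ[𝓝 x] h) :
    mvfderiv 𝓘(ℝ, E) f x = mvfderiv 𝓘(ℝ, E) h x := by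
  ext v
  have := H.mfderiv_eq (I := 𝓘(ℝ, E)) (I' := 𝓘(ℝ, ℝ))
  simp only [mvfderiv, ContinuousLinearMap.comp_apply]
  rw [this]
  rfl

theorem mvfderiv_finset_sum {κ : Type*} (s : Finset κ) {f : κ → M → ℝ} {x : M}
    (hf : ∀ i ∈ s, MDiffAt (f i) x) :
    MDiffAt (fun y => ∑ i ∈ s, f i y) x ∧
    mvfderiv 𝓘(ℝ, E) (fun y => ∑ i ∈ s, f i y) x = ∑ i ∈ s, mvfderiv 𝓘(ℝ, E) (f i) x := by
  classical
  induction s using Finset.induction_on with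
  | empty =>
    simp only [Finset.sum_empty]
    exact ⟨mdifferentiableAt_const, mvfderiv_const 0⟩
  | insert a s ha ih =>
    obtain ⟨h1, h2⟩ := ih fun i hi => hf i (Finset.mem_insert_of_mem hi)
    have ha' := hf a (Finset.mem_insert_self a s)
    simp only [Finset.sum_insert ha]
    refine ⟨ha'.add h1, ?_⟩
    rw [← h2]
    exact mvfderiv_add ha' h1

theorem mvfderiv_mul_const {f : M → ℝ} {x : M} (hf : MDiffAt f x) (c : ℝ)
    (v : TangentSpace 𝓘(ℝ, E) x) :
    mvfderiv 𝓘(ℝ, E) (fun y => f y * c) x v = mvfderiv 𝓘(ℝ, E) f x v * c := by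
  have := mvfderiv_mul (I := 𝓘(ℝ, E)) hf (mdifferentiableAt_const (c := c))
  have h2 : mvfderiv 𝓘(ℝ, E) (fun _ : M => c) x = 0 := mvfderiv_const c
  have h3 := congrArg (fun L => L v) this
  change mvfderiv 𝓘(ℝ, E) (fun y => f y * c) x v = _ at h3
  rw [h3, h2]
  simp [mul_comm]

theorem ContMDiffOn.mdiffAt {f : M → ℝ} {U : Set M} (hf : ContMDiffOn 𝓘(ℝ, E) 𝓘(ℝ, ℝ) ∞ f U)
    (hU : IsOpen U) {x : M} (hx : x ∈ U) : MDiffAt f x :=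
  (hf.contMDiffAt (hU.mem_nhds hx)).mdifferentiableAt (by simp)

variable {f f' : M → V₁} {h : M → V₂} {U : Set M} {x : M}

theorem funSmoothOn_real {f : M → ℝ} :
    FunSmoothOn E f U ↔ ContMDiffOn 𝓘(ℝ, E) 𝓘(ℝ, ℝ) ∞ f U := by
  refine ⟨fun H => H LinearMap.id, fun H φ => ?_⟩
  have : (fun x => φ (f x)) = fun x => f x * φ 1 := by
    funext x
    rw [← smul_eq_mul, ← map_smul, smul_eq_mul, mul_one]
  rw [this]
  exact H.mul contMDiffOn_const

theorem FunSmoothOn.mono (hf : FunSmoothOn E f U) {U' : Set M} (hU : U' ⊆ U) :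
    FunSmoothOn E f U' :=
  fun φ => (hf φ).mono hU

theorem FunSmoothOn.congr (hf : FunSmoothOn E f U) (hff' : ∀ y ∈ U, f' y = f y) :
    FunSmoothOn E f' U :=
  fun φ => (hf φ).congr fun y hy => by rw [hff' y hy]

theorem funSmoothOn_const (c : V₁) : FunSmoothOn E (fun _ : M => c) U :=
  fun _ => contMDiffOn_const

theorem FunSmoothOn.add (hf : FunSmoothOn E f U) (hf' : FunSmoothOn E f' U) :
    FunSmoothOn E (fun y => f y + f' y) U := fun φ => by
  simp only [map_add]
  exact (hf φ).add (hf' φ)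

theorem FunSmoothOn.sum {κ : Type*} (s : Finset κ) {f : κ → M → V₁}
    (hf : ∀ i ∈ s, FunSmoothOn E (f i) U) : FunSmoothOn E (fun y => ∑ i ∈ s, f i y) U :=
  fun φ => by
    simpa only [map_sum] using contMDiffOn_finsetSum fun i hi => hf i hi φ

theorem FunSmoothOn.linearMap (hf : FunSmoothOn E f U) (L : V₁ →ₗ[ℝ] V₂) :
    FunSmoothOn E (fun y => L (f y)) U :=
  fun φ => hf (φ.comp L)

theorem apply_eq_sum_coord {κ : Type*} [Fintype κ] (b : Module.Basis κ ℝ V₁) (φ : V₁ →ₗ[ℝ] ℝ)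
    (w : V₁) : φ w = ∑ s, b.coord s w * φ (b s) := by
  have h := congrArg φ (b.sum_repr w)
  rw [map_sum] at h
  simpa using h.symm

theorem funSmoothOn_of_coord {κ : Type*} [Fintype κ] (b : Module.Basis κ ℝ V₁)
    (hf : ∀ s, ContMDiffOn 𝓘(ℝ, E) 𝓘(ℝ, ℝ) ∞ (fun y => b.coord s (f y)) U) :
    FunSmoothOn E f U := fun φ => by
  have : (fun y => φ (f y)) = fun y => ∑ s, b.coord s (f y) * φ (b s) :=
    funext fun y => apply_eq_sum_coord b φ (f y)
  rw [this]
  exact contMDiffOn_finsetSum fun i _ => (hf i).mul contMDiffOn_const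

theorem apply_vecDeriv [FiniteDimensional ℝ V₁] (hf : FunSmoothOn E f U) (hU : IsOpen U)
    (hx : x ∈ U) (v : TangentSpace 𝓘(ℝ, E) x) (φ : V₁ →ₗ[ℝ] ℝ) :
    φ (vecDeriv f x v) = mvfderiv 𝓘(ℝ, E) (fun y => φ (f y)) x v := by
  set b := Module.finBasis ℝ V₁
  have : (fun y => φ (f y)) = fun y => ∑ s, b.coord s (f y) * φ (b s) :=
    funext fun y => apply_eq_sum_coord b φ (f y)
  have hd : ∀ s, MDiffAt (fun y => b.coord s (f y)) x := fun s => (hf (b.coord s)).mdiffAt hU hx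
  have key := (mvfderiv_finset_sum Finset.univ
    (f := fun s y => b.coord s (f y) * φ (b s)) fun i _ =>
      (hd i).mul (mdifferentiableAt_const (c := φ (b i)))).2
  rw [this, key]
  simp only [vecDeriv, map_sum, map_smul, sum_apply]
  refine Finset.sum_congr rfl fun s _ => ?_
  exact (mvfderiv_mul_const (hd s) (φ (b s)) v).symm

theorem eq_of_forall_functional {a b : V₁} (H : ∀ φ : V₁ →ₗ[ℝ] ℝ, φ a = φ b) : a = b := by
  rw [← sub_eq_zero]
  refine (Module.forall_dual_apply_eq_zero_iff ℝ _).1 fun φ => ?_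
  rw [map_sub, H, sub_self]

theorem vecDeriv_congr [FiniteDimensional ℝ V₁] (H : f =ᶠ[𝓝 x] f')
    (v : TangentSpace 𝓘(ℝ, E) x) : vecDeriv f x v = vecDeriv f' x v := by
  unfold vecDeriv
  refine Finset.sum_congr rfl fun s _ => ?_
  have h := mvfderiv_congr_of_eventuallyEq (E := E) (H.fun_comp ((Module.finBasis ℝ V₁).coord s))
  exact congrArg (fun L : TangentSpace 𝓘(ℝ, E) x →L[ℝ] ℝ => L v • Module.finBasis ℝ V₁ s) h

theorem vecDeriv_const [FiniteDimensional ℝ V₁] (c : V₁) (v : TangentSpace 𝓘(ℝ, E) x) :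
    vecDeriv (fun _ : M => c) x v = 0 := by
  refine Finset.sum_eq_zero fun s _ => ?_
  have h2 : mvfderiv 𝓘(ℝ, E) (fun _ : M => (Module.finBasis ℝ V₁).coord s c) x = 0 :=
    mvfderiv_const _
  rw [h2]
  simp

theorem vecDeriv_real {f : M → ℝ} (hf : FunSmoothOn E f U) (hU : IsOpen U)
    (hx : x ∈ U) (v : TangentSpace 𝓘(ℝ, E) x) : vecDeriv f x v = mvfderiv 𝓘(ℝ, E) f x v :=
  apply_vecDeriv hf hU hx v LinearMap.id

theorem vecDeriv_add [FiniteDimensional ℝ V₁] (hf : FunSmoothOn E f U) (hf' : FunSmoothOn E f' U)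
    (hU : IsOpen U) (hx : x ∈ U) (v : TangentSpace 𝓘(ℝ, E) x) :
    vecDeriv (fun y => f y + f' y) x v = vecDeriv f x v + vecDeriv f' x v := by
  refine eq_of_forall_functional fun φ => ?_
  rw [apply_vecDeriv (hf.add hf') hU hx, map_add, apply_vecDeriv hf hU hx,
    apply_vecDeriv hf' hU hx]
  simp only [map_add]
  exact congrArg (fun L => L v) (mvfderiv_add ((hf φ).mdiffAt hU hx) ((hf' φ).mdiffAt hU hx))

theorem vecDeriv_linearMap [FiniteDimensional ℝ V₁] [FiniteDimensional ℝ V₂]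
    (hf : FunSmoothOn E f U) (hU : IsOpen U) (hx : x ∈ U) (v : TangentSpace 𝓘(ℝ, E) x)
    (L : V₁ →ₗ[ℝ] V₂) : vecDeriv (fun y => L (f y)) x v = L (vecDeriv f x v) := by
  refine eq_of_forall_functional fun φ => ?_
  rw [apply_vecDeriv (hf.linearMap L) hU hx]
  exact (apply_vecDeriv hf hU hx v (φ.comp L)).symm

theorem FunSmoothOn.bilin [FiniteDimensional ℝ V₁] [FiniteDimensional ℝ V₂]
    (hf : FunSmoothOn E f U) (hh : FunSmoothOn E h U) (B : V₁ →ₗ[ℝ] V₂ →ₗ[ℝ] V₃) :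
    FunSmoothOn E (fun y => B (f y) (h y)) U := fun φ => by
  set b := Module.finBasis ℝ V₁
  have : (fun y => φ (B (f y) (h y))) = fun y => ∑ s, b.coord s (f y) * φ (B (b s) (h y)) :=
    funext fun y => apply_eq_sum_coord b (φ ∘ₗ B.flip (h y)) (f y)
  rw [this]
  exact contMDiffOn_finsetSum fun i _ =>
    (hf (b.coord i)).mul (hh (φ.comp (B (b i))))

theorem vecDeriv_bilin [FiniteDimensional ℝ V₁] [FiniteDimensional ℝ V₂] [FiniteDimensional ℝ V₃]
    (hf : FunSmoothOn E f U) (hh : FunSmoothOn E h U) (hU : IsOpen U) (hx : x ∈ U)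
    (v : TangentSpace 𝓘(ℝ, E) x) (B : V₁ →ₗ[ℝ] V₂ →ₗ[ℝ] V₃) :
    vecDeriv (fun y => B (f y) (h y)) x v = B (vecDeriv f x v) (h x) + B (f x) (vecDeriv h x v) := by
  refine eq_of_forall_functional fun φ => ?_
  rw [apply_vecDeriv (hf.bilin hh B) hU hx]
  set b := Module.finBasis ℝ V₁
  have : (fun y => φ (B (f y) (h y))) = fun y => ∑ s, b.coord s (f y) * φ (B (b s) (h y)) :=
    funext fun y => apply_eq_sum_coord b (φ ∘ₗ B.flip (h y)) (f y)
  have h1 : ∀ s, MDiffAt (fun y => b.coord s (f y)) x := fun s => (hf (b.coord s)).mdiffAt hU hx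
  have h2 : ∀ s, MDiffAt (fun y => φ (B (b s) (h y))) x :=
    fun s => (hh (φ.comp (B (b s)))).mdiffAt hU hx
  have key := (mvfderiv_finset_sum Finset.univ
    (f := fun s y => b.coord s (f y) * φ (B (b s) (h y))) fun i _ => (h1 i).mul (h2 i)).2
  rw [this, key, sum_apply]
  have e1 : φ (B (vecDeriv f x v) (h x)) =
      ∑ s, b.coord s (vecDeriv f x v) * φ (B (b s) (h x)) :=
    apply_eq_sum_coord b (φ ∘ₗ B.flip (h x)) _
  have e2 : φ (B (f x) (vecDeriv h x v)) =
      ∑ s, b.coord s (f x) * φ (B (b s) (vecDeriv h x v)) :=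
    apply_eq_sum_coord b (φ ∘ₗ B.flip (vecDeriv h x v)) _
  rw [map_add, e1, e2, ← Finset.sum_add_distrib]
  refine Finset.sum_congr rfl fun s _ => ?_
  have key := congrArg (fun L => L v) (mvfderiv_mul (I := 𝓘(ℝ, E)) (h1 s) (h2 s))
  refine key.trans ?_
  have e3 := apply_vecDeriv hf hU hx v (b.coord s)
  have e4 := apply_vecDeriv hh hU hx v (φ.comp (B (b s)))
  simp only [LinearMap.comp_apply] at e4
  rw [e3, e4]
  simp
  ring

theorem FunSmoothOn.smul [FiniteDimensional ℝ V₁] {c : M → ℝ} (hc : FunSmoothOn E c U)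
    (hf : FunSmoothOn E f U) : FunSmoothOn E (fun y => c y • f y) U :=
  hc.bilin hf (LinearMap.lsmul ℝ V₁)

theorem vecDeriv_smul [FiniteDimensional ℝ V₁] {c : M → ℝ} (hc : FunSmoothOn E c U)
    (hf : FunSmoothOn E f U) (hU : IsOpen U) (hx : x ∈ U) (v : TangentSpace 𝓘(ℝ, E) x) :
    vecDeriv (fun y => c y • f y) x v =
      mvfderiv 𝓘(ℝ, E) c x v • f x + c x • vecDeriv f x v := by
  rw [← vecDeriv_real hc hU hx]
  exact vecDeriv_bilin hc hf hU hx v (LinearMap.lsmul ℝ V₁)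

theorem vecDeriv_linear_vec [FiniteDimensional ℝ V₁] :
    IsLinearMap ℝ (fun v : TangentSpace 𝓘(ℝ, E) x => vecDeriv f x v) where
  map_add v w := by simp [vecDeriv, add_smul, Finset.sum_add_distrib]
  map_smul c v := by simp [vecDeriv, mul_smul, Finset.smul_sum]

theorem contMDiffOn_matrix_det {κ : Type*} [Fintype κ] [DecidableEq κ] {A : M → Matrix κ κ ℝ}
    (hA : ∀ i j, ContMDiffOn 𝓘(ℝ, E) 𝓘(ℝ, ℝ) ∞ (fun y => A y i j) U) :
    ContMDiffOn 𝓘(ℝ, E) 𝓘(ℝ, ℝ) ∞ (fun y => (A y).det) U := by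
  simp only [Matrix.det_apply']
  exact contMDiffOn_finsetSum fun σ _ => contMDiffOn_const.mul
    (contMDiffOn_finsetProd fun i _ => hA _ _)

theorem contMDiffOn_matrix_inv {κ : Type*} [Fintype κ] [DecidableEq κ] {A : M → Matrix κ κ ℝ}
    (hA : ∀ i j, ContMDiffOn 𝓘(ℝ, E) 𝓘(ℝ, ℝ) ∞ (fun y => A y i j) U)
    (hdet : ∀ y ∈ U, (A y).det ≠ 0) (i j : κ) :
    ContMDiffOn 𝓘(ℝ, E) 𝓘(ℝ, ℝ) ∞ (fun y => (A y)⁻¹ i j) U := by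
  simp only [Matrix.inv_def, Matrix.smul_apply, Matrix.adjugate_apply, Ring.inverse_eq_inv']
  refine ContMDiffOn.mul ((contMDiffOn_matrix_det hA).inv₀ hdet) (contMDiffOn_matrix_det ?_)
  intro k l
  simp only [Matrix.updateRow_apply]
  split_ifs
  · exact contMDiffOn_const
  · exact hA k l

end VectorValued
/-! ### Smooth vector fields in charts -/

section VectorFields

variable {E : Type*} [NormedAddCommGroup E] [NormedSpace ℝ E]
  {M : Type*} [TopologicalSpace M] [ChartedSpace E M] [IsManifold 𝓘(ℝ, E) ∞ M]

/-- The domain of the trivialization of `TM` given by the chart at `x₀`. -/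
def chartDomain (x₀ : M) : Set M :=
  (trivializationAt E (TangentSpace 𝓘(ℝ, E) : M → Type _) x₀).baseSet

/-- The components of a tangent vector at `y` in the chart at `x₀`. -/
def toChart (x₀ y : M) : TangentSpace 𝓘(ℝ, E) y →ₗ[ℝ] E :=
  ((trivializationAt E (TangentSpace 𝓘(ℝ, E)) x₀).continuousLinearMapAt ℝ y).toLinearMap

/-- The tangent vector at `y` with given components in the chart at `x₀`. For a fixed `u : E`, the
map `y ↦ ofChart x₀ y u` is the vector field with constant components `u`. -/
def ofChart (x₀ y : M) : E →ₗ[ℝ] TangentSpace 𝓘(ℝ, E) y :=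
  ((trivializationAt E (TangentSpace 𝓘(ℝ, E)) x₀).symmL ℝ y).toLinearMap

theorem isOpen_chartDomain (x₀ : M) : IsOpen (chartDomain (E := E) x₀) :=
  (trivializationAt E (TangentSpace 𝓘(ℝ, E) : M → Type _) x₀).open_baseSet

theorem mem_chartDomain (x : M) : x ∈ chartDomain (E := E) x :=
  FiberBundle.mem_baseSet_trivializationAt' (F := E)
    (E := (TangentSpace 𝓘(ℝ, E) : M → Type _)) x

theorem toChart_ofChart {x₀ y : M} (hy : y ∈ chartDomain (E := E) x₀) (u : E) :
    toChart x₀ y (ofChart x₀ y u) = u :=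
  (trivializationAt E (TangentSpace 𝓘(ℝ, E)) x₀).continuousLinearMapAt_symmL (R := ℝ) hy u

theorem ofChart_toChart {x₀ y : M} (hy : y ∈ chartDomain (E := E) x₀)
    (v : TangentSpace 𝓘(ℝ, E) y) : ofChart x₀ y (toChart x₀ y v) = v :=
  (trivializationAt E (TangentSpace 𝓘(ℝ, E)) x₀).symmL_continuousLinearMapAt (R := ℝ) hy v

theorem toChart_eq_snd {x₀ y : M} (hy : y ∈ chartDomain (E := E) x₀)
    (v : TangentSpace 𝓘(ℝ, E) y) :
    toChart x₀ y v = (trivializationAt E (TangentSpace 𝓘(ℝ, E) : M → Type _) x₀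
      (TotalSpace.mk' E y v)).2 := by
  change (trivializationAt E (TangentSpace 𝓘(ℝ, E)) x₀).continuousLinearMapAt ℝ y v = _
  rw [Trivialization.continuousLinearMapAt_apply, Trivialization.linearMapAt_apply]
  exact if_pos hy

/-- Smoothness of a vector field on `U`. -/
abbrev SmoothField (Y : Π x : M, TangentSpace 𝓘(ℝ, E) x) (U : Set M) : Prop :=
  ContMDiffOn 𝓘(ℝ, E) (𝓘(ℝ, E).prod 𝓘(ℝ, E)) ∞ (fun x => TotalSpace.mk' E x (Y x)) U

variable {U : Set M} {X Y Z : Π x : M, TangentSpace 𝓘(ℝ, E) x} {x : M}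

theorem SmoothField.mdiffAt (hY : SmoothField Y U) (hU : IsOpen U) (hx : x ∈ U) :
    MDiffAt (T% Y) x :=
  (hY.contMDiffAt (hU.mem_nhds hx)).mdifferentiableAt (by simp)

theorem contMDiffOn_mvfderiv_apply {f : M → ℝ} (hf : ContMDiffOn 𝓘(ℝ, E) 𝓘(ℝ, ℝ) ∞ f U)
    (hX : SmoothField X U) (hU : IsOpen U) :
    ContMDiffOn 𝓘(ℝ, E) 𝓘(ℝ, ℝ) ∞ (fun y => mvfderiv 𝓘(ℝ, E) f y (X y)) U := by
  have h1 := hf.contMDiffOn_tangentMapWithin (m := ∞) (by simp) hU.uniqueMDiffOn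
  have h2 := (contMDiff_snd_tangentBundle_modelSpace ℝ 𝓘(ℝ, ℝ) (n := ∞)).comp_contMDiffOn
    (h1.comp hX fun y hy => hy)
  refine h2.congr fun y hy => ?_
  change mvfderiv 𝓘(ℝ, E) f y (X y) = mfderivWithin 𝓘(ℝ, E) 𝓘(ℝ, ℝ) f U y (X y)
  rw [mfderivWithin_of_isOpen hU hy]
  rfl

variable [FiniteDimensional ℝ E]

theorem funSmoothOn_model {f : M → E} :
    FunSmoothOn E f U ↔ ContMDiffOn 𝓘(ℝ, E) 𝓘(ℝ, E) ∞ f U := by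
  refine ⟨fun H => ?_, fun H φ => ?_⟩
  · have : f = fun y => ∑ i, (Module.finBasis ℝ E).coord i (f y) • Module.finBasis ℝ E i := by
      funext y
      exact ((Module.finBasis ℝ E).sum_repr (f y)).symm
    rw [this]
    exact contMDiffOn_finsetSum fun i _ => (H _).smul contMDiffOn_const
  · exact φ.toContinuousLinearMap.contMDiff.comp_contMDiffOn H

theorem smoothField_iff_of_subset (hU : IsOpen U) {x₀ : M} (h : U ⊆ chartDomain (E := E) x₀) :
    SmoothField Y U ↔ FunSmoothOn E (fun y => toChart x₀ y (Y y)) U := by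
  rw [SmoothField, Trivialization.contMDiffOn_section_iff
    (trivializationAt E (TangentSpace 𝓘(ℝ, E) : M → Type _) x₀) hU h, funSmoothOn_model]
  exact contMDiffOn_congr fun y hy => (toChart_eq_snd (h hy) _).symm

theorem SmoothField.toChart (hY : SmoothField Y U) (hU : IsOpen U) (x₀ : M) :
    FunSmoothOn E (fun y => toChart x₀ y (Y y)) (U ∩ chartDomain (E := E) x₀) :=
  (smoothField_iff_of_subset (hU.inter (isOpen_chartDomain x₀)) inter_subset_right).1
    (hY.mono inter_subset_left)

theorem smoothField_of_forall (hU : IsOpen U) (h : ∀ x₀ ∈ U,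
    SmoothField Y (U ∩ chartDomain (E := E) x₀)) : SmoothField Y U := fun x hx =>
  ((h x hx).contMDiffAt ((hU.inter (isOpen_chartDomain x)).mem_nhds
    ⟨hx, mem_chartDomain x⟩)).contMDiffWithinAt

theorem smoothField_ofChart (x₀ : M) (u : E) :
    SmoothField (fun y : M => ofChart x₀ y u) (chartDomain (E := E) x₀) := by
  rw [smoothField_iff_of_subset (isOpen_chartDomain x₀) subset_rfl]
  exact (funSmoothOn_const u).congr fun y hy => toChart_ofChart hy u

theorem smoothField_sum_smul {κ : Type*} [Fintype κ] {c : κ → M → ℝ}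
    {Y : κ → Π x : M, TangentSpace 𝓘(ℝ, E) x} (hU : IsOpen U)
    (hc : ∀ i, ContMDiffOn 𝓘(ℝ, E) 𝓘(ℝ, ℝ) ∞ (c i) U) (hY : ∀ i, SmoothField (Y i) U) :
    SmoothField (fun y => ∑ i, c i y • Y i y) U := by
  refine smoothField_of_forall hU fun x₀ _ => ?_
  rw [smoothField_iff_of_subset (hU.inter (isOpen_chartDomain x₀)) inter_subset_right]
  simp only [map_sum, map_smul]
  exact FunSmoothOn.sum _ fun i _ => ((funSmoothOn_real.2 (hc i)).mono inter_subset_left).smul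
    ((hY i).toChart hU x₀)

theorem SmoothField.smul {c : M → ℝ} (hY : SmoothField Y U) (hU : IsOpen U)
    (hc : ContMDiffOn 𝓘(ℝ, E) 𝓘(ℝ, ℝ) ∞ c U) : SmoothField (fun y => c y • Y y) U := by
  simpa using smoothField_sum_smul (κ := Unit) hU (fun _ => hc) fun _ => hY

theorem eq_sum_ofChart {x₀ y : M} (hy : y ∈ chartDomain (E := E) x₀)
    (v : TangentSpace 𝓘(ℝ, E) y) :
    v = ∑ i, (Module.finBasis ℝ E).coord i (toChart x₀ y v) •
      ofChart x₀ y (Module.finBasis ℝ E i) := by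
  have h := congrArg (ofChart x₀ y) ((Module.finBasis ℝ E).sum_repr (toChart x₀ y v))
  rw [ofChart_toChart hy, map_sum] at h
  simpa using h.symm

end VectorFields

/-! ### The connection on vector fields -/

section Connection

variable {E : Type*} [NormedAddCommGroup E] [NormedSpace ℝ E] [FiniteDimensional ℝ E]
  {M : Type*} [TopologicalSpace M] [ChartedSpace E M] [IsManifold 𝓘(ℝ, E) ∞ M]
  (cov : CovariantDerivative 𝓘(ℝ, E) E (TangentSpace 𝓘(ℝ, E) : M → Type _))
  {U : Set M} {X Y Z : Π x : M, TangentSpace 𝓘(ℝ, E) x} {x : M}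

theorem cov_congr (hY : SmoothField Y U) (hU : IsOpen U) (hx : x ∈ U)
    (h : ∀ y ∈ U, Z y = Y y) : cov Z x = cov Y x :=
  cov.isCovariantDerivativeOn.congr_of_eqOn (s := U)
    (SmoothField.mdiffAt (hY.congr fun y hy => congrArg (TotalSpace.mk' E y) (h y hy)) hU hx)
    (hY.mdiffAt hU hx) (hU.mem_nhds hx) h

theorem cov_add (hY : SmoothField Y U) (hZ : SmoothField Z U) (hU : IsOpen U) (hx : x ∈ U) :
    cov (fun y => Y y + Z y) x = cov Y x + cov Z x :=
  cov.isCovariantDerivativeOnUniv.add (hY.mdiffAt hU hx) (hZ.mdiffAt hU hx)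

theorem cov_smul {c : M → ℝ} (hc : ContMDiffOn 𝓘(ℝ, E) 𝓘(ℝ, ℝ) ∞ c U)
    (hY : SmoothField Y U) (hU : IsOpen U) (hx : x ∈ U) (v : TangentSpace 𝓘(ℝ, E) x) :
    cov (fun y => c y • Y y) x v = mvfderiv 𝓘(ℝ, E) c x v • Y x + c x • cov Y x v := by
  have := cov.isCovariantDerivativeOnUniv.leibniz (hY.mdiffAt hU hx) (hc.mdiffAt hU hx)
  have h2 := congrArg (fun L => L v) this
  rw [add_comm]
  exact h2

theorem cov_sum_smul {κ : Type*} [Fintype κ] {c : κ → M → ℝ}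
    {Y : κ → Π x : M, TangentSpace 𝓘(ℝ, E) x} (hU : IsOpen U) (hx : x ∈ U)
    (hc : ∀ i, ContMDiffOn 𝓘(ℝ, E) 𝓘(ℝ, ℝ) ∞ (c i) U) (hY : ∀ i, SmoothField (Y i) U)
    (v : TangentSpace 𝓘(ℝ, E) x) :
    cov (fun y => ∑ i, c i y • Y i y) x v =
      ∑ i, (mvfderiv 𝓘(ℝ, E) (c i) x v • Y i x + c i x • cov (Y i) x v) := by
  classical
  have key : ∀ s : Finset κ, SmoothField (fun y => ∑ i ∈ s, c i y • Y i y) U ∧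
      cov (fun y => ∑ i ∈ s, c i y • Y i y) x v =
      ∑ i ∈ s, (mvfderiv 𝓘(ℝ, E) (c i) x v • Y i x + c i x • cov (Y i) x v) := by
    intro s
    have hs : ∀ s : Finset κ, SmoothField (fun y => ∑ i ∈ s, c i y • Y i y) U := by
      intro s
      have := smoothField_sum_smul (κ := s) (c := fun i => c i) (Y := fun i => Y i) hU
        (fun i => hc i) fun i => hY i
      exact this.congr fun y _ => congrArg (TotalSpace.mk' E y)
        (Finset.sum_coe_sort s fun i => c i y • Y i y).symm
    refine ⟨hs s, ?_⟩
    induction s using Finset.induction_on with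
    | empty =>
      have := cov.isCovariantDerivativeOnUniv.zero (x := x)
      simp only [Finset.sum_empty]
      exact congrArg (fun L => L v) this
    | insert a s ha ih =>
      simp only [Finset.sum_insert ha]
      rw [cov_add cov ((hY a).smul hU (hc a)) (hs s) hU hx, ← ih,
        ← cov_smul cov (hc a) (hY a) hU hx v]
      rfl
  exact (key Finset.univ).2

/-- The connection form in the chart at `x₀`: the endomorphism of `E` that sends `u` to the
components of `∇_v U`, where `U` is the vector field with constant components `u`. -/
def chartConnection (x₀ y : M) (v : TangentSpace 𝓘(ℝ, E) y) : E →ₗ[ℝ] E :=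
  (Module.finBasis ℝ E).constr ℝ fun i =>
    toChart x₀ y (cov (fun z => ofChart x₀ z (Module.finBasis ℝ E i)) y v)

/-- The covariant derivative of a vector field in the components of a chart. -/
theorem toChart_cov {x₀ : M} (hY : SmoothField Y U) (hU : IsOpen U) (hx : x ∈ U)
    (hx₀ : x ∈ chartDomain (E := E) x₀) (v : TangentSpace 𝓘(ℝ, E) x) :
    toChart x₀ x (cov Y x v) = vecDeriv (fun y => toChart x₀ y (Y y)) x v +
      chartConnection cov x₀ x v (toChart x₀ x (Y x)) := by
  set b := Module.finBasis ℝ E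
  set U' := U ∩ chartDomain (E := E) x₀
  have hU' : IsOpen U' := hU.inter (isOpen_chartDomain x₀)
  have hx' : x ∈ U' := ⟨hx, hx₀⟩
  have hc := hY.toChart hU x₀
  have hb : ∀ i, SmoothField (fun y : M => ofChart x₀ y (b i)) U' := fun i =>
    (smoothField_ofChart x₀ (b i)).mono inter_subset_right
  have h1 := cov_congr cov (smoothField_sum_smul hU' (fun i => hc (b.coord i)) hb) hU' hx'
    fun y hy => eq_sum_ofChart hy.2 (Y y)
  rw [h1, cov_sum_smul cov hU' hx' (fun i => hc (b.coord i)) hb, map_sum]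
  simp only [map_add, map_smul, toChart_ofChart hx₀, Finset.sum_add_distrib]
  congr 1
  rw [chartConnection, Module.Basis.constr_apply_fintype]
  simp [b]

theorem chartConnection_apply {x₀ : M} (hx₀ : x ∈ chartDomain (E := E) x₀)
    (v : TangentSpace 𝓘(ℝ, E) x) (u : E) :
    chartConnection cov x₀ x v u = toChart x₀ x (cov (fun z => ofChart x₀ z u) x v) := by
  rw [toChart_cov cov (smoothField_ofChart x₀ u) (isOpen_chartDomain x₀) hx₀ hx₀,
    vecDeriv_congr (f' := fun _ => u), vecDeriv_const, zero_add, toChart_ofChart hx₀]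
  filter_upwards [(isOpen_chartDomain x₀).mem_nhds hx₀] with y hy
  exact toChart_ofChart hy u

theorem toChart_connectionEnd (v w : TangentSpace 𝓘(ℝ, E) x) :
    toChart x x (connectionEnd cov x v w) = chartConnection cov x x v (toChart x x w) :=
  (chartConnection_apply cov (mem_chartDomain x) v _).symm

theorem chartConnection_add {x₀ : M} (v w : TangentSpace 𝓘(ℝ, E) x) :
    chartConnection cov x₀ x (v + w) =
      chartConnection cov x₀ x v + chartConnection cov x₀ x w := by
  simp only [chartConnection, map_add]
  exact map_add _ (fun i => _) _

theorem SmoothField.cov_apply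
    (hcov : ∀ U : Set M, IsOpen U → ContMDiffCovariantDerivativeOn E ∞ cov.toFun U)
    (hX : SmoothField X U) (hY : SmoothField Y U) (hU : IsOpen U) :
    SmoothField (fun y => cov Y y (X y)) U :=
  ContMDiffOn.clm_bundle_apply ((hcov U hU).contMDiff (σ := Y) (by simpa using hY)) hX

theorem FunSmoothOn.pi {κ : Type*} [Fintype κ] {V : Type*} [AddCommGroup V] [Module ℝ V]
    {f : M → κ → V} (hf : ∀ i, FunSmoothOn E (fun y => f y i) U) : FunSmoothOn E f U := by
  classical
  refine (FunSmoothOn.sum Finset.univ fun i _ =>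
    (hf i).linearMap (LinearMap.single ℝ (fun _ : κ => V) i)).congr fun y _ => ?_
  ext i
  simp [Finset.sum_apply, Pi.single_apply]

theorem funSmoothOn_chartConnection
    (hcov : ∀ U : Set M, IsOpen U → ContMDiffCovariantDerivativeOn E ∞ cov.toFun U)
    (hX : SmoothField X U) (hU : IsOpen U) {x₀ : M} (h : U ⊆ chartDomain (E := E) x₀) :
    FunSmoothOn E (fun y => chartConnection cov x₀ y (X y)) U := by
  refine FunSmoothOn.linearMap (V₁ := Fin (Module.finrank ℝ E) → E) (FunSmoothOn.pi fun i => ?_)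
    ((Module.finBasis ℝ E).constr ℝ).toLinearMap
  rw [← smoothField_iff_of_subset hU h]
  exact SmoothField.cov_apply cov hcov hX ((smoothField_ofChart x₀ _).mono h) hU

end Connection
/-! ### Smooth one-forms and their covariant derivative -/

section OneForms

variable {E : Type*} [NormedAddCommGroup E] [NormedSpace ℝ E] [FiniteDimensional ℝ E]
  {M : Type*} [TopologicalSpace M] [ChartedSpace E M] [IsManifold 𝓘(ℝ, E) ∞ M]
  {U : Set M} {X Y Z : Π x : M, TangentSpace 𝓘(ℝ, E) x} {x : M}
  {α β : Π x : M, Cotangent (E := E) x}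

/-- The components of a `1`-form in the coordinate coframe of the chart at `x₀`. -/
def formRep (α : Π x : M, Cotangent (E := E) x) (x₀ y : M) : Module.Dual ℝ E :=
  (α y).comp (ofChart x₀ y)

/-- Smoothness of a `1`-form on `U`. -/
def SmoothForm (α : Π x : M, Cotangent (E := E) x) (U : Set M) : Prop :=
  ∀ x₀ : M, FunSmoothOn E (formRep α x₀) (U ∩ chartDomain (E := E) x₀)

theorem smoothForm_iff : SmoothForm α U ↔ ∀ (x₀ : M) (u : E),
    ContMDiffOn 𝓘(ℝ, E) 𝓘(ℝ, ℝ) ∞ (fun y => α y (ofChart x₀ y u))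
      (U ∩ chartDomain (E := E) x₀) := by
  refine ⟨fun h x₀ u => h x₀ (Module.Dual.eval ℝ E u), fun h x₀ => ?_⟩
  refine funSmoothOn_of_coord (Module.finBasis ℝ E).dualBasis fun s => ?_
  simpa [formRep] using h x₀ (Module.finBasis ℝ E s)

theorem SmoothForm.mono (hα : SmoothForm α U) {U' : Set M} (h : U' ⊆ U) : SmoothForm α U' :=
  fun x₀ => (hα x₀).mono (inter_subset_inter_left _ h)

theorem apply_eq_formRep {x₀ y : M} (hy : y ∈ chartDomain (E := E) x₀)
    (v : TangentSpace 𝓘(ℝ, E) y) : α y v = formRep α x₀ y (toChart x₀ y v) := by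
  simp [formRep, ofChart_toChart hy]

theorem SmoothForm.apply_field (hα : SmoothForm α U) (hY : SmoothField Y U) (hU : IsOpen U) :
    ContMDiffOn 𝓘(ℝ, E) 𝓘(ℝ, ℝ) ∞ (fun y => α y (Y y)) U := fun x hx => by
  have h1 := (hα x).bilin (hY.toChart hU x) (LinearMap.id (R := ℝ) (M := Module.Dual ℝ E))
  have h2 : ContMDiffOn 𝓘(ℝ, E) 𝓘(ℝ, ℝ) ∞ (fun y => α y (Y y))
      (U ∩ chartDomain (E := E) x) :=
    funSmoothOn_real.1 (h1.congr fun y hy => apply_eq_formRep hy.2 _)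
  exact (h2.contMDiffAt ((hU.inter (isOpen_chartDomain x)).mem_nhds
    ⟨hx, mem_chartDomain x⟩)).contMDiffWithinAt

theorem smoothForm_of_local (h : ∀ x ∈ U, ∃ U', IsOpen U' ∧ x ∈ U' ∧ SmoothForm α U') :
    SmoothForm α U := by
  rw [smoothForm_iff]
  intro x₀ u x hx
  obtain ⟨U', hU', hxU', h'⟩ := h x hx.1
  exact (((smoothForm_iff.1 h' x₀ u).contMDiffAt ((hU'.inter (isOpen_chartDomain x₀)).mem_nhds
    ⟨hxU', hx.2⟩))).contMDiffWithinAt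

/-- A `1`-form is smooth on the domain of a chart if its components in that chart are. -/
theorem smoothForm_of_chart (hU : IsOpen U) {x₀ : M} (hU₀ : U ⊆ chartDomain (E := E) x₀)
    {κ : Type*} [Fintype κ] (b : Module.Basis κ ℝ E)
    (h : ∀ i, ContMDiffOn 𝓘(ℝ, E) 𝓘(ℝ, ℝ) ∞ (fun y => α y (ofChart x₀ y (b i))) U) :
    SmoothForm α U := by
  rw [smoothForm_iff]
  intro x₁ u
  have hU₁ : IsOpen (U ∩ chartDomain (E := E) x₁) := hU.inter (isOpen_chartDomain x₁)
  have h1 := (smoothField_iff_of_subset hU₁ (inter_subset_left.trans hU₀)).1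
    ((smoothField_ofChart x₁ u).mono inter_subset_right)
  have h2 : ContMDiffOn 𝓘(ℝ, E) 𝓘(ℝ, ℝ) ∞ (fun y => ∑ i,
      b.coord i (toChart x₀ y (ofChart x₁ y u)) * α y (ofChart x₀ y (b i)))
      (U ∩ chartDomain (E := E) x₁) :=
    contMDiffOn_finsetSum fun i _ => (h1 (b.coord i)).mul ((h i).mono inter_subset_left)
  refine h2.congr fun y hy => ?_
  rw [apply_eq_formRep (hU₀ hy.1), apply_eq_sum_coord b]
  rfl

variable (cov : CovariantDerivative 𝓘(ℝ, E) E (TangentSpace 𝓘(ℝ, E) : M → Type _))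

/-- The covariant derivative `∇_v α` of a `1`-form at `x`, in the components of the chart
at `x`. -/
def formCov (α : Π x : M, Cotangent (E := E) x) (x : M) (v : TangentSpace 𝓘(ℝ, E) x) :
    Cotangent (E := E) x :=
  (vecDeriv (formRep α x) x v).comp (toChart x x) - (α x).comp (connectionEnd cov x v)

/-- `(∇_v α)(Y) = v(α(Y)) - α(∇_v Y)`. -/
theorem formCov_apply (hα : SmoothForm α U) (hY : SmoothField Y U) (hU : IsOpen U) (hx : x ∈ U)
    (v : TangentSpace 𝓘(ℝ, E) x) :
    formCov cov α x v (Y x) =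
      mvfderiv 𝓘(ℝ, E) (fun y => α y (Y y)) x v - α x (cov Y x v) := by
  have hU' : IsOpen (U ∩ chartDomain (E := E) x) := hU.inter (isOpen_chartDomain x)
  have hx' : x ∈ U ∩ chartDomain (E := E) x := ⟨hx, mem_chartDomain x⟩
  have h1 := vecDeriv_bilin (hα x) (hY.toChart hU x) hU' hx' v
    (LinearMap.id (R := ℝ) (M := Module.Dual ℝ E))
  have h2 := (hα x).bilin (hY.toChart hU x) (LinearMap.id (R := ℝ) (M := Module.Dual ℝ E))
  rw [vecDeriv_real h2 hU' hx'] at h1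
  have h3 : mvfderiv 𝓘(ℝ, E) (fun y => α y (Y y)) x v = mvfderiv 𝓘(ℝ, E)
      (fun y => (LinearMap.id (R := ℝ) (M := Module.Dual ℝ E)) (formRep α x y)
        (toChart x y (Y y))) x v := by
    refine congrArg (fun L : TangentSpace 𝓘(ℝ, E) x →L[ℝ] ℝ => L v)
      (mvfderiv_congr_of_eventuallyEq ?_)
    filter_upwards [hU'.mem_nhds hx'] with y hy
    exact apply_eq_formRep hy.2 _
  rw [h3, h1, apply_eq_formRep (mem_chartDomain x) (cov Y x v),
    toChart_cov cov hY hU hx (mem_chartDomain x), ← toChart_connectionEnd, map_add,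
    ← apply_eq_formRep (mem_chartDomain x) (connectionEnd cov x v (Y x))]
  simp only [formCov, LinearMap.sub_apply, LinearMap.comp_apply, LinearMap.id_apply]
  ring

theorem SmoothForm.formCov
    (hcov : ∀ U : Set M, IsOpen U → ContMDiffCovariantDerivativeOn E ∞ cov.toFun U)
    (hα : SmoothForm α U) (hX : SmoothField X U) (hU : IsOpen U) :
    SmoothForm (fun y => formCov cov α y (X y)) U := by
  rw [smoothForm_iff]
  intro x₀ u
  have hU' : IsOpen (U ∩ chartDomain (E := E) x₀) := hU.inter (isOpen_chartDomain x₀)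
  have hα' := hα.mono (inter_subset_left (t := chartDomain (E := E) x₀))
  have hX' := hX.mono (inter_subset_left (t := chartDomain (E := E) x₀))
  have hY := (smoothField_ofChart x₀ u).mono (inter_subset_right (s := U))
  refine ContMDiffOn.congr (ContMDiffOn.sub
    (contMDiffOn_mvfderiv_apply (hα'.apply_field hY hU') hX' hU')
    (hα'.apply_field (SmoothField.cov_apply cov hcov hX' hY hU') hU')) fun y hy => ?_
  exact formCov_apply cov hα' hY hU' hy (X y)

/-- The dual coframe of a smooth frame is smooth: in a chart its matrix is the inverse of the matrix
of the frame. -/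
theorem IsFrameOn.smoothForm {ι : Type*} [Fintype ι] [DecidableEq ι]
    {e : ι → Π x : M, TangentSpace 𝓘(ℝ, E) x} {θ : ι → Π x : M, Cotangent (E := E) x}
    (h : IsFrameOn U e θ) (μ : ι) : SmoothForm (θ μ) U := by
  refine smoothForm_of_local fun x hx => ?_
  -- work in the chart at `x`, with the basis of `E` given by the frame at `x`
  set U' := U ∩ chartDomain (E := E) x
  have hU' : IsOpen U' := h.isOpen.inter (isOpen_chartDomain x)
  have hx' : x ∈ U' := ⟨hx, mem_chartDomain x⟩
  refine ⟨U', hU', hx', ?_⟩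
  let c : Module.Basis ι ℝ E := (h.frame.toBasisAt hx).map
    (LinearEquiv.ofLinearMap (toChart x x) (ofChart x x)
      (LinearMap.ext fun u => toChart_ofChart hx'.2 u)
      (LinearMap.ext fun u => ofChart_toChart hx'.2 u))
  let A : M → Matrix ι ι ℝ := fun y => Matrix.of fun i j => c.coord i (toChart x y (e j y))
  let T : M → Matrix ι ι ℝ := fun y => Matrix.of fun i j => θ i y (ofChart x y (c j))
  have hTA : ∀ y ∈ U', T y * A y = 1 := by
    intro y hy
    ext i j
    have h1 := h.dual y hy.1 i j
    rw [apply_eq_formRep hy.2, apply_eq_sum_coord c] at h1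
    rw [Matrix.mul_apply, Matrix.one_apply, ← h1]
    exact Finset.sum_congr rfl fun k _ => mul_comm _ _
  have hA : ∀ i j, ContMDiffOn 𝓘(ℝ, E) 𝓘(ℝ, ℝ) ∞ (fun y => A y i j) U' := fun i j =>
    SmoothField.toChart (h.frame.contMDiffOn j) h.isOpen x (c.coord i)
  refine smoothForm_of_chart hU' inter_subset_right c fun i => ?_
  refine (contMDiffOn_matrix_inv hA (fun y hy => Matrix.det_ne_zero_of_left_inverse (hTA y hy))
    μ i).congr fun y hy => ?_
  rw [Matrix.inv_eq_left_inv (hTA y hy)]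
  rfl

end OneForms

/-! ### Raising indices -/

namespace PseudoRiemannianMetric

variable {E : Type*} [NormedAddCommGroup E] [NormedSpace ℝ E] [FiniteDimensional ℝ E]
  {M : Type*} [TopologicalSpace M] [ChartedSpace E M] [IsManifold 𝓘(ℝ, E) ∞ M]
  (g : PseudoRiemannianMetric E M)
  {U : Set M} {X Y Z : Π x : M, TangentSpace 𝓘(ℝ, E) x} {x : M}
  {α β : Π x : M, Cotangent (E := E) x}

theorem val_sharp (x : M) (a : Cotangent (E := E) x) (w : TangentSpace 𝓘(ℝ, E) x) :
    g.val x (g.sharp x a) w = a w :=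
  LinearMap.BilinForm.apply_toDual_symm_apply (B := g.bilin x) (hB := g.bilin_nondegenerate x) a w

theorem cometric_apply (x : M) (a b : Cotangent (E := E) x) :
    g.cometric x a b = b (g.sharp x a) := by
  change g.val x (g.sharp x a) (g.sharp x b) = _
  rw [g.symm, val_sharp]

theorem cometric_comm (x : M) (a b : Cotangent (E := E) x) :
    g.cometric x a b = g.cometric x b a :=
  g.symm x _ _

theorem smooth_val (hY : SmoothField Y U) (hZ : SmoothField Z U) :
    ContMDiffOn 𝓘(ℝ, E) 𝓘(ℝ, ℝ) ∞ (fun y => g.val y (Y y) (Z y)) U := by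
  have := ContMDiffOn.clm_bundle_apply₂ (n := ∞) (F₃ := ℝ) (E₃ := Bundle.Trivial M ℝ)
    (g.contMDiff.contMDiffOn (s := U)) hY hZ
  intro x hx
  exact (Bundle.contMDiffWithinAt_totalSpace.1 (this x hx)).2

/-- In a chart, raising an index is multiplication by the inverse of the Gram matrix of the
coordinate fields. -/
theorem smoothField_sharp (hα : SmoothForm α U) (hU : IsOpen U) :
    SmoothField (fun y => g.sharp y (α y)) U := by
  refine smoothField_of_forall hU fun x₀ _ => ?_
  set U' := U ∩ chartDomain (E := E) x₀
  have hU' : IsOpen U' := hU.inter (isOpen_chartDomain x₀)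
  rw [smoothField_iff_of_subset hU' inter_subset_right]
  set b := Module.finBasis ℝ E
  let A : M → Matrix _ _ ℝ := fun y => Matrix.of fun i j =>
    g.val y (ofChart x₀ y (b i)) (ofChart x₀ y (b j))
  have hb : ∀ i, SmoothField (fun y : M => ofChart x₀ y (b i)) U' := fun i =>
    (smoothField_ofChart x₀ (b i)).mono inter_subset_right
  have hA : ∀ i j, ContMDiffOn 𝓘(ℝ, E) 𝓘(ℝ, ℝ) ∞ (fun y => A y i j) U' := fun i j =>
    g.smooth_val (hb i) (hb j)
  -- `A y` is the Gram matrix of the coordinate fields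
  have hmul : ∀ y ∈ U', ∀ a : Cotangent (E := E) y,
      (A y).mulVec (fun i => b.coord i (toChart x₀ y (g.sharp y a))) =
        fun i => a (ofChart x₀ y (b i)) := by
    intro y hy a
    funext i
    rw [← g.val_sharp y a, g.symm]
    have h1 := congrArg (g.val y (ofChart x₀ y (b i))) (eq_sum_ofChart hy.2 (g.sharp y a))
    rw [h1, map_sum]
    simp only [Matrix.mulVec, dotProduct, A, Matrix.of_apply, map_smul, smul_eq_mul]
    exact Finset.sum_congr rfl fun k _ => mul_comm _ _
  have hdet : ∀ y ∈ U', (A y).det ≠ 0 := by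
    intro y hy h0
    obtain ⟨w, hw, hw0⟩ := Matrix.exists_mulVec_eq_zero_iff.2 h0
    apply hw
    -- the vector with components `w` is `a♯`, where `a` has components `A y w = 0`
    set v := ofChart x₀ y (∑ i, w i • b i)
    set a := (g.sharp y).symm v
    have hv : g.sharp y a = v := LinearEquiv.apply_symm_apply _ _
    have hvw : ∀ i, b.coord i (toChart x₀ y v) = w i := by
      intro i
      rw [toChart_ofChart hy.2, Module.Basis.coord_apply, b.repr_sum_self]
    have h1 := hmul y hy a
    rw [hv] at h1
    simp only [hvw] at h1
    have ha : a = 0 := by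
      ext u
      have h2 := apply_eq_sum_coord b (a.comp (ofChart x₀ y)) (toChart x₀ y u)
      simp only [LinearMap.comp_apply, ofChart_toChart hy.2] at h2
      rw [h2]
      refine Finset.sum_eq_zero fun i _ => ?_
      have := congrFun (h1.symm.trans hw0) i
      simp only [Pi.zero_apply] at this
      simp [this]
    funext i
    rw [← hvw, ← hv, ha]
    simp
  refine funSmoothOn_of_coord b fun i => ?_
  have h2 : ContMDiffOn 𝓘(ℝ, E) 𝓘(ℝ, ℝ) ∞
      (fun y => ∑ j, (A y)⁻¹ i j * α y (ofChart x₀ y (b j))) U' :=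
    contMDiffOn_finsetSum fun j _ => (contMDiffOn_matrix_inv hA hdet i j).mul
      (smoothForm_iff.1 hα x₀ (b j))
  refine h2.congr fun y hy => ?_
  have h3 := congrArg (fun w => (A y)⁻¹.mulVec w) (hmul y hy (α y))
  simp only [Matrix.mulVec_mulVec,
    Matrix.nonsing_inv_mul _ (isUnit_iff_ne_zero.2 (hdet y hy)), Matrix.one_mulVec] at h3
  exact congrFun h3 i

/-- A metric connection commutes with the raising of indices. -/
theorem sharp_formCov {cov : CovariantDerivative 𝓘(ℝ, E) E (TangentSpace 𝓘(ℝ, E) : M → Type _)}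
    (hcov : IsLeviCivita g cov) (hα : SmoothForm α U) (hU : IsOpen U) (hx : x ∈ U)
    (v : TangentSpace 𝓘(ℝ, E) x) :
    g.sharp x (formCov cov α x v) = cov (fun y => g.sharp y (α y)) x v := by
  set U' := U ∩ chartDomain (E := E) x
  have hU' : IsOpen U' := hU.inter (isOpen_chartDomain x)
  have hx' : x ∈ U' := ⟨hx, mem_chartDomain x⟩
  have hα' : SmoothForm α U' := hα.mono inter_subset_left
  rw [← sub_eq_zero]
  refine g.nondegenerate x _ fun w => ?_
  have hY : SmoothField (fun y : M => ofChart x y (toChart x x w)) U' :=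
    (smoothField_ofChart x _).mono inter_subset_right
  have h1 := hcov.metric_compatible x v _ _ ((g.smoothField_sharp hα' hU').mdiffAt hU' hx')
    (hY.mdiffAt hU' hx')
  have h2 := formCov_apply cov hα' hY hU' hx' v
  simp only [val_sharp] at h1
  rw [h1] at h2
  simp only [ofChart_toChart hx'.2] at h2
  rw [map_sub, sub_apply, val_sharp, h2]
  ring

end PseudoRiemannianMetric

/-! ### Derivations and contractions of the exterior algebra -/

section ExteriorAlgebra

variable {V W : Type*} [AddCommGroup V] [Module ℝ V] [AddCommGroup W] [Module ℝ W]

theorem exteriorDerivation_algebraMap (A : V →ₗ[ℝ] V) (r : ℝ) :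
    exteriorDerivation A (algebraMap ℝ (ExteriorAlgebra ℝ V) r) = 0 := by
  rw [Algebra.algebraMap_eq_smul_one, map_smul, exteriorDerivation_one, smul_zero]

theorem exteriorDerivation_ι_mul (A : V →ₗ[ℝ] V) (v : V) (a : ExteriorAlgebra ℝ V) :
    exteriorDerivation A (ExteriorAlgebra.ι ℝ v * a) =
      ExteriorAlgebra.ι ℝ (A v) * a + ExteriorAlgebra.ι ℝ v * exteriorDerivation A a := by
  rw [exteriorDerivation_mul, exteriorDerivation_ι]

theorem exterior_left_induction {P : ExteriorAlgebra ℝ V → Prop}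
    (algebraMap : ∀ r : ℝ, P (algebraMap ℝ _ r)) (add : ∀ a b, P a → P b → P (a + b))
    (ι_mul : ∀ a v, P a → P (ExteriorAlgebra.ι ℝ v * a)) (a : ExteriorAlgebra ℝ V) : P a :=
  CliffordAlgebra.left_induction (Q := (0 : QuadraticForm ℝ V)) algebraMap add
    (fun a v => ι_mul a v) a

variable (V) in
/-- `exteriorDerivation A` depends linearly on `A`. -/
def exteriorDerivationHom :
    (V →ₗ[ℝ] V) →ₗ[ℝ] ExteriorAlgebra ℝ V →ₗ[ℝ] ExteriorAlgebra ℝ V where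
  toFun := exteriorDerivation
  map_add' A B := by
    refine LinearMap.ext fun a => ?_
    rw [LinearMap.add_apply]
    induction a using exterior_left_induction with
    | algebraMap r => simp [exteriorDerivation_algebraMap]
    | add a b ha hb => simp only [map_add, ha, hb]; abel
    | ι_mul a v ha =>
      simp only [exteriorDerivation_ι_mul, ha, LinearMap.add_apply, map_add]
      noncomm_ring
  map_smul' c A := by
    refine LinearMap.ext fun a => ?_
    rw [LinearMap.smul_apply]
    induction a using exterior_left_induction with
    | algebraMap r => simp [exteriorDerivation_algebraMap]
    | add a b ha hb => simp only [map_add, ha, hb, smul_add]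
    | ι_mul a v ha =>
      simp only [exteriorDerivation_ι_mul, ha, LinearMap.smul_apply, map_smul, smul_add,
        mul_smul_comm, smul_mul_assoc, RingHom.id_apply]

theorem map_exteriorDerivation {A : V →ₗ[ℝ] V} {B : W →ₗ[ℝ] W} {f : V →ₗ[ℝ] W}
    (h : ∀ v, f (A v) = B (f v)) (a : ExteriorAlgebra ℝ V) :
    ExteriorAlgebra.map f (exteriorDerivation A a) =
      exteriorDerivation B (ExteriorAlgebra.map f a) := by
  induction a using exterior_left_induction with
  | algebraMap r => simp [exteriorDerivation_algebraMap]
  | add a b ha hb => simp only [map_add, ha, hb]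
  | ι_mul a v ha =>
    simp only [exteriorDerivation_ι_mul, map_add, map_mul, ExteriorAlgebra.map_apply_ι, ha, h]

/-- The left contraction of a multivector with a linear functional. -/
def contraction : Module.Dual ℝ V →ₗ[ℝ] ExteriorAlgebra ℝ V →ₗ[ℝ] ExteriorAlgebra ℝ V :=
  CliffordAlgebra.contractLeft (Q := (0 : QuadraticForm ℝ V))

theorem contraction_algebraMap (d : Module.Dual ℝ V) (r : ℝ) :
    contraction d (algebraMap ℝ (ExteriorAlgebra ℝ V) r) = 0 :=
  CliffordAlgebra.contractLeft_algebraMap (Q := (0 : QuadraticForm ℝ V)) d r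

theorem contraction_ι_mul (d : Module.Dual ℝ V) (v : V) (a : ExteriorAlgebra ℝ V) :
    contraction d (ExteriorAlgebra.ι ℝ v * a) =
      d v • a - ExteriorAlgebra.ι ℝ v * contraction d a :=
  CliffordAlgebra.contractLeft_ι_mul (Q := (0 : QuadraticForm ℝ V)) (d := d) v a

theorem map_contraction (f : V →ₗ[ℝ] W) (d : Module.Dual ℝ W) (a : ExteriorAlgebra ℝ V) :
    ExteriorAlgebra.map f (contraction (d.comp f) a) =
      contraction d (ExteriorAlgebra.map f a) := by
  induction a using exterior_left_induction with
  | algebraMap r => simp [contraction_algebraMap]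
  | add a b ha hb => simp only [map_add, ha, hb]
  | ι_mul a v ha =>
    simp only [contraction_ι_mul, map_sub, map_smul, map_mul, ExteriorAlgebra.map_apply_ι, ha,
      LinearMap.comp_apply]

/-- The commutator of a derivation with a contraction is a contraction. -/
theorem exteriorDerivation_contraction (A : V →ₗ[ℝ] V) (d : Module.Dual ℝ V)
    (a : ExteriorAlgebra ℝ V) :
    exteriorDerivation A (contraction d a) =
      contraction d (exteriorDerivation A a) - contraction (d.comp A) a := by
  induction a using exterior_left_induction with
  | algebraMap r => simp [contraction_algebraMap, exteriorDerivation_algebraMap]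
  | add a b ha hb => simp only [map_add, ha, hb]; abel
  | ι_mul a v ha =>
    simp only [contraction_ι_mul, exteriorDerivation_ι_mul, map_sub, map_smul, map_add, ha,
      LinearMap.comp_apply, mul_sub]
    abel

end ExteriorAlgebra
/-! ### Sections of the Clifford bundle in charts -/

instance exteriorAlgebra_finiteDimensional {V : Type*} [AddCommGroup V] [Module ℝ V]
    [FiniteDimensional ℝ V] : FiniteDimensional ℝ (ExteriorAlgebra ℝ V) :=
  Module.Finite.of_basis (Module.finBasis ℝ V).ExteriorAlgebra

namespace PseudoRiemannianMetric

variable {E : Type*} [NormedAddCommGroup E] [NormedSpace ℝ E] [FiniteDimensional ℝ E]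
  {M : Type*} [TopologicalSpace M] [ChartedSpace E M] [IsManifold 𝓘(ℝ, E) ∞ M]
  (g : PseudoRiemannianMetric E M)
  {U : Set M} {X Y Z : Π x : M, TangentSpace 𝓘(ℝ, E) x} {x : M}
  {α β : Π x : M, Cotangent (E := E) x} {F G : Π x : M, g.Cl x}

/-- The components of an element of the Clifford fibre at `y` in the coordinate coframe of the
chart at `x₀`. -/
def rep (x₀ y : M) : g.Cl y →ₗ[ℝ] ExteriorAlgebra ℝ (Module.Dual ℝ E) :=
  (ExteriorAlgebra.map (ofChart (E := E) x₀ y).dualMap).toLinearMap ∘ₗ (g.toForm y).toLinearMap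

/-- The element of the Clifford fibre at `y` with given components in the coordinate coframe of
the chart at `x₀`; the inverse of `rep` on the domain of the chart. -/
def unrep (x₀ y : M) : ExteriorAlgebra ℝ (Module.Dual ℝ E) →ₗ[ℝ] g.Cl y :=
  (g.toForm y).symm.toLinearMap ∘ₗ (ExteriorAlgebra.map (toChart (E := E) x₀ y).dualMap).toLinearMap

theorem rep_unrep {x₀ y : M} (hy : y ∈ chartDomain (E := E) x₀)
    (c : ExteriorAlgebra ℝ (Module.Dual ℝ E)) : g.rep x₀ y (g.unrep x₀ y c) = c := by
  have h : (ofChart (E := E) x₀ y).dualMap ∘ₗ (toChart x₀ y).dualMap = LinearMap.id := by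
    ext w u
    simp [toChart_ofChart hy]
  simp only [rep, unrep, LinearMap.comp_apply, LinearEquiv.coe_coe, AlgHom.toLinearMap_apply,
    LinearEquiv.apply_symm_apply]
  rw [← AlgHom.comp_apply, ExteriorAlgebra.map_comp_map, h, ExteriorAlgebra.map_id]
  rfl

theorem unrep_rep {x₀ y : M} (hy : y ∈ chartDomain (E := E) x₀) (a : g.Cl y) :
    g.unrep x₀ y (g.rep x₀ y a) = a := by
  have h : (toChart (E := E) x₀ y).dualMap ∘ₗ (ofChart x₀ y).dualMap = LinearMap.id := by
    ext w u
    simp [ofChart_toChart hy]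
  simp only [rep, unrep, LinearMap.comp_apply, LinearEquiv.coe_coe, AlgHom.toLinearMap_apply]
  rw [← AlgHom.comp_apply, ExteriorAlgebra.map_comp_map, h, ExteriorAlgebra.map_id]
  simp

theorem rep_injective {x₀ y : M} (hy : y ∈ chartDomain (E := E) x₀) :
    Function.Injective (g.rep x₀ y) :=
  Function.LeftInverse.injective (g.unrep_rep hy)

theorem toForm_ι (x : M) (a : Cotangent (E := E) x) :
    g.toForm x (CliffordAlgebra.ι _ a) = ExteriorAlgebra.ι ℝ a :=
  CliffordAlgebra.changeForm_ι CliffordAlgebra.changeForm.associated_neg_proof a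

theorem toForm_algebraMap (x : M) (r : ℝ) :
    g.toForm x (algebraMap ℝ _ r) = algebraMap ℝ _ r :=
  CliffordAlgebra.changeForm_algebraMap CliffordAlgebra.changeForm.associated_neg_proof r

theorem rep_wedge (x₀ y : M) (a b : g.Cl y) :
    g.rep x₀ y (cliffordWedge a b) = g.rep x₀ y a * g.rep x₀ y b := by
  simp only [rep, cliffordWedge, toForm, LinearMap.comp_apply, LinearEquiv.coe_coe,
    AlgHom.toLinearMap_apply, LinearEquiv.apply_symm_apply, map_mul]

theorem rep_oneForm (α : Π x : M, Cotangent (E := E) x) (x₀ y : M) :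
    g.rep x₀ y (g.oneForm α y) = ExteriorAlgebra.ι ℝ (formRep α x₀ y) := by
  simp only [rep, oneForm, LinearMap.comp_apply, LinearEquiv.coe_coe,
    AlgHom.toLinearMap_apply, toForm_ι, ExteriorAlgebra.map_apply_ι]
  rfl

theorem rep_algebraMap (x₀ y : M) (r : ℝ) :
    g.rep x₀ y (algebraMap ℝ _ r) = algebraMap ℝ _ r := by
  simp only [rep, LinearMap.comp_apply, LinearEquiv.coe_coe,
    AlgHom.toLinearMap_apply, toForm_algebraMap, AlgHom.commutes]

/-- The interior product of a tangent vector with an element of the Clifford fibre. -/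
def interior (x : M) (w : TangentSpace 𝓘(ℝ, E) x) (a : g.Cl x) : g.Cl x :=
  (g.toForm x).symm (contraction (Module.Dual.eval ℝ _ w) (g.toForm x a))

theorem rep_interior {x₀ y : M} (hy : y ∈ chartDomain (E := E) x₀) (w : TangentSpace 𝓘(ℝ, E) y)
    (a : g.Cl y) : g.rep x₀ y (g.interior y w a) =
      contraction (Module.Dual.eval ℝ E (toChart x₀ y w)) (g.rep x₀ y a) := by
  simp only [rep, interior, LinearMap.comp_apply, LinearEquiv.coe_coe,
    AlgHom.toLinearMap_apply, LinearEquiv.apply_symm_apply]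
  rw [← map_contraction]
  congr 3
  ext u
  simp [ofChart_toChart hy]

/-- Clifford multiplication by a `1`-form is the exterior product plus the interior product with
the dual vector. -/
theorem ι_mul_eq (x : M) (a : Cotangent (E := E) x) (b : g.Cl x) :
    CliffordAlgebra.ι _ a * b =
      cliffordWedge (CliffordAlgebra.ι _ a) b + g.interior x (g.sharp x a) b := by
  apply (g.toForm x).injective
  have h1 : g.toForm x (CliffordAlgebra.ι _ a * b) = ExteriorAlgebra.ι ℝ a * g.toForm x b -
      contraction (QuadraticMap.associated (R := ℝ) (-(g.cometric x).toQuadraticMap) a)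
        (g.toForm x b) :=
    CliffordAlgebra.changeForm_ι_mul CliffordAlgebra.changeForm.associated_neg_proof a b
  have h2 : QuadraticMap.associated (R := ℝ) (-(g.cometric x).toQuadraticMap) a =
      -Module.Dual.eval ℝ _ (g.sharp x a) := by
    ext b
    have h := congrArg (fun B => B a b)
      (QuadraticMap.two_nsmul_associated ℝ (-(g.cometric x).toQuadraticMap))
    simp only [QuadraticMap.polarBilin_apply_apply, QuadraticMap.polar, neg_apply,
      LinearMap.BilinMap.toQuadraticMap_apply, map_add,
      LinearMap.add_apply, g.cometric_comm x b a] at h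
    rw [LinearMap.neg_apply, Module.Dual.eval_apply, ← g.cometric_apply]
    change 2 • QuadraticMap.associated (R := ℝ) (-(g.cometric x).toQuadraticMap) a b = _ at h
    rw [nsmul_eq_mul] at h
    push_cast at h
    linarith
  rw [h1, h2, map_add]
  simp only [cliffordWedge, interior, toForm, LinearEquiv.apply_symm_apply, map_neg,
    LinearMap.neg_apply, sub_neg_eq_add]
  congr 2
  exact (g.toForm_ι x a).symm

theorem smoothOn_iff : g.SmoothOn F U ↔
    ∀ x₀ : M, FunSmoothOn E (fun y => g.rep x₀ y (F y)) (U ∩ chartDomain (E := E) x₀) :=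
  Iff.rfl

variable {g}

theorem SmoothOn.mono (hF : g.SmoothOn F U) {U' : Set M} (h : U' ⊆ U) : g.SmoothOn F U' :=
  fun x₀ φ => (hF x₀ φ).mono (inter_subset_inter_left _ h)

theorem SmoothOn.congr (hF : g.SmoothOn F U) (h : ∀ y ∈ U, G y = F y) : g.SmoothOn G U :=
  g.smoothOn_iff.2 fun x₀ => (g.smoothOn_iff.1 hF x₀).congr fun y hy => by rw [h y hy.1]

theorem SmoothOn.add (hF : g.SmoothOn F U) (hG : g.SmoothOn G U) :
    g.SmoothOn (fun y => F y + G y) U := by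
  rw [smoothOn_iff] at *
  intro x₀
  simp only [map_add]
  exact (hF x₀).add (hG x₀)

theorem SmoothOn.smul {c : M → ℝ} (hc : ContMDiffOn 𝓘(ℝ, E) 𝓘(ℝ, ℝ) ∞ c U)
    (hF : g.SmoothOn F U) : g.SmoothOn (fun y => c y • F y) U := by
  rw [smoothOn_iff] at *
  intro x₀
  simp only [map_smul]
  exact ((funSmoothOn_real.2 hc).mono inter_subset_left).smul (hF x₀)

theorem SmoothOn.sum {κ : Type*} (s : Finset κ) {F : κ → Π x : M, g.Cl x}
    (hF : ∀ i ∈ s, g.SmoothOn (F i) U) : g.SmoothOn (fun y => ∑ i ∈ s, F i y) U := by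
  rw [smoothOn_iff]
  intro x₀
  simp only [map_sum]
  exact FunSmoothOn.sum s fun i hi => g.smoothOn_iff.1 (hF i hi) x₀

theorem SmoothOn.wedge (hF : g.SmoothOn F U) (hG : g.SmoothOn G U) :
    g.SmoothOn (fun y => cliffordWedge (F y) (G y)) U := by
  rw [smoothOn_iff] at *
  intro x₀
  simp only [rep_wedge]
  exact (hF x₀).bilin (hG x₀) (LinearMap.mul ℝ _)

theorem smoothOn_oneForm (hα : SmoothForm α U) : g.SmoothOn (g.oneForm α) U := by
  rw [smoothOn_iff] at *
  intro x₀
  simp only [rep_oneForm]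
  exact (hα x₀).linearMap (ExteriorAlgebra.ι ℝ)

theorem SmoothOn.interior (hF : g.SmoothOn F U) (hY : SmoothField Y U) (hU : IsOpen U) :
    g.SmoothOn (fun y => g.interior y (Y y) (F y)) U := by
  rw [smoothOn_iff] at *
  intro x₀
  refine (((hY.toChart hU x₀).linearMap (Module.Dual.eval ℝ E)).bilin (hF x₀)
    contraction).congr fun y hy => g.rep_interior hy.2 _ _

theorem SmoothOn.oneForm_mul (hF : g.SmoothOn F U) (hα : SmoothForm α U) (hU : IsOpen U) :
    g.SmoothOn (fun y => g.oneForm α y * F y) U :=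
  ((smoothOn_oneForm hα).wedge hF |>.add
    (hF.interior (g.smoothField_sharp hα hU) hU)).congr fun y _ => g.ι_mul_eq y (α y) (F y)

/-! ### The Leibniz rules of the covariant derivative -/

variable (cov : CovariantDerivative 𝓘(ℝ, E) E (TangentSpace 𝓘(ℝ, E) : M → Type _))

theorem componentDeriv_eq (hF : g.SmoothOn F U) (hU : IsOpen U) (hx : x ∈ U)
    (v : TangentSpace 𝓘(ℝ, E) x) :
    g.componentDeriv F x v = vecDeriv (fun y => g.rep x y (F y)) x v := by
  refine (Module.finBasis ℝ (Module.Dual ℝ E)).ExteriorAlgebra.ext_elem fun s => ?_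
  have h := apply_vecDeriv (hF x) (hU.inter (isOpen_chartDomain x)) ⟨hx, mem_chartDomain x⟩ v
    ((Module.finBasis ℝ (Module.Dual ℝ E)).ExteriorAlgebra.coord s)
  refine Eq.trans ?_ h.symm
  exact congrFun (Module.Basis.repr_sum_self _ _) s

/-- The covariant derivative of a section in the components of the chart at the point. -/
theorem rep_cliffordCov (hF : g.SmoothOn F U) (hU : IsOpen U) (hx : x ∈ U)
    (v : TangentSpace 𝓘(ℝ, E) x) :
    g.rep x x (g.cliffordCov cov F x v) = vecDeriv (fun y => g.rep x y (F y)) x v +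
      exteriorDerivation (-(chartConnection cov x x v).dualMap) (g.rep x x (F x)) := by
  have h1 : g.cliffordCov cov F x v = g.unrep x x (g.componentDeriv F x v) +
      (g.toForm x).symm
        (exteriorDerivation (-(connectionEnd cov x v).dualMap) (g.toForm x (F x))) :=
    map_add (g.toForm x).symm _ _
  rw [h1, map_add, rep_unrep _ (mem_chartDomain x), componentDeriv_eq hF hU hx]
  congr 1
  simp only [rep, LinearMap.comp_apply, LinearEquiv.coe_coe,
    AlgHom.toLinearMap_apply, LinearEquiv.apply_symm_apply]
  refine map_exteriorDerivation (fun w => ?_) _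
  ext u
  have h2 : connectionEnd cov x v (ofChart x x u) =
      ofChart x x (chartConnection cov x x v u) := by
    rw [← ofChart_toChart (mem_chartDomain x) (connectionEnd cov x v (ofChart x x u)),
      toChart_connectionEnd, toChart_ofChart (mem_chartDomain x)]
  simp [h2]

theorem cliffordCov_congr (hF : g.SmoothOn F U) (hU : IsOpen U) (hx : x ∈ U)
    (h : ∀ y ∈ U, G y = F y) (v : TangentSpace 𝓘(ℝ, E) x) :
    g.cliffordCov cov G x v = g.cliffordCov cov F x v := by
  apply g.rep_injective (mem_chartDomain x)
  rw [rep_cliffordCov cov hF hU hx, rep_cliffordCov cov (hF.congr h) hU hx, h x hx]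
  congr 1
  refine vecDeriv_congr ?_ v
  filter_upwards [hU.mem_nhds hx] with y hy
  rw [h y hy]

theorem cliffordCov_add (hF : g.SmoothOn F U) (hG : g.SmoothOn G U) (hU : IsOpen U) (hx : x ∈ U)
    (v : TangentSpace 𝓘(ℝ, E) x) :
    g.cliffordCov cov (fun y => F y + G y) x v =
      g.cliffordCov cov F x v + g.cliffordCov cov G x v := by
  apply g.rep_injective (mem_chartDomain x)
  rw [map_add, rep_cliffordCov cov hF hU hx, rep_cliffordCov cov hG hU hx,
    rep_cliffordCov cov (hF.add hG) hU hx]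
  simp only [map_add]
  rw [vecDeriv_add (g.smoothOn_iff.1 hF x) (g.smoothOn_iff.1 hG x)
    (hU.inter (isOpen_chartDomain x)) ⟨hx, mem_chartDomain x⟩]
  exact add_add_add_comm _ _ _ _

theorem cliffordCov_smul {c : M → ℝ} (hc : ContMDiffOn 𝓘(ℝ, E) 𝓘(ℝ, ℝ) ∞ c U)
    (hF : g.SmoothOn F U) (hU : IsOpen U) (hx : x ∈ U) (v : TangentSpace 𝓘(ℝ, E) x) :
    g.cliffordCov cov (fun y => c y • F y) x v =
      mvfderiv 𝓘(ℝ, E) c x v • F x + c x • g.cliffordCov cov F x v := by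
  apply g.rep_injective (mem_chartDomain x)
  rw [map_add, map_smul, map_smul, rep_cliffordCov cov hF hU hx,
    rep_cliffordCov cov (hF.smul hc) hU hx]
  simp only [map_smul]
  rw [vecDeriv_smul ((funSmoothOn_real.2 hc).mono inter_subset_left) (g.smoothOn_iff.1 hF x)
    (hU.inter (isOpen_chartDomain x)) ⟨hx, mem_chartDomain x⟩, smul_add, add_assoc]

theorem cliffordCov_algebraMap (r : ℝ) (hU : IsOpen U) (hx : x ∈ U)
    (v : TangentSpace 𝓘(ℝ, E) x) :
    g.SmoothOn (fun _ => algebraMap ℝ _ r) U ∧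
    g.cliffordCov cov (fun _ => algebraMap ℝ _ r) x v = 0 := by
  have h : g.SmoothOn (fun _ => algebraMap ℝ _ r) U := by
    rw [smoothOn_iff]
    intro x₀
    simp only [rep_algebraMap]
    exact funSmoothOn_const _
  refine ⟨h, ?_⟩
  apply g.rep_injective (mem_chartDomain x)
  rw [rep_cliffordCov cov h hU hx]
  simp only [rep_algebraMap, vecDeriv_const, exteriorDerivation_algebraMap, map_zero, add_zero]

theorem cliffordCov_sum {κ : Type*} (s : Finset κ) {F : κ → Π x : M, g.Cl x}
    (hF : ∀ i ∈ s, g.SmoothOn (F i) U) (hU : IsOpen U) (hx : x ∈ U)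
    (v : TangentSpace 𝓘(ℝ, E) x) :
    g.cliffordCov cov (fun y => ∑ i ∈ s, F i y) x v = ∑ i ∈ s, g.cliffordCov cov (F i) x v := by
  classical
  induction s using Finset.induction_on with
  | empty =>
    have := (cliffordCov_algebraMap (g := g) cov 0 hU hx v).2
    simpa using this
  | insert a s ha ih =>
    have hs : ∀ i ∈ s, g.SmoothOn (F i) U := fun i hi => hF i (Finset.mem_insert_of_mem hi)
    simp only [Finset.sum_insert ha]
    rw [cliffordCov_add cov (hF a (Finset.mem_insert_self a s)) (SmoothOn.sum s hs) hU hx, ih hs]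

theorem cliffordCov_wedge (hF : g.SmoothOn F U) (hG : g.SmoothOn G U) (hU : IsOpen U) (hx : x ∈ U)
    (v : TangentSpace 𝓘(ℝ, E) x) :
    g.cliffordCov cov (fun y => cliffordWedge (F y) (G y)) x v =
      cliffordWedge (g.cliffordCov cov F x v) (G x) +
        cliffordWedge (F x) (g.cliffordCov cov G x v) := by
  apply g.rep_injective (mem_chartDomain x)
  rw [map_add, rep_wedge, rep_wedge, rep_cliffordCov cov hF hU hx, rep_cliffordCov cov hG hU hx,
    rep_cliffordCov cov (hF.wedge hG) hU hx]
  simp only [rep_wedge, exteriorDerivation_mul]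
  have := vecDeriv_bilin (hF x) (hG x) (hU.inter (isOpen_chartDomain x)) ⟨hx, mem_chartDomain x⟩ v
    (LinearMap.mul ℝ _)
  simp only [LinearMap.mul_apply'] at this
  refine (congrArg (fun t => t + _) this).trans ?_
  simp only [localRep, add_mul, mul_add]
  exact add_add_add_comm _ _ _ _

/-- On `1`-forms the covariant derivative is `(∇_v α)(Y) = v(α(Y)) - α(∇_v Y)`. -/
theorem cliffordCov_oneForm (hα : SmoothForm α U) (hU : IsOpen U) (hx : x ∈ U)
    (v : TangentSpace 𝓘(ℝ, E) x) :
    g.cliffordCov cov (g.oneForm α) x v = CliffordAlgebra.ι _ (formCov cov α x v) := by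
  apply g.rep_injective (mem_chartDomain x)
  rw [rep_cliffordCov cov (smoothOn_oneForm hα) hU hx]
  simp only [rep_oneForm, exteriorDerivation_ι]
  rw [vecDeriv_linearMap (hα x) (hU.inter (isOpen_chartDomain x)) ⟨hx, mem_chartDomain x⟩,
    ← map_add]
  simp only [rep, LinearMap.comp_apply, LinearEquiv.coe_coe,
    AlgHom.toLinearMap_apply, toForm_ι, ExteriorAlgebra.map_apply_ι]
  congr 1
  ext u
  have h2 : connectionEnd cov x v (ofChart x x u) =
      ofChart x x (chartConnection cov x x v u) := by
    rw [← ofChart_toChart (mem_chartDomain x) (connectionEnd cov x v (ofChart x x u)),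
      toChart_connectionEnd, toChart_ofChart (mem_chartDomain x)]
  simp [formCov, toChart_ofChart (mem_chartDomain x), h2, formRep, sub_eq_add_neg]

theorem cliffordCov_interior (hF : g.SmoothOn F U) (hY : SmoothField Y U) (hU : IsOpen U)
    (hx : x ∈ U) (v : TangentSpace 𝓘(ℝ, E) x) :
    g.cliffordCov cov (fun y => g.interior y (Y y) (F y)) x v =
      g.interior x (cov Y x v) (F x) + g.interior x (Y x) (g.cliffordCov cov F x v) := by
  apply g.rep_injective (mem_chartDomain x)
  have hx₀ := mem_chartDomain (E := E) x
  have hU' : IsOpen (U ∩ chartDomain (E := E) x) := hU.inter (isOpen_chartDomain x)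
  rw [map_add, rep_interior _ hx₀, rep_interior _ hx₀, rep_cliffordCov cov hF hU hx,
    rep_cliffordCov cov (hF.interior hY hU) hU hx, rep_interior _ hx₀,
    toChart_cov cov hY hU hx hx₀, exteriorDerivation_contraction]
  have h1 := vecDeriv_bilin ((hY.toChart hU x).linearMap (Module.Dual.eval ℝ E)) (hF x) hU'
    ⟨hx, hx₀⟩ v contraction
  rw [vecDeriv_linearMap (hY.toChart hU x) hU' ⟨hx, hx₀⟩] at h1
  have h2 : vecDeriv (fun y => g.rep x y (g.interior y (Y y) (F y))) x v =
      vecDeriv (fun y => contraction (Module.Dual.eval ℝ E (toChart x y (Y y)))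
        (g.localRep F x y)) x v := by
    refine vecDeriv_congr ?_ v
    filter_upwards [hU'.mem_nhds ⟨hx, hx₀⟩] with y hy
    exact g.rep_interior hy.2 _ _
  have h3 : (Module.Dual.eval ℝ E (toChart x x (Y x))).comp
      (-(chartConnection cov x x v).dualMap) =
      -Module.Dual.eval ℝ E (chartConnection cov x x v (toChart x x (Y x))) := by
    ext w
    simp
  rw [h2, h1, h3]
  simp only [map_add, map_neg, LinearMap.add_apply, LinearMap.neg_apply, sub_neg_eq_add]
  change _ + contraction _ (vecDeriv (fun y => g.rep x y (F y)) x v) + _ = _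
  change contraction _ (g.rep x x (F x)) + _ + _ = _
  abel

/-- The Leibniz rule for the Clifford product by a `1`-form; it holds because the connection is
metric, so that it commutes with the interior product with the dual vector field. -/
theorem cliffordCov_oneForm_mul (hcov : IsLeviCivita g cov) (hα : SmoothForm α U)
    (hF : g.SmoothOn F U) (hU : IsOpen U) (hx : x ∈ U) (v : TangentSpace 𝓘(ℝ, E) x) :
    g.cliffordCov cov (fun y => g.oneForm α y * F y) x v =
      g.cliffordCov cov (g.oneForm α) x v * F x + g.oneForm α x * g.cliffordCov cov F x v := by
  have h1 := (smoothOn_oneForm hα).wedge hF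
  have h2 := hF.interior (g.smoothField_sharp hα hU) hU
  rw [cliffordCov_congr (G := fun y => g.oneForm α y * F y) cov (h1.add h2) hU hx
      fun y _ => g.ι_mul_eq y (α y) (F y),
    cliffordCov_add cov h1 h2 hU hx, cliffordCov_wedge cov (smoothOn_oneForm hα) hF hU hx,
    cliffordCov_interior cov hF (g.smoothField_sharp hα hU) hU hx,
    cliffordCov_oneForm cov hα hU hx, ι_mul_eq, ← sharp_formCov g hcov hα hU hx]
  have h3 : g.oneForm α x * g.cliffordCov cov F x v = _ := g.ι_mul_eq x (α x) _
  rw [h3]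
  exact add_add_add_comm _ _ _ _

end PseudoRiemannianMetric
/-! ### Smoothness of covariant derivatives -/

/-- The derivation of `Λ E*` that extends the dual action of an endomorphism of `E`, as a linear
function of that endomorphism. -/
def dualDerivation (E : Type*) [AddCommGroup E] [Module ℝ E] :
    (E →ₗ[ℝ] E) →ₗ[ℝ] ExteriorAlgebra ℝ (Module.Dual ℝ E) →ₗ[ℝ]
      ExteriorAlgebra ℝ (Module.Dual ℝ E) where
  toFun A := exteriorDerivation (-A.dualMap)
  map_add' A B := by
    have h : -(A + B).dualMap = -A.dualMap + -B.dualMap := by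
      ext w u
      simp [add_comm]
    rw [h]
    exact map_add (exteriorDerivationHom (Module.Dual ℝ E)) _ _
  map_smul' c A := by
    have h : -(c • A).dualMap = c • -A.dualMap := by
      ext w u
      simp
    rw [h]
    exact map_smul (exteriorDerivationHom (Module.Dual ℝ E)) _ _

namespace PseudoRiemannianMetric

variable {E : Type*} [NormedAddCommGroup E] [NormedSpace ℝ E] [FiniteDimensional ℝ E]
  {M : Type*} [TopologicalSpace M] [ChartedSpace E M] [IsManifold 𝓘(ℝ, E) ∞ M]
  {g : PseudoRiemannianMetric E M}
  (cov : CovariantDerivative 𝓘(ℝ, E) E (TangentSpace 𝓘(ℝ, E) : M → Type _))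
  {U : Set M} {X Y Z : Π x : M, TangentSpace 𝓘(ℝ, E) x} {x : M}
  {α β : Π x : M, Cotangent (E := E) x} {F G : Π x : M, g.Cl x}

theorem unrep_algebraMap (x₀ y : M) (r : ℝ) :
    g.unrep x₀ y (algebraMap ℝ _ r) = algebraMap ℝ _ r := by
  apply (g.toForm y).injective
  simp only [unrep, LinearMap.comp_apply, LinearEquiv.coe_coe, LinearEquiv.apply_symm_apply,
    AlgHom.toLinearMap_apply, toForm_algebraMap, AlgHom.commutes]

theorem unrep_ι (x₀ y : M) (w : Module.Dual ℝ E) :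
    g.unrep x₀ y (ExteriorAlgebra.ι ℝ w) = CliffordAlgebra.ι _ (w.comp (toChart x₀ y)) := by
  apply (g.toForm y).injective
  simp only [unrep, LinearMap.comp_apply, LinearEquiv.coe_coe, LinearEquiv.apply_symm_apply,
    AlgHom.toLinearMap_apply, toForm_ι, ExteriorAlgebra.map_apply_ι]
  rfl

theorem unrep_mul (x₀ y : M) (a b : ExteriorAlgebra ℝ (Module.Dual ℝ E)) :
    g.unrep x₀ y (a * b) = cliffordWedge (g.unrep x₀ y a) (g.unrep x₀ y b) := by
  simp only [unrep, cliffordWedge, toForm, LinearMap.comp_apply, LinearEquiv.coe_coe,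
    AlgHom.toLinearMap_apply, LinearEquiv.apply_symm_apply, map_mul]

/-- The coordinate `1`-forms of a chart are smooth, and their covariant derivatives are given by
the transpose of the connection form. -/
theorem smoothForm_coord_and_formCov (x₀ : M) (w : Module.Dual ℝ E) :
    SmoothForm (fun y : M => w.comp (toChart x₀ y)) (chartDomain (E := E) x₀) ∧
    ∀ y ∈ chartDomain (E := E) x₀, ∀ v : TangentSpace 𝓘(ℝ, E) y,
      formCov cov (fun y : M => w.comp (toChart x₀ y)) y v =
        (-(w.comp (chartConnection cov x₀ y v))).comp (toChart x₀ y) := by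
  have hD := isOpen_chartDomain (E := E) x₀
  have h1 : SmoothForm (fun y : M => w.comp (toChart x₀ y)) (chartDomain (E := E) x₀) :=
    smoothForm_of_chart hD subset_rfl (Module.finBasis ℝ E) fun i =>
      ContMDiffOn.congr (f := fun _ => w (Module.finBasis ℝ E i)) contMDiffOn_const
        fun y hy => congrArg w (toChart_ofChart hy _)
  refine ⟨h1, fun y hy v => ?_⟩
  ext u
  have h2 := formCov_apply cov h1 (smoothField_ofChart x₀ (toChart x₀ y u)) hD hy v
  have h3 : mvfderiv 𝓘(ℝ, E)
      (fun z => (w.comp (toChart x₀ z)) (ofChart x₀ z (toChart x₀ y u))) y v = 0 := by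
    have : mvfderiv 𝓘(ℝ, E)
        (fun z => (w.comp (toChart x₀ z)) (ofChart x₀ z (toChart x₀ y u))) y =
        mvfderiv 𝓘(ℝ, E) (fun _ => w (toChart x₀ y u)) y := by
      refine mvfderiv_congr_of_eventuallyEq ?_
      filter_upwards [hD.mem_nhds hy] with z hz
      exact congrArg w (toChart_ofChart hz _)
    rw [this]
    exact congrArg (fun L : TangentSpace 𝓘(ℝ, E) y →L[ℝ] ℝ => L v) (mvfderiv_const _)
  simp only [ofChart_toChart hy] at h2
  rw [h2, h3]
  simp [chartConnection_apply cov hy]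

/-- Sections with constant components in a chart are smooth, and their covariant derivatives are
given by the derivation that extends the transpose of the connection form. -/
theorem smoothOn_const_and_cliffordCov (x₀ : M) (c : ExteriorAlgebra ℝ (Module.Dual ℝ E)) :
    g.SmoothOn (fun y => g.unrep x₀ y c) (chartDomain (E := E) x₀) ∧
    ∀ y ∈ chartDomain (E := E) x₀, ∀ v : TangentSpace 𝓘(ℝ, E) y,
      g.cliffordCov cov (fun y => g.unrep x₀ y c) y v =
        g.unrep x₀ y (exteriorDerivation (-(chartConnection cov x₀ y v).dualMap) c) := by
  have hD := isOpen_chartDomain (E := E) x₀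
  induction c using exterior_left_induction with
  | algebraMap r =>
    simp only [unrep_algebraMap, exteriorDerivation_algebraMap, map_zero]
    refine ⟨(cliffordCov_algebraMap cov r hD (mem_chartDomain x₀) 0).1, fun y hy v =>
      (cliffordCov_algebraMap cov r hD hy v).2⟩
  | add a b ha hb =>
    simp only [map_add]
    refine ⟨ha.1.add hb.1, fun y hy v => ?_⟩
    rw [cliffordCov_add cov ha.1 hb.1 hD hy, ha.2 y hy, hb.2 y hy]
  | ι_mul a w ha =>
    obtain ⟨h1, h2⟩ := smoothForm_coord_and_formCov cov x₀ w
    simp only [unrep_mul, unrep_ι, exteriorDerivation_ι_mul, map_add]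
    refine ⟨(smoothOn_oneForm h1).wedge ha.1, fun y hy v => ?_⟩
    have h3 := cliffordCov_wedge cov (smoothOn_oneForm (g := g) h1) ha.1 hD hy v
    rw [cliffordCov_oneForm cov h1 hD hy, ha.2 y hy, h2 y hy] at h3
    exact h3

/-- The covariant derivative of a section in the components of an arbitrary chart. -/
theorem rep_cliffordCov_chart {x₀ : M} (hF : g.SmoothOn F U) (hU : IsOpen U) (hx : x ∈ U)
    (hx₀ : x ∈ chartDomain (E := E) x₀) (v : TangentSpace 𝓘(ℝ, E) x) :
    g.rep x₀ x (g.cliffordCov cov F x v) = vecDeriv (fun y => g.rep x₀ y (F y)) x v +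
      exteriorDerivation (-(chartConnection cov x₀ x v).dualMap) (g.rep x₀ x (F x)) := by
  set U' := U ∩ chartDomain (E := E) x₀
  have hU' : IsOpen U' := hU.inter (isOpen_chartDomain x₀)
  have hx' : x ∈ U' := ⟨hx, hx₀⟩
  set b := Module.finBasis ℝ (ExteriorAlgebra ℝ (Module.Dual ℝ E))
  have hc : ∀ s, ContMDiffOn 𝓘(ℝ, E) 𝓘(ℝ, ℝ) ∞ (fun y => b.coord s (g.rep x₀ y (F y))) U' :=
    fun s => hF x₀ (b.coord s)
  have hb : ∀ s, g.SmoothOn (fun y => g.unrep x₀ y (b s)) U' := fun s =>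
    (smoothOn_const_and_cliffordCov cov x₀ (b s)).1.mono inter_subset_right
  have hs : ∀ s ∈ Finset.univ, g.SmoothOn
      (fun y => b.coord s (g.rep x₀ y (F y)) • g.unrep x₀ y (b s)) U' := fun s _ =>
    (hb s).smul (hc s)
  have h1 : ∀ y ∈ U', F y = ∑ s, b.coord s (g.rep x₀ y (F y)) • g.unrep x₀ y (b s) := by
    intro y hy
    have h := congrArg (g.unrep x₀ y) (b.sum_repr (g.rep x₀ y (F y)))
    rw [unrep_rep _ hy.2, map_sum] at h
    simpa using h.symm
  rw [cliffordCov_congr cov (SmoothOn.sum _ hs) hU' hx' h1, cliffordCov_sum cov _ hs hU' hx',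
    map_sum]
  have h2 : ∀ s, g.rep x₀ x (g.cliffordCov cov
      (fun y => b.coord s (g.rep x₀ y (F y)) • g.unrep x₀ y (b s)) x v) =
      mvfderiv 𝓘(ℝ, E) (fun y => b.coord s (g.rep x₀ y (F y))) x v • b s +
      b.coord s (g.rep x₀ x (F x)) •
        exteriorDerivation (-(chartConnection cov x₀ x v).dualMap) (b s) := by
    intro s
    rw [cliffordCov_smul cov (hc s) (hb s) hU' hx',
      (smoothOn_const_and_cliffordCov cov x₀ (b s)).2 x hx₀]
    simp only [map_add, map_smul, rep_unrep _ hx₀]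
  simp only [h2, Finset.sum_add_distrib]
  congr 1
  have h := congrArg (exteriorDerivation (-(chartConnection cov x₀ x v).dualMap))
    (b.sum_repr (g.rep x₀ x (F x)))
  rw [map_sum] at h
  simpa using h

theorem SmoothOn.cliffordCov
    (hcov : ∀ U : Set M, IsOpen U → ContMDiffCovariantDerivativeOn E ∞ cov.toFun U)
    (hF : g.SmoothOn F U) (hX : SmoothField X U) (hU : IsOpen U) :
    g.SmoothOn (fun y => g.cliffordCov cov F y (X y)) U := by
  rw [smoothOn_iff]
  intro x₀
  set U' := U ∩ chartDomain (E := E) x₀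
  have hU' : IsOpen U' := hU.inter (isOpen_chartDomain x₀)
  have h1 := g.smoothOn_iff.1 hF x₀
  have h2 : FunSmoothOn E (fun y => vecDeriv (fun y => g.rep x₀ y (F y)) y (X y)) U' := by
    refine FunSmoothOn.sum _ fun s _ => FunSmoothOn.smul ?_ (funSmoothOn_const _)
    exact funSmoothOn_real.2
      (contMDiffOn_mvfderiv_apply (h1 _) (hX.mono inter_subset_left) hU')
  have h3 := funSmoothOn_chartConnection cov hcov (hX.mono inter_subset_left) hU'
    (inter_subset_right (s := U) (t := chartDomain (E := E) x₀))
  exact (h2.add (h3.bilin h1 (dualDerivation E))).congr fun y hy =>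
    rep_cliffordCov_chart cov hF hU hy.1 hy.2 _

theorem isLinearMap_cliffordCov (hF : g.SmoothOn F U) (hU : IsOpen U) (hx : x ∈ U) :
    IsLinearMap ℝ (fun v => g.cliffordCov cov F x v) where
  map_add v w := by
    apply g.rep_injective (mem_chartDomain x)
    simp only [map_add, rep_cliffordCov cov hF hU hx, vecDeriv_linear_vec.map_add]
    have h2 := congrArg (fun L => L (g.rep x x (F x)))
      (map_add (dualDerivation E) (chartConnection cov x x v) (chartConnection cov x x w))
    rw [← chartConnection_add] at h2
    refine (congrArg (fun t => _ + t) h2).trans ?_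
    exact add_add_add_comm _ _ _ _
  map_smul c v := by
    apply g.rep_injective (mem_chartDomain x)
    simp only [map_smul, rep_cliffordCov cov hF hU hx, vecDeriv_linear_vec.map_smul]
    have h : chartConnection cov x x (c • v) = c • chartConnection cov x x v := by
      ext u
      simp [chartConnection_apply cov (mem_chartDomain x)]
    have h2 := congrArg (fun L => L (g.rep x x (F x)))
      (map_smul (dualDerivation E) c (chartConnection cov x x v))
    rw [h, smul_add]
    exact congrArg (fun t => _ + t) h2

end PseudoRiemannianMetric
/-! ### Clifford products of one-forms -/

section Grades

variable {V : Type*} [AddCommGroup V] [Module ℝ V]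

/-- The grades of the element of `Λ V` that represents the Clifford product of two vectors. -/
theorem exterior_grade_ι_mul_ι_add (a b : V) (r : ℝ) :
    GradedRing.proj (fun i : ℕ => ⋀[ℝ]^i V) 0
      (ExteriorAlgebra.ι ℝ a * ExteriorAlgebra.ι ℝ b + algebraMap ℝ _ r) = algebraMap ℝ _ r ∧
    GradedRing.proj (fun i : ℕ => ⋀[ℝ]^i V) 2
      (ExteriorAlgebra.ι ℝ a * ExteriorAlgebra.ι ℝ b + algebraMap ℝ _ r) =
        ExteriorAlgebra.ι ℝ a * ExteriorAlgebra.ι ℝ b := by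
  have h1 : ExteriorAlgebra.ι ℝ a * ExteriorAlgebra.ι ℝ b ∈ ⋀[ℝ]^2 V := by
    change _ ∈ LinearMap.range (ExteriorAlgebra.ι ℝ : V →ₗ[ℝ] _) ^ 2
    rw [pow_two]
    exact Submodule.mul_mem_mul (LinearMap.mem_range_self _ a) (LinearMap.mem_range_self _ b)
  have h2 : algebraMap ℝ (ExteriorAlgebra ℝ V) r ∈ ⋀[ℝ]^0 V :=
    SetLike.algebraMap_mem_graded (fun i : ℕ => ⋀[ℝ]^i V) r
  simp only [map_add, GradedRing.proj_apply]
  rw [DirectSum.decompose_of_mem_same (fun i : ℕ => ⋀[ℝ]^i V) h1,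
    DirectSum.decompose_of_mem_same (fun i : ℕ => ⋀[ℝ]^i V) h2,
    DirectSum.decompose_of_mem_ne (fun i : ℕ => ⋀[ℝ]^i V) h1 (by norm_num),
    DirectSum.decompose_of_mem_ne (fun i : ℕ => ⋀[ℝ]^i V) h2 (by norm_num), zero_add, add_zero]
  exact ⟨rfl, rfl⟩

theorem exterior_grade_three_ι (a : V) :
    GradedRing.proj (fun i : ℕ => ⋀[ℝ]^i V) 3 (ExteriorAlgebra.ι ℝ a) = 0 := by
  have h1 : ExteriorAlgebra.ι ℝ a ∈ ⋀[ℝ]^1 V := by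
    change _ ∈ LinearMap.range (ExteriorAlgebra.ι ℝ : V →ₗ[ℝ] _) ^ 1
    rw [pow_one]
    exact LinearMap.mem_range_self _ a
  rw [GradedRing.proj_apply, DirectSum.decompose_of_mem_ne (fun i : ℕ => ⋀[ℝ]^i V) h1
    (by norm_num)]

theorem contraction_ι (d : Module.Dual ℝ V) (v : V) :
    contraction d (ExteriorAlgebra.ι ℝ v) = algebraMap ℝ _ (d v) := by
  have h := contraction_ι_mul d v 1
  have h1 : contraction d (1 : ExteriorAlgebra ℝ V) = 0 := by
    rw [← map_one (algebraMap ℝ (ExteriorAlgebra ℝ V)), contraction_algebraMap]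
  rw [mul_one, h1, mul_zero, sub_zero] at h
  rw [h, Algebra.algebraMap_eq_smul_one]

end Grades

namespace PseudoRiemannianMetric

variable {E : Type*} [NormedAddCommGroup E] [NormedSpace ℝ E] [FiniteDimensional ℝ E]
  {M : Type*} [TopologicalSpace M] [ChartedSpace E M] [IsManifold 𝓘(ℝ, E) ∞ M]
  (g : PseudoRiemannianMetric E M)

theorem toForm_wedge (x : M) (a b : g.Cl x) :
    g.toForm x (cliffordWedge a b) = g.toForm x a * g.toForm x b := by
  simp only [cliffordWedge, toForm, LinearEquiv.apply_symm_apply]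

theorem toForm_interior (x : M) (w : TangentSpace 𝓘(ℝ, E) x) (a : g.Cl x) :
    g.toForm x (g.interior x w a) = contraction (Module.Dual.eval ℝ _ w) (g.toForm x a) := by
  rw [interior, LinearEquiv.apply_symm_apply]

/-- The Clifford product of two one-forms is the sum of its `2`-form part and its `0`-form part:
`ab = a ∧ b + g(a, b)`. -/
theorem ι_mul_ι (x : M) (a b : Cotangent (E := E) x) :
    (CliffordAlgebra.ι _ a * CliffordAlgebra.ι _ b : g.Cl x) =
      cliffordWedge (CliffordAlgebra.ι _ a) (CliffordAlgebra.ι _ b) +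
        algebraMap ℝ _ (g.cometric x a b) := by
  rw [ι_mul_eq]
  congr 1
  apply (g.toForm x).injective
  rw [toForm_interior, toForm_ι, contraction_ι, toForm_algebraMap, cometric_apply]
  rfl

theorem toForm_ι_mul_ι (x : M) (a b : Cotangent (E := E) x) :
    g.toForm x (CliffordAlgebra.ι _ a * CliffordAlgebra.ι _ b) =
      ExteriorAlgebra.ι ℝ a * ExteriorAlgebra.ι ℝ b + algebraMap ℝ _ (g.cometric x a b) := by
  rw [ι_mul_ι, map_add, toForm_wedge, toForm_ι, toForm_ι, toForm_algebraMap]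

theorem cliffordGrade_zero_ι_mul_ι (x : M) (a b : Cotangent (E := E) x) :
    cliffordGrade 0 (CliffordAlgebra.ι _ a * CliffordAlgebra.ι _ b : g.Cl x) =
      algebraMap ℝ _ (g.cometric x a b) := by
  apply (g.toForm x).injective
  rw [toForm_algebraMap, ← (exterior_grade_ι_mul_ι_add a b (g.cometric x a b)).1, ← toForm_ι_mul_ι]
  exact (g.toForm x).apply_symm_apply _

theorem cliffordGrade_two_ι_mul_ι (x : M) (a b : Cotangent (E := E) x) :
    cliffordGrade 2 (CliffordAlgebra.ι _ a * CliffordAlgebra.ι _ b : g.Cl x) =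
      cliffordWedge (CliffordAlgebra.ι _ a) (CliffordAlgebra.ι _ b) := by
  apply (g.toForm x).injective
  rw [toForm_wedge, toForm_ι, toForm_ι, ← (exterior_grade_ι_mul_ι_add a b (g.cometric x a b)).2,
    ← toForm_ι_mul_ι]
  exact (g.toForm x).apply_symm_apply _

theorem cliffordGrade_three_ι (x : M) (a : Cotangent (E := E) x) :
    cliffordGrade 3 (CliffordAlgebra.ι _ a : g.Cl x) = 0 := by
  apply (g.toForm x).injective
  rw [map_zero, ← exterior_grade_three_ι a, ← g.toForm_ι]
  exact (g.toForm x).apply_symm_apply _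

/-- The Clifford product of a `2`-form with a one-form has a `3`-form part and a one-form part:
`(a ∧ b) c = a ∧ b ∧ c + g(b, c) a - g(a, c) b`. -/
theorem wedge_mul_ι (x : M) (a b c : Cotangent (E := E) x) :
    (cliffordWedge (CliffordAlgebra.ι _ a) (CliffordAlgebra.ι _ b) * CliffordAlgebra.ι _ c : g.Cl x)
      = cliffordWedge (cliffordWedge (CliffordAlgebra.ι _ a) (CliffordAlgebra.ι _ b))
          (CliffordAlgebra.ι _ c) +
        (g.cometric x b c • CliffordAlgebra.ι _ a - g.cometric x a c • CliffordAlgebra.ι _ b) := by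
  rw [eq_sub_of_add_eq (g.ι_mul_ι x a b).symm, sub_mul, mul_assoc, g.ι_mul_ι x b c, mul_add,
    g.ι_mul_eq x a]
  apply (g.toForm x).injective
  simp only [map_add, map_sub, map_smul, toForm_wedge, toForm_ι, toForm_interior,
    ← Algebra.commutes, ← Algebra.smul_def, contraction_ι_mul, contraction_ι]
  have h (d : Cotangent (E := E) x) :
      Module.Dual.eval ℝ (TangentSpace 𝓘(ℝ, E) x) (g.sharp x a) d = g.cometric x a d :=
    (g.cometric_apply x a d).symm
  rw [h, h, toForm_ι_mul_ι, toForm_algebraMap, add_sub_cancel_right, mul_assoc]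
  abel

end PseudoRiemannianMetric

/-! ### Frames and coframes -/

section Frames

variable {E : Type*} [NormedAddCommGroup E] [NormedSpace ℝ E] [FiniteDimensional ℝ E]
  {M : Type*} [TopologicalSpace M] [ChartedSpace E M] [IsManifold 𝓘(ℝ, E) ∞ M]
  {ι : Type*} [Fintype ι] [DecidableEq ι] {U U' : Set M}
  {e e' : ι → Π x : M, TangentSpace 𝓘(ℝ, E) x} {θ θ' : ι → Π x : M, Cotangent (E := E) x}

theorem IsFrameOn.mono (h : IsFrameOn U e θ) (hU' : IsOpen U') (hs : U' ⊆ U) :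
    IsFrameOn U' e θ :=
  ⟨hU', h.frame.mono hs, fun x hx => h.dual x (hs hx)⟩

theorem IsFrameOn.smoothField (h : IsFrameOn U e θ) (μ : ι) : SmoothField (e μ) U :=
  h.frame.contMDiffOn μ

theorem IsFrameOn.eq_sum_frame (h : IsFrameOn U e θ) {x : M} (hx : x ∈ U)
    (w : TangentSpace 𝓘(ℝ, E) x) : w = ∑ ρ, θ ρ x w • e ρ x := by
  have h1 : ∀ w ∈ Submodule.span ℝ (Set.range fun ρ => e ρ x), w = ∑ ρ, θ ρ x w • e ρ x := by
    intro w hw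
    induction hw using Submodule.span_induction with
    | mem w hw =>
      obtain ⟨ν, rfl⟩ := hw
      simp [h.dual x hx]
    | zero => simp
    | add v w _ _ hv hw =>
      nth_rewrite 1 [hv, hw]
      simp only [map_add, add_smul, Finset.sum_add_distrib]
    | smul c w _ hw =>
      nth_rewrite 1 [hw]
      simp only [map_smul, Finset.smul_sum, smul_smul, smul_eq_mul]
  exact h1 w (h.frame.generating hx trivial)

theorem IsFrameOn.eq_sum_coframe (h : IsFrameOn U e θ) {x : M} (hx : x ∈ U)
    (a : Cotangent (E := E) x) : a = ∑ ρ, a (e ρ x) • θ ρ x := by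
  ext w
  nth_rewrite 1 [h.eq_sum_frame hx w]
  simp only [map_sum, map_smul, smul_eq_mul, LinearMap.sum_apply, LinearMap.smul_apply]
  exact Finset.sum_congr rfl fun ρ _ => mul_comm _ _

/-- The contraction of a coframe with its frame does not depend on the frame. -/
theorem IsFrameOn.contract_eq (h : IsFrameOn U e θ) (h' : IsFrameOn U' e' θ') {x : M}
    (hx : x ∈ U) (hx' : x ∈ U') {W : Type*} [AddCommGroup W] [Module ℝ W]
    (T : Cotangent (E := E) x →ₗ[ℝ] TangentSpace 𝓘(ℝ, E) x →ₗ[ℝ] W) :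
    ∑ α, T (θ α x) (e α x) = ∑ α, T (θ' α x) (e' α x) := by
  calc ∑ α, T (θ α x) (e α x) = ∑ α, ∑ β, θ' β x (e α x) • T (θ α x) (e' β x) := by
        refine Finset.sum_congr rfl fun α _ => ?_
        nth_rewrite 1 [h'.eq_sum_frame hx' (e α x)]
        simp only [map_sum, map_smul]
    _ = ∑ β, T (∑ α, θ' β x (e α x) • θ α x) (e' β x) := by
        rw [Finset.sum_comm]
        simp only [map_sum, map_smul, LinearMap.sum_apply, LinearMap.smul_apply]
    _ = _ := by
        refine Finset.sum_congr rfl fun β _ => ?_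
        rw [← h.eq_sum_coframe hx]

/-- `∇_v θ^β = - θ^β(∇_v e_ρ) θ^ρ`. -/
theorem IsFrameOn.formCov_coframe (h : IsFrameOn U e θ)
    (cov : CovariantDerivative 𝓘(ℝ, E) E (TangentSpace 𝓘(ℝ, E) : M → Type _)) {x : M} (hx : x ∈ U)
    (v : TangentSpace 𝓘(ℝ, E) x) (β : ι) :
    formCov cov (θ β) x v = -∑ ρ, θ β x (cov (e ρ) x v) • θ ρ x := by
  rw [h.eq_sum_coframe hx (formCov cov (θ β) x v), ← Finset.sum_neg_distrib]
  refine Finset.sum_congr rfl fun ρ _ => ?_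
  rw [formCov_apply cov (h.smoothForm β) (h.smoothField ρ) h.isOpen hx]
  have h1 : mvfderiv 𝓘(ℝ, E) (fun y => θ β y (e ρ y)) x =
      mvfderiv 𝓘(ℝ, E) (fun _ : M => if β = ρ then (1 : ℝ) else 0) x := by
    refine mvfderiv_congr_of_eventuallyEq ?_
    filter_upwards [h.isOpen.mem_nhds hx] with y hy using h.dual y hy β ρ
  rw [h1]
  simp only [mvfderiv, mfderiv_const, ContinuousLinearMap.comp_zero, zero_apply, zero_sub]
  exact neg_smul (θ β x (cov (e ρ) x v)) (θ ρ x)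

end Frames
/-! ### The second covariant derivative and the square of the Dirac operator -/

namespace PseudoRiemannianMetric

variable {E : Type*} [NormedAddCommGroup E] [NormedSpace ℝ E] [FiniteDimensional ℝ E]
  {M : Type*} [TopologicalSpace M] [ChartedSpace E M] [IsManifold 𝓘(ℝ, E) ∞ M]
  {g : PseudoRiemannianMetric E M}
  (cov : CovariantDerivative 𝓘(ℝ, E) E (TangentSpace 𝓘(ℝ, E) : M → Type _))
  {U : Set M} {x : M} {F : Π x : M, g.Cl x} {Y : Π x : M, TangentSpace 𝓘(ℝ, E) x}

variable (g) in
/-- The second covariant derivative `∇²_{v, Y} F = ∇_v ∇_Y F - ∇_{∇_v Y} F` at `x`. -/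
def hessian (F : Π x : M, g.Cl x) (Y : Π x : M, TangentSpace 𝓘(ℝ, E) x) (x : M)
    (v : TangentSpace 𝓘(ℝ, E) x) : g.Cl x :=
  g.cliffordCov cov (fun y => g.cliffordCov cov F y (Y y)) x v - g.cliffordCov cov F x (cov Y x v)

theorem cliffordCov_sum_vec (hF : g.SmoothOn F U) (hU : IsOpen U) (hx : x ∈ U) {κ : Type*}
    (s : Finset κ) (c : κ → ℝ) (w : κ → TangentSpace 𝓘(ℝ, E) x) :
    g.cliffordCov cov F x (∑ i ∈ s, c i • w i) = ∑ i ∈ s, c i • g.cliffordCov cov F x (w i) := by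
  have h := map_sum (isLinearMap_cliffordCov cov hF hU hx).mk' (fun i => c i • w i) s
  exact h.trans (Finset.sum_congr rfl fun i _ =>
    (isLinearMap_cliffordCov cov hF hU hx).map_smul _ _)

theorem isLinearMap_hessian
    (hcov : ∀ U : Set M, IsOpen U → ContMDiffCovariantDerivativeOn E ∞ cov.toFun U)
    (hF : g.SmoothOn F U) (hY : SmoothField Y U) (hU : IsOpen U) (hx : x ∈ U) :
    IsLinearMap ℝ (fun v => g.hessian cov F Y x v) := by
  have h1 := isLinearMap_cliffordCov cov (hF.cliffordCov cov hcov hY hU) hU hx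
  have h2 := isLinearMap_cliffordCov cov hF hU hx
  refine ⟨fun v w => ?_, fun c v => ?_⟩
  · simp only [hessian, map_add]
    rw [h1.map_add, h2.map_add]
    abel
  · simp only [hessian, map_smul]
    rw [h1.map_smul, h2.map_smul, smul_sub]

/-- The second covariant derivative is tensorial in the differentiated field: the derivatives of
the coefficients `c i` cancel between its two terms. -/
theorem hessian_sum_smul
    (hcov : ∀ U : Set M, IsOpen U → ContMDiffCovariantDerivativeOn E ∞ cov.toFun U)
    (hF : g.SmoothOn F U) (hU : IsOpen U) (hx : x ∈ U) {κ : Type*} [Fintype κ] {c : κ → M → ℝ}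
    {Z : κ → Π x : M, TangentSpace 𝓘(ℝ, E) x}
    (hc : ∀ i, ContMDiffOn 𝓘(ℝ, E) 𝓘(ℝ, ℝ) ∞ (c i) U) (hZ : ∀ i, SmoothField (Z i) U)
    (hY : ∀ y ∈ U, Y y = ∑ i, c i y • Z i y) (v : TangentSpace 𝓘(ℝ, E) x) :
    g.hessian cov F Y x v = ∑ i, c i x • g.hessian cov F (Z i) x v := by
  have h1 : ∀ i, g.SmoothOn (fun y => c i y • g.cliffordCov cov F y (Z i y)) U := fun i =>
    (hF.cliffordCov cov hcov (hZ i) hU).smul (hc i)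
  have h2 : g.cliffordCov cov (fun y => g.cliffordCov cov F y (Y y)) x v =
      ∑ i, (mvfderiv 𝓘(ℝ, E) (c i) x v • g.cliffordCov cov F x (Z i x) +
        c i x • g.cliffordCov cov (fun y => g.cliffordCov cov F y (Z i y)) x v) := by
    rw [cliffordCov_congr cov (F := fun y => ∑ i, c i y • g.cliffordCov cov F y (Z i y))
      (SmoothOn.sum _ fun i _ => h1 i) hU hx ?_ v, cliffordCov_sum cov _ (fun i _ => h1 i) hU hx]
    · exact Finset.sum_congr rfl fun i _ =>
        cliffordCov_smul cov (hc i) (hF.cliffordCov cov hcov (hZ i) hU) hU hx v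
    · intro y hy
      rw [hY y hy, cliffordCov_sum_vec cov hF hU hy]
  have h3 : g.cliffordCov cov F x (cov Y x v) =
      ∑ i, (mvfderiv 𝓘(ℝ, E) (c i) x v • g.cliffordCov cov F x (Z i x) +
        c i x • g.cliffordCov cov F x (cov (Z i) x v)) := by
    rw [cov_congr cov (smoothField_sum_smul hU hc hZ) hU hx hY, cov_sum_smul cov hU hx hc hZ,
      Finset.sum_add_distrib, (isLinearMap_cliffordCov cov hF hU hx).map_add,
      cliffordCov_sum_vec cov hF hU hx, cliffordCov_sum_vec cov hF hU hx, Finset.sum_add_distrib]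
  rw [hessian, h2, h3, ← Finset.sum_sub_distrib]
  refine Finset.sum_congr rfl fun i _ => ?_
  rw [add_sub_add_left_eq_sub, ← smul_sub, hessian]

variable {ι : Type*} [Fintype ι] [DecidableEq ι] {U' : Set M}
  {e e' : ι → Π x : M, TangentSpace 𝓘(ℝ, E) x} {θ θ' : ι → Π x : M, Cotangent (E := E) x}

/-- The sum over `ρ` in `secondCov` assembles to `∇_{∇_{e_α} e_β} F`. -/
theorem secondCov_eq_hessian (h : IsFrameOn U e θ) (hF : g.SmoothOn F U) (hx : x ∈ U) (α β : ι) :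
    g.secondCov cov e θ α β F x = g.hessian cov F (e β) x (e α x) := by
  rw [secondCov, hessian, h.eq_sum_frame hx (cov (e β) x (e α x)),
    cliffordCov_sum_vec cov hF h.isOpen hx]
  rfl

theorem dirac_congr_frame (h : IsFrameOn U e θ) (h' : IsFrameOn U' e' θ')
    (hF : g.SmoothOn F (U ∩ U')) (hx : x ∈ U ∩ U') :
    g.dirac cov e θ F x = g.dirac cov e' θ' F x :=
  h.contract_eq h' hx.1 hx.2 (LinearMap.mk₂ ℝ
    (fun a v => (CliffordAlgebra.ι _ a : g.Cl x) * g.cliffordCov cov F x v)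
    (fun a b v => by rw [map_add, add_mul]) (fun c a v => by rw [map_smul, smul_mul_assoc])
    (fun a v w => by
      rw [(isLinearMap_cliffordCov cov hF (h.isOpen.inter h'.isOpen) hx).map_add, mul_add])
    (fun c a v => by
      rw [(isLinearMap_cliffordCov cov hF (h.isOpen.inter h'.isOpen) hx).map_smul,
        mul_smul_comm]))

/-- Contracting the second covariant derivative with a bilinear function of two one-forms gives an
operator that does not depend on the frame. -/
theorem secondCov_contract_eq
    (hcov : ∀ U : Set M, IsOpen U → ContMDiffCovariantDerivativeOn E ∞ cov.toFun U)
    (h : IsFrameOn U e θ) (h' : IsFrameOn U' e' θ')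
    (hF : g.SmoothOn F (U ∩ U')) (hx : x ∈ U ∩ U')
    (T : Cotangent (E := E) x →ₗ[ℝ] Cotangent (E := E) x →ₗ[ℝ] g.Cl x →ₗ[ℝ] g.Cl x) :
    ∑ α, ∑ β, T (θ α x) (θ β x) (g.secondCov cov e θ α β F x) =
      ∑ α, ∑ β, T (θ' α x) (θ' β x) (g.secondCov cov e' θ' α β F x) := by
  have hU : IsOpen (U ∩ U') := h.isOpen.inter h'.isOpen
  -- the second covariant derivative as a bilinear function of two tangent vectors at `x`
  let H : TangentSpace 𝓘(ℝ, E) x →ₗ[ℝ] TangentSpace 𝓘(ℝ, E) x →ₗ[ℝ] g.Cl x :=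
    ∑ γ, (θ γ x).smulRight (isLinearMap_hessian cov hcov hF
      ((h.smoothField γ).mono inter_subset_left) hU hx).mk'
  have hH (w v : TangentSpace 𝓘(ℝ, E) x) :
      H w v = ∑ γ, θ γ x w • g.hessian cov F (e γ) x v := by
    simp only [H, LinearMap.sum_apply, LinearMap.smulRight_apply, LinearMap.smul_apply]
    rfl
  have key {Y : Π x : M, TangentSpace 𝓘(ℝ, E) x} (hY : SmoothField Y (U ∩ U'))
      (v : TangentSpace 𝓘(ℝ, E) x) : g.hessian cov F Y x v = H (Y x) v := by
    rw [hH]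
    exact hessian_sum_smul cov hcov hF hU hx
      (fun γ => ((h.smoothForm γ).mono inter_subset_left).apply_field hY hU)
      (fun γ => (h.smoothField γ).mono inter_subset_left)
      (fun y hy => h.eq_sum_frame hy.1 (Y y)) v
  have hs (α β : ι) : g.secondCov cov e θ α β F x = H (e β x) (e α x) := by
    rw [secondCov_eq_hessian cov (h.mono hU inter_subset_left) hF hx]
    exact key ((h.smoothField β).mono inter_subset_left) _
  have hs' (α β : ι) : g.secondCov cov e' θ' α β F x = H (e' β x) (e' α x) := by
    rw [secondCov_eq_hessian cov (h'.mono hU inter_subset_right) hF hx]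
    exact key ((h'.smoothField β).mono inter_subset_right) _
  simp only [hs, hs']
  have h1 (a : Cotangent (E := E) x) (v : TangentSpace 𝓘(ℝ, E) x) :
      ∑ β, T a (θ β x) (H (e β x) v) = ∑ β, T a (θ' β x) (H (e' β x) v) :=
    h.contract_eq h' hx.1 hx.2 (LinearMap.mk₂ ℝ (fun b w => T a b (H w v))
      (by simp) (by simp) (by simp) (by simp))
  have h2 (b : Cotangent (E := E) x) (w : TangentSpace 𝓘(ℝ, E) x) :
      ∑ α, T (θ α x) b (H w (e α x)) = ∑ α, T (θ' α x) b (H w (e' α x)) :=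
    h.contract_eq h' hx.1 hx.2 (LinearMap.mk₂ ℝ (fun a v => T a b (H w v))
      (by simp) (by simp) (by simp) (by simp))
  simp only [h1]
  rw [Finset.sum_comm]
  simp only [h2]
  rw [Finset.sum_comm]

theorem dAlembertian_congr_frame
    (hcov : ∀ U : Set M, IsOpen U → ContMDiffCovariantDerivativeOn E ∞ cov.toFun U)
    (h : IsFrameOn U e θ) (h' : IsFrameOn U' e' θ')
    (hF : g.SmoothOn F (U ∩ U')) (hx : x ∈ U ∩ U') :
    g.dAlembertian cov e θ F x = g.dAlembertian cov e' θ' F x := by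
  have h1 := secondCov_contract_eq cov hcov h h' hF hx
    ((g.cometric x).compr₂ (LinearMap.toSpanSingleton ℝ (g.Cl x →ₗ[ℝ] g.Cl x) LinearMap.id))
  simp only [LinearMap.compr₂_apply, LinearMap.toSpanSingleton_apply, LinearMap.smul_apply,
    LinearMap.id_apply] at h1
  exact h1

theorem ricciOp_congr_frame
    (hcov : ∀ U : Set M, IsOpen U → ContMDiffCovariantDerivativeOn E ∞ cov.toFun U)
    (h : IsFrameOn U e θ) (h' : IsFrameOn U' e' θ')
    (hF : g.SmoothOn F (U ∩ U')) (hx : x ∈ U ∩ U') :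
    g.ricciOp cov e θ F x = g.ricciOp cov e' θ' F x :=
  secondCov_contract_eq cov hcov h h' hF hx (LinearMap.mk₂ ℝ
    (fun a b => LinearMap.mulLeft ℝ
      (cliffordWedge (CliffordAlgebra.ι _ a) (CliffordAlgebra.ι _ b) : g.Cl x))
    (fun a b c => by ext; simp [cliffordWedge, add_mul])
    (fun r a b => by ext; simp [cliffordWedge])
    (fun a b c => by ext; simp [cliffordWedge, mul_add, add_mul])
    (fun r a b => by ext; simp [cliffordWedge]))

/-- The square of the Dirac operator. The terms in which `∇_{e_α}` falls on the coframe are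
`θ^α (∇_{e_α} θ^β) ∇_{e_β} = - γ^β_{αρ} θ^α θ^ρ ∇_{e_β}`. -/
theorem dirac_dirac (hcov : IsLeviCivita g cov) (h : IsFrameOn U e θ) (hF : g.SmoothOn F U)
    (hx : x ∈ U) :
    g.dirac cov e θ (g.dirac cov e θ F) x =
      ∑ α, ∑ β, g.oneForm (θ α) x * g.oneForm (θ β) x * g.secondCov cov e θ α β F x := by
  have h0 (β : ι) : g.SmoothOn (fun y => g.cliffordCov cov F y (e β y)) U :=
    hF.cliffordCov cov hcov.smooth (h.smoothField β) h.isOpen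
  have h1 (β : ι) : g.SmoothOn (fun y => g.oneForm (θ β) y * g.cliffordCov cov F y (e β y)) U :=
    (h0 β).oneForm_mul (h.smoothForm β) h.isOpen
  have h2 (v : TangentSpace 𝓘(ℝ, E) x) (β : ι) :
      g.cliffordCov cov (g.oneForm (θ β)) x v =
        -∑ ρ, θ β x (cov (e ρ) x v) • g.oneForm (θ ρ) x := by
    rw [cliffordCov_oneForm cov (h.smoothForm β) h.isOpen hx, h.formCov_coframe cov hx, map_neg,
      map_sum]
    simp only [map_smul]
    rfl
  have h3 (v : TangentSpace 𝓘(ℝ, E) x) :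
      ∑ β, g.cliffordCov cov (g.oneForm (θ β)) x v * g.cliffordCov cov F x (e β x) =
        -∑ ρ, g.oneForm (θ ρ) x * g.cliffordCov cov F x (cov (e ρ) x v) := by
    simp only [h2, neg_mul, Finset.sum_mul, Finset.sum_neg_distrib]
    rw [Finset.sum_comm]
    congr 1
    refine Finset.sum_congr rfl fun ρ _ => ?_
    rw [h.eq_sum_frame hx (cov (e ρ) x v), cliffordCov_sum_vec cov hF h.isOpen hx,
      ← h.eq_sum_frame hx, Finset.mul_sum]
    refine Finset.sum_congr rfl fun β _ => ?_
    rw [smul_mul_assoc, mul_smul_comm]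
  change ∑ α, g.oneForm (θ α) x * g.cliffordCov cov
    (fun y => ∑ β, g.oneForm (θ β) y * g.cliffordCov cov F y (e β y)) x (e α x) = _
  refine Finset.sum_congr rfl fun α _ => ?_
  rw [cliffordCov_sum cov _ (fun β _ => h1 β) h.isOpen hx,
    Finset.sum_congr rfl fun β _ => cliffordCov_oneForm_mul cov hcov (h.smoothForm β) (h0 β)
      h.isOpen hx (e α x), Finset.sum_add_distrib, h3, neg_add_eq_sub, ← Finset.sum_sub_distrib,
    Finset.mul_sum]
  refine Finset.sum_congr rfl fun β _ => ?_
  rw [secondCov_eq_hessian cov h hF hx, hessian, ← mul_sub, mul_assoc]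

/-- The splitting of `θ^α θ^β` into its `0`-form and `2`-form parts splits `∂²`. -/
theorem dAlembertian_add_ricciOp (F : Π x : M, g.Cl x) (x : M) :
    g.dAlembertian cov e θ F x + g.ricciOp cov e θ F x =
      ∑ α, ∑ β, g.oneForm (θ α) x * g.oneForm (θ β) x * g.secondCov cov e θ α β F x := by
  simp only [dAlembertian, ricciOp, ← Finset.sum_add_distrib]
  refine Finset.sum_congr rfl fun α _ => Finset.sum_congr rfl fun β _ => ?_
  rw [oneForm, oneForm, g.ι_mul_ι, add_mul, add_comm, Algebra.smul_def]

end PseudoRiemannianMetric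
/-! ### Lie brackets -/

section Bracket

variable {E : Type*} [NormedAddCommGroup E] [NormedSpace ℝ E] [FiniteDimensional ℝ E]
  {M : Type*} [TopologicalSpace M] [ChartedSpace E M] [IsManifold 𝓘(ℝ, E) ∞ M]
  {U : Set M} {X Y Z Z' : Π x : M, TangentSpace 𝓘(ℝ, E) x} {x : M}

open VectorField

theorem SmoothField.mlieBracket (hX : SmoothField X U) (hY : SmoothField Y U) (hU : IsOpen U) :
    SmoothField (mlieBracket 𝓘(ℝ, E) X Y) U := by
  intro y hy
  have : IsManifold 𝓘(ℝ, E) (((⊤ : ℕ∞) : ℕ∞ω) + 1) M := inferInstanceAs (IsManifold 𝓘(ℝ, E) ∞ M)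
  have : IsManifold 𝓘(ℝ, E) (minSmoothness ℝ 2) M := by
    rw [minSmoothness_of_isRCLikeNormedField]
    infer_instance
  have hX' := (hX y hy).contMDiffAt (hU.mem_nhds hy)
  have hY' := (hY y hy).contMDiffAt (hU.mem_nhds hy)
  refine ContMDiffAt.contMDiffWithinAt ?_
  refine ContMDiffAt.mlieBracket_vectorField (m := ⊤) (n := ⊤) hX' hY' ?_
  rw [minSmoothness_of_isRCLikeNormedField]
  exact le_rfl

theorem mlieBracket_congr_right (hU : IsOpen U) (hx : x ∈ U) (h : ∀ y ∈ U, Z' y = Z y) :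
    mlieBracket 𝓘(ℝ, E) X Z' x = mlieBracket 𝓘(ℝ, E) X Z x := by
  refine Filter.EventuallyEq.mlieBracket_vectorField_eq Filter.EventuallyEq.rfl ?_
  filter_upwards [hU.mem_nhds hx] with y hy using h y hy

theorem mlieBracket_fun_smul {f : M → ℝ} (hf : ContMDiffOn 𝓘(ℝ, E) 𝓘(ℝ, ℝ) ∞ f U)
    (hZ : SmoothField Z U) (hU : IsOpen U) (hx : x ∈ U) :
    mlieBracket 𝓘(ℝ, E) X (fun y => f y • Z y) x =
      mvfderiv 𝓘(ℝ, E) f x (X x) • Z x + f x • mlieBracket 𝓘(ℝ, E) X Z x :=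
  mlieBracket_smul_right (hf.mdiffAt hU hx) (hZ.mdiffAt hU hx)

theorem leibniz_mlieBracket (hX : SmoothField X U) (hY : SmoothField Y U) (hZ : SmoothField Z U)
    (hU : IsOpen U) (hx : x ∈ U) :
    mlieBracket 𝓘(ℝ, E) X (mlieBracket 𝓘(ℝ, E) Y Z) x =
      mlieBracket 𝓘(ℝ, E) (mlieBracket 𝓘(ℝ, E) X Y) Z x +
        mlieBracket 𝓘(ℝ, E) Y (mlieBracket 𝓘(ℝ, E) X Z) x := by
  have : IsManifold 𝓘(ℝ, E) (minSmoothness ℝ 3) M := by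
    rw [minSmoothness_of_isRCLikeNormedField]
    infer_instance
  have h (W : Π x : M, TangentSpace 𝓘(ℝ, E) x) (hW : SmoothField W U) :
      CMDiffAt (minSmoothness ℝ 2) (T% W) x := by
    rw [minSmoothness_of_isRCLikeNormedField]
    exact ((hW x hx).contMDiffAt (hU.mem_nhds hx)).of_le ENat.LEInfty.out
  exact leibniz_identity_mlieBracket_apply (h X hX) (h Y hY) (h Z hZ)

theorem mlieBracket_mlieBracket_smul {f : M → ℝ} (hf : ContMDiffOn 𝓘(ℝ, E) 𝓘(ℝ, ℝ) ∞ f U)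
    (hY : SmoothField Y U) (hZ : SmoothField Z U) (hU : IsOpen U) (hx : x ∈ U) :
    mlieBracket 𝓘(ℝ, E) X (mlieBracket 𝓘(ℝ, E) Y (fun y => f y • Z y)) x =
      (mvfderiv 𝓘(ℝ, E) (fun y => mvfderiv 𝓘(ℝ, E) f y (Y y)) x (X x) • Z x +
        mvfderiv 𝓘(ℝ, E) f x (Y x) • mlieBracket 𝓘(ℝ, E) X Z x) +
      (mvfderiv 𝓘(ℝ, E) f x (X x) • mlieBracket 𝓘(ℝ, E) Y Z x +
        f x • mlieBracket 𝓘(ℝ, E) X (mlieBracket 𝓘(ℝ, E) Y Z) x) := by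
  have h1 := contMDiffOn_mvfderiv_apply hf hY hU
  have h2 := hY.mlieBracket hZ hU
  rw [mlieBracket_congr_right hU hx fun y hy => mlieBracket_fun_smul hf hZ hU hy]
  refine (mlieBracket_add_right ((hZ.smul hU h1).mdiffAt hU hx)
    ((h2.smul hU hf).mdiffAt hU hx)).trans ?_
  rw [mlieBracket_fun_smul h1 hZ hU hx, mlieBracket_fun_smul hf h2 hU hx]

/-- The Lie bracket acts on functions as the commutator: `[X, Y] f = X (Y f) - Y (X f)`. It is the
coefficient of `Z` in the Jacobi identity for `X`, `Y` and `f Z`. -/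
theorem mvfderiv_mlieBracket {f : M → ℝ} (hf : ContMDiffOn 𝓘(ℝ, E) 𝓘(ℝ, ℝ) ∞ f U)
    (hX : SmoothField X U) (hY : SmoothField Y U) (hU : IsOpen U) (hx : x ∈ U) :
    mvfderiv 𝓘(ℝ, E) f x (mlieBracket 𝓘(ℝ, E) X Y x) =
      mvfderiv 𝓘(ℝ, E) (fun y => mvfderiv 𝓘(ℝ, E) f y (Y y)) x (X x) -
        mvfderiv 𝓘(ℝ, E) (fun y => mvfderiv 𝓘(ℝ, E) f y (X y)) x (Y x) := by
  by_cases h0 : ∀ w : TangentSpace 𝓘(ℝ, E) x, w = 0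
  · rw [h0 (X x), h0 (Y x), h0 (mlieBracket 𝓘(ℝ, E) X Y x)]
    simp only [map_zero, sub_zero]
  push Not at h0
  obtain ⟨w, hw⟩ := h0
  -- a smooth vector field near `x` that does not vanish at `x`
  let Z : Π y : M, TangentSpace 𝓘(ℝ, E) y := fun y => ofChart x y (toChart x x w)
  have hV : IsOpen (U ∩ chartDomain (E := E) x) := hU.inter (isOpen_chartDomain x)
  have hxV : x ∈ U ∩ chartDomain (E := E) x := ⟨hx, mem_chartDomain x⟩
  have hZ : SmoothField Z (U ∩ chartDomain (E := E) x) :=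
    (smoothField_ofChart x _).mono inter_subset_right
  have hZx : Z x = w := ofChart_toChart (mem_chartDomain x) w
  replace hf := hf.mono (inter_subset_left (t := chartDomain (E := E) x))
  replace hX := ContMDiffOn.mono hX (inter_subset_left (t := chartDomain (E := E) x))
  replace hY := ContMDiffOn.mono hY (inter_subset_left (t := chartDomain (E := E) x))
  have h1 := leibniz_mlieBracket hX hY (hZ.smul hV hf) hV hxV
  rw [mlieBracket_mlieBracket_smul hf hY hZ hV hxV,
    mlieBracket_mlieBracket_smul hf hX hZ hV hxV, mlieBracket_fun_smul hf hZ hV hxV,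
    leibniz_mlieBracket hX hY hZ hV hxV, hZx] at h1
  have h2 : (mvfderiv 𝓘(ℝ, E) (fun y => mvfderiv 𝓘(ℝ, E) f y (Y y)) x (X x) -
      mvfderiv 𝓘(ℝ, E) (fun y => mvfderiv 𝓘(ℝ, E) f y (X y)) x (Y x) -
      mvfderiv 𝓘(ℝ, E) f x (mlieBracket 𝓘(ℝ, E) X Y x)) • w = 0 := by
    rw [sub_smul, sub_smul]
    rw [← sub_eq_zero] at h1
    rw [← h1]
    module
  have h3 := (smul_eq_zero.1 h2).resolve_right hw
  linarith

end Bracket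

/-! ### The symmetries of the curvature -/

section Curvature

variable {E : Type*} [NormedAddCommGroup E] [NormedSpace ℝ E] [FiniteDimensional ℝ E]
  {M : Type*} [TopologicalSpace M] [ChartedSpace E M] [IsManifold 𝓘(ℝ, E) ∞ M]
  {g : PseudoRiemannianMetric E M}
  {cov : CovariantDerivative 𝓘(ℝ, E) E (TangentSpace 𝓘(ℝ, E) : M → Type _)}
  {U : Set M} {X Y Z W : Π x : M, TangentSpace 𝓘(ℝ, E) x} {x : M}

open VectorField

theorem IsLeviCivita.mlieBracket_eq (hcov : IsLeviCivita g cov) (hX : SmoothField X U)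
    (hY : SmoothField Y U) (hU : IsOpen U) (hx : x ∈ U) :
    mlieBracket 𝓘(ℝ, E) X Y x = cov Y x (X x) - cov X x (Y x) :=
  (cov.torsion_eq_zero_iff.1 hcov.torsion_eq_zero (hX.mdiffAt hU hx) (hY.mdiffAt hU hx)).symm

theorem curvature_antisymm (X Y Z : Π x : M, TangentSpace 𝓘(ℝ, E) x) (x : M) :
    curvature cov X Y Z x = -curvature cov Y X Z x := by
  rw [curvature, curvature, mlieBracket_swap_apply, map_neg]
  abel

/-- The first Bianchi identity: for a torsion-free connection the cyclic sum of the curvature is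
the cyclic sum of the iterated Lie brackets, which vanishes by the Jacobi identity. -/
theorem IsLeviCivita.first_bianchi (hcov : IsLeviCivita g cov) (hX : SmoothField X U)
    (hY : SmoothField Y U) (hZ : SmoothField Z U) (hU : IsOpen U) (hx : x ∈ U) :
    curvature cov X Y Z x + curvature cov Y Z X x + curvature cov Z X Y x = 0 := by
  have key {A B C : Π x : M, TangentSpace 𝓘(ℝ, E) x} (hA : SmoothField A U)
      (hB : SmoothField B U) (hC : SmoothField C U) :
      cov (fun y => cov C y (B y)) x (A x) - cov (fun y => cov B y (C y)) x (A x) =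
        mlieBracket 𝓘(ℝ, E) A (mlieBracket 𝓘(ℝ, E) B C) x +
          cov A x (mlieBracket 𝓘(ℝ, E) B C x) := by
    have hBC := hB.mlieBracket hC hU
    have h1 := hB.cov_apply cov hcov.smooth hC hU
    have h2 := hC.cov_apply cov hcov.smooth hB hU
    have h3 : ∀ y ∈ U, mlieBracket 𝓘(ℝ, E) B C y + cov B y (C y) = cov C y (B y) := fun y hy => by
      rw [hcov.mlieBracket_eq hB hC hU hy, sub_add_cancel]
    rw [hcov.mlieBracket_eq hA hBC hU hx, sub_add_cancel, ← cov_congr cov h1 hU hx h3,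
      cov_add cov hBC h2 hU hx]
    exact add_sub_cancel_right _ _
  have h1 := key hX hY hZ
  have h2 := key hY hX hZ
  have h3 := key hZ hX hY
  have h4 := leibniz_mlieBracket hX hY hZ hU hx
  rw [mlieBracket_swap_apply (V := mlieBracket 𝓘(ℝ, E) X Y)] at h4
  rw [curvature, curvature, curvature, mlieBracket_swap_apply (V := Z) (W := X), map_neg]
  linear_combination (norm := module) h1 - h2 + h3 + h4

/-- For a metric connection `R(X, Y)` is skew-adjoint: differentiating `g(Z, W)` twice gives
`[X Y - Y X - [X, Y]] g(Z, W) = g(R(X, Y) Z, W) + g(Z, R(X, Y) W)`, and the left side vanishes. -/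
theorem IsLeviCivita.curvature_skew (hcov : IsLeviCivita g cov) (hX : SmoothField X U)
    (hY : SmoothField Y U) (hZ : SmoothField Z U) (hW : SmoothField W U) (hU : IsOpen U)
    (hx : x ∈ U) :
    g.val x (curvature cov X Y Z x) (W x) + g.val x (Z x) (curvature cov X Y W x) = 0 := by
  have hd {A B : Π x : M, TangentSpace 𝓘(ℝ, E) x} (hA : SmoothField A U)
      (hB : SmoothField B U) {y : M} (hy : y ∈ U) (v : TangentSpace 𝓘(ℝ, E) y) :
      mvfderiv 𝓘(ℝ, E) (fun y => g.val y (A y) (B y)) y v =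
        g.val y (cov A y v) (B y) + g.val y (A y) (cov B y v) :=
    hcov.metric_compatible y v A B (hA.mdiffAt hU hy) (hB.mdiffAt hU hy)
  have key {A B : Π x : M, TangentSpace 𝓘(ℝ, E) x} (hA : SmoothField A U)
      (hB : SmoothField B U) :
      mvfderiv 𝓘(ℝ, E) (fun y => mvfderiv 𝓘(ℝ, E) (fun y => g.val y (Z y) (W y)) y (B y)) x (A x)
        = (g.val x (cov (fun y => cov Z y (B y)) x (A x)) (W x) +
            g.val x (cov Z x (B x)) (cov W x (A x))) +
          (g.val x (cov Z x (A x)) (cov W x (B x)) +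
            g.val x (Z x) (cov (fun y => cov W y (B y)) x (A x))) := by
    have h1 := hB.cov_apply cov hcov.smooth hZ hU
    have h2 := hB.cov_apply cov hcov.smooth hW hU
    have h3 : mvfderiv 𝓘(ℝ, E)
        (fun y => mvfderiv 𝓘(ℝ, E) (fun y => g.val y (Z y) (W y)) y (B y)) x =
        mvfderiv 𝓘(ℝ, E)
          (fun y => g.val y (cov Z y (B y)) (W y) + g.val y (Z y) (cov W y (B y))) x := by
      refine mvfderiv_congr_of_eventuallyEq ?_
      filter_upwards [hU.mem_nhds hx] with y hy using hd hZ hW hy (B y)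
    rw [h3, mvfderiv_fun_add ((g.smooth_val h1 hW).mdiffAt hU hx)
      ((g.smooth_val hZ h2).mdiffAt hU hx), add_apply, hd h1 hW hx, hd hZ h2 hx]
  have h1 := mvfderiv_mlieBracket (g.smooth_val hZ hW) hX hY hU hx
  rw [key hX hY, key hY hX, hd hZ hW hx] at h1
  simp only [curvature, map_sub, sub_apply]
  linarith

/-- The curvature on one-forms: `(∇_X ∇_Y - ∇_Y ∇_X - ∇_[X, Y]) α = - α(R(X, Y) ·)`. -/
theorem formCov_curvature
    (hcov : ∀ U : Set M, IsOpen U → ContMDiffCovariantDerivativeOn E ∞ cov.toFun U)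
    {α : Π x : M, Cotangent (E := E) x} (hα : SmoothForm α U) (hX : SmoothField X U)
    (hY : SmoothField Y U) (hZ : SmoothField Z U) (hU : IsOpen U) (hx : x ∈ U) :
    (formCov cov (fun y => formCov cov α y (Y y)) x (X x) -
      formCov cov (fun y => formCov cov α y (X y)) x (Y x) -
      formCov cov α x (mlieBracket 𝓘(ℝ, E) X Y x)) (Z x) = -α x (curvature cov X Y Z x) := by
  have key {A B : Π x : M, TangentSpace 𝓘(ℝ, E) x} (hA : SmoothField A U)
      (hB : SmoothField B U) :
      formCov cov (fun y => formCov cov α y (B y)) x (A x) (Z x) =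
        mvfderiv 𝓘(ℝ, E) (fun y => mvfderiv 𝓘(ℝ, E) (fun y => α y (Z y)) y (B y)) x (A x) -
          mvfderiv 𝓘(ℝ, E) (fun y => α y (cov Z y (B y))) x (A x) -
          (mvfderiv 𝓘(ℝ, E) (fun y => α y (cov Z y (A y))) x (B x) -
            α x (cov (fun y => cov Z y (A y)) x (B x))) := by
    have h1 := hB.cov_apply cov hcov hZ hU
    have h2 := hA.cov_apply cov hcov hZ hU
    have h3 : mvfderiv 𝓘(ℝ, E) (fun y => formCov cov α y (B y) (Z y)) x =
        mvfderiv 𝓘(ℝ, E) (fun y => mvfderiv 𝓘(ℝ, E) (fun y => α y (Z y)) y (B y) -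
          α y (cov Z y (B y))) x := by
      refine mvfderiv_congr_of_eventuallyEq ?_
      filter_upwards [hU.mem_nhds hx] with y hy using formCov_apply cov hα hZ hU hy (B y)
    rw [formCov_apply cov (hα.formCov cov hcov hB hU) hZ hU hx, h3, mvfderiv_fun_sub
      ((contMDiffOn_mvfderiv_apply (hα.apply_field hZ hU) hB hU).mdiffAt hU hx)
      ((hα.apply_field h1 hU).mdiffAt hU hx), sub_apply, formCov_apply cov hα h2 hU hx]
  rw [LinearMap.sub_apply, LinearMap.sub_apply, key hX hY, key hY hX,
    formCov_apply cov hα hZ hU hx, mvfderiv_mlieBracket (hα.apply_field hZ hU) hX hY hU hx]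
  simp only [curvature, map_sub]
  ring

end Curvature
/-! ### The Ricci operator on a coframe -/

namespace PseudoRiemannianMetric

variable {E : Type*} [NormedAddCommGroup E] [NormedSpace ℝ E] [FiniteDimensional ℝ E]
  {M : Type*} [TopologicalSpace M] [ChartedSpace E M] [IsManifold 𝓘(ℝ, E) ∞ M]
  {g : PseudoRiemannianMetric E M}
  {cov : CovariantDerivative 𝓘(ℝ, E) E (TangentSpace 𝓘(ℝ, E) : M → Type _)}
  {ι : Type*} [Fintype ι] [DecidableEq ι] {U : Set M}
  {e : ι → Π x : M, TangentSpace 𝓘(ℝ, E) x} {θ : ι → Π x : M, Cotangent (E := E) x} {x : M}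

open VectorField

theorem riemannCoeff_antisymm (ρ μ α β : ι) :
    riemannCoeff cov e θ ρ μ α β x = -riemannCoeff cov e θ ρ μ β α x := by
  rw [riemannCoeff, riemannCoeff, curvature_antisymm, map_neg]

theorem riemannCoeff_cyclic (hcov : IsLeviCivita g cov) (h : IsFrameOn U e θ) (hx : x ∈ U)
    (ρ μ α β : ι) :
    riemannCoeff cov e θ ρ μ α β x + riemannCoeff cov e θ α μ β ρ x +
      riemannCoeff cov e θ β μ ρ α x = 0 := by
  simp only [riemannCoeff]
  rw [← map_add, ← map_add, hcov.first_bianchi (h.smoothField α) (h.smoothField β)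
    (h.smoothField ρ) h.isOpen hx, map_zero]

theorem sharp_eq_sum (h : IsFrameOn U e θ) (hx : x ∈ U) (μ : ι) :
    g.sharp x (θ μ x) = ∑ ρ, g.cometric x (θ μ x) (θ ρ x) • e ρ x := by
  rw [h.eq_sum_frame hx (g.sharp x (θ μ x))]
  exact Finset.sum_congr rfl fun ρ _ => by rw [g.cometric_apply]

/-- With the first index raised, the components of the Riemann tensor are antisymmetric in the
first pair: `g^{ρσ} R_ρ^μ_{αβ} = - g^{ρμ} R_ρ^σ_{αβ}`. -/
theorem sum_cometric_riemannCoeff (hcov : IsLeviCivita g cov) (h : IsFrameOn U e θ) (hx : x ∈ U)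
    (μ σ α β : ι) :
    ∑ ρ, g.cometric x (θ ρ x) (θ σ x) * riemannCoeff cov e θ ρ μ α β x =
      -∑ ρ, g.cometric x (θ ρ x) (θ μ x) * riemannCoeff cov e θ ρ σ α β x := by
  have key (μ σ : ι) : ∑ ρ, g.cometric x (θ ρ x) (θ σ x) * riemannCoeff cov e θ ρ μ α β x =
      ∑ ρ, ∑ ν, (g.cometric x (θ ρ x) (θ σ x) * g.cometric x (θ ν x) (θ μ x)) *
        g.val x (curvature cov (e α) (e β) (e ρ) x) (e ν x) := by
    refine Finset.sum_congr rfl fun ρ _ => ?_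
    rw [riemannCoeff, ← g.val_sharp, sharp_eq_sum h hx, g.symm, map_sum, Finset.mul_sum]
    refine Finset.sum_congr rfl fun ν _ => ?_
    rw [map_smul, smul_eq_mul, g.cometric_comm x (θ μ x), mul_assoc]
  rw [key, key, Finset.sum_comm, ← Finset.sum_neg_distrib]
  refine Finset.sum_congr rfl fun ρ _ => ?_
  rw [← Finset.sum_neg_distrib]
  refine Finset.sum_congr rfl fun ν _ => ?_
  have h1 := hcov.curvature_skew (h.smoothField α) (h.smoothField β) (h.smoothField ρ)
    (h.smoothField ν) h.isOpen hx
  rw [g.symm x (e ρ x)] at h1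
  linear_combination (g.cometric x (θ ν x) (θ σ x) * g.cometric x (θ ρ x) (θ μ x)) * h1

theorem ricciMixed_eq (hcov : IsLeviCivita g cov) (h : IsFrameOn U e θ) (hx : x ∈ U) (μ β : ι) :
    g.ricciMixed cov e θ μ β x =
      ∑ ρ, ∑ α, g.cometric x (θ ρ x) (θ α x) * riemannCoeff cov e θ ρ μ α β x := by
  rw [Finset.sum_comm]
  simp only [sum_cometric_riemannCoeff hcov h hx μ, ricciMixed, ricciCoeff, Finset.mul_sum,
    ← Finset.sum_neg_distrib]
  rw [Finset.sum_comm]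
  refine Finset.sum_congr rfl fun α _ => Finset.sum_congr rfl fun ρ _ => ?_
  rw [riemannCoeff_antisymm ρ α α β, g.cometric_comm x (θ μ x)]
  ring

/-- The antisymmetric part of the second covariant derivative of a coframe is its curvature:
`(∇²_{αβ} - ∇²_{βα}) θ^μ = - R_ρ^μ_{αβ} θ^ρ`. -/
theorem secondCov_sub_secondCov (hcov : IsLeviCivita g cov) (h : IsFrameOn U e θ) (hx : x ∈ U)
    (μ α β : ι) :
    g.secondCov cov e θ α β (g.oneForm (θ μ)) x - g.secondCov cov e θ β α (g.oneForm (θ μ)) x =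
      -∑ ρ, riemannCoeff cov e θ ρ μ α β x • g.oneForm (θ ρ) x := by
  have hθ := h.smoothForm μ
  have hF := smoothOn_oneForm (g := g) hθ
  have h1 (α β : ι) : g.cliffordCov cov
      (fun y => g.cliffordCov cov (g.oneForm (θ μ)) y (e β y)) x (e α x) =
      CliffordAlgebra.ι _ (formCov cov (fun y => formCov cov (θ μ) y (e β y)) x (e α x)) := by
    have h2 := hθ.formCov cov hcov.smooth (h.smoothField β) h.isOpen
    rw [← cliffordCov_oneForm cov h2 h.isOpen hx]
    exact cliffordCov_congr cov (smoothOn_oneForm h2) h.isOpen hx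
      (fun y hy => cliffordCov_oneForm cov hθ h.isOpen hy _) _
  have h2 := isLinearMap_cliffordCov cov hF h.isOpen hx
  rw [secondCov_eq_hessian cov h hF hx, secondCov_eq_hessian cov h hF hx, hessian, hessian,
    sub_sub_sub_comm, ← h2.map_sub, ← hcov.mlieBracket_eq (h.smoothField α) (h.smoothField β)
      h.isOpen hx, h1, h1, cliffordCov_oneForm cov hθ h.isOpen hx, ← map_sub, ← map_sub,
    h.eq_sum_coframe hx (_ - _), map_sum, ← Finset.sum_neg_distrib]
  refine Finset.sum_congr rfl fun ρ _ => ?_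
  rw [formCov_curvature hcov.smooth hθ (h.smoothField α) (h.smoothField β) (h.smoothField ρ)
    h.isOpen hx, map_smul, neg_smul]
  rfl

theorem cliffordWedge_ι_swap (a b : Cotangent (E := E) x) :
    (cliffordWedge (CliffordAlgebra.ι _ a) (CliffordAlgebra.ι _ b) : g.Cl x) =
      -cliffordWedge (CliffordAlgebra.ι _ b) (CliffordAlgebra.ι _ a) := by
  apply (g.toForm x).injective
  rw [map_neg, toForm_wedge, toForm_wedge, toForm_ι, toForm_ι]
  exact eq_neg_of_add_eq_zero_left (ExteriorAlgebra.ι_add_mul_swap a b)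

/-- Contracting `θ^α ∧ θ^β` with the second covariant derivative of `θ^μ`, through any bilinear
product `T`, only sees the curvature. -/
theorem contract_secondCov_coframe (hcov : IsLeviCivita g cov) (h : IsFrameOn U e θ) (hx : x ∈ U)
    (μ : ι) (T : g.Cl x →ₗ[ℝ] g.Cl x →ₗ[ℝ] g.Cl x) :
    ∑ α, ∑ β, T (cliffordWedge (g.oneForm (θ α) x) (g.oneForm (θ β) x))
        (g.secondCov cov e θ α β (g.oneForm (θ μ)) x) =
      -∑ ρ, T (g.curvatureForm cov e θ ρ μ x) (g.oneForm (θ ρ) x) := by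
  set S := ∑ α, ∑ β, T (cliffordWedge (g.oneForm (θ α) x) (g.oneForm (θ β) x))
    (g.secondCov cov e θ α β (g.oneForm (θ μ)) x) with hS
  -- exchange the names of `α` and `β`: only the antisymmetric part of `∇²_{αβ}` contributes
  have h1 : S = -∑ α, ∑ β, T (cliffordWedge (g.oneForm (θ α) x) (g.oneForm (θ β) x))
      (g.secondCov cov e θ β α (g.oneForm (θ μ)) x) := by
    rw [hS, Finset.sum_comm]
    simp only [← Finset.sum_neg_distrib]
    refine Finset.sum_congr rfl fun α _ => Finset.sum_congr rfl fun β _ => ?_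
    rw [oneForm, oneForm, cliffordWedge_ι_swap, map_neg, LinearMap.neg_apply]
  have h2 : S + S = -∑ α, ∑ β, ∑ ρ, riemannCoeff cov e θ ρ μ α β x •
      T (cliffordWedge (g.oneForm (θ α) x) (g.oneForm (θ β) x)) (g.oneForm (θ ρ) x) := by
    nth_rewrite 2 [h1]
    rw [hS, ← sub_eq_add_neg]
    simp only [← Finset.sum_sub_distrib, ← Finset.sum_neg_distrib]
    refine Finset.sum_congr rfl fun α _ => Finset.sum_congr rfl fun β _ => ?_
    rw [← map_sub, secondCov_sub_secondCov hcov h hx, map_neg, map_sum, ← Finset.sum_neg_distrib]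
    simp only [map_smul]
  have h3 : ∑ ρ, T (g.curvatureForm cov e θ ρ μ x) (g.oneForm (θ ρ) x) = (1 / 2 : ℝ) •
      ∑ α, ∑ β, ∑ ρ, riemannCoeff cov e θ ρ μ α β x •
      T (cliffordWedge (g.oneForm (θ α) x) (g.oneForm (θ β) x)) (g.oneForm (θ ρ) x) := by
    simp only [curvatureForm, map_smul, map_sum, LinearMap.smul_apply, LinearMap.sum_apply,
      ← Finset.smul_sum]
    congr 1
    rw [Finset.sum_comm]
    refine Finset.sum_congr rfl fun α _ => ?_
    rw [Finset.sum_comm]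
  rw [h3, ← smul_neg, ← h2, ← two_smul ℝ S, smul_smul]
  norm_num

variable (g) in
/-- The exterior product of the Clifford fibre as a bilinear map. -/
def wedgeHom (x : M) : g.Cl x →ₗ[ℝ] g.Cl x →ₗ[ℝ] g.Cl x :=
  LinearMap.mk₂ ℝ cliffordWedge
    (fun a b c => by simp [cliffordWedge, add_mul]) (fun r a b => by simp [cliffordWedge])
    (fun a b c => by simp [cliffordWedge, mul_add]) (fun r a b => by simp [cliffordWedge])

theorem wedgeHom_apply (a b : g.Cl x) : g.wedgeHom x a b = cliffordWedge a b := rfl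

theorem ricciOp_coframe (hcov : IsLeviCivita g cov) (h : IsFrameOn U e θ) (hx : x ∈ U) (μ : ι) :
    g.ricciOp cov e θ (g.oneForm (θ μ)) x =
      -∑ ρ, g.curvatureForm cov e θ ρ μ x * g.oneForm (θ ρ) x :=
  contract_secondCov_coframe hcov h hx μ (LinearMap.mul ℝ _)

/-- The cyclic sum of `θ^α ∧ θ^β ∧ θ^ρ` is symmetric, so only the cyclic sum of the Riemann
tensor contributes. -/
theorem sum_curvatureForm_wedge (hcov : IsLeviCivita g cov) (h : IsFrameOn U e θ) (hx : x ∈ U)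
    (μ : ι) :
    ∑ ρ, cliffordWedge (g.curvatureForm cov e θ ρ μ x) (g.oneForm (θ ρ) x) = 0 := by
  let t (α β ρ : ι) : g.Cl x := cliffordWedge (cliffordWedge (g.oneForm (θ α) x)
    (g.oneForm (θ β) x)) (g.oneForm (θ ρ) x)
  have ht (α β ρ : ι) : t α β ρ = t β ρ α := by
    apply (g.toForm x).injective
    simp only [t, toForm_wedge, oneForm, toForm_ι]
    have h1 := eq_neg_of_add_eq_zero_left (ExteriorAlgebra.ι_add_mul_swap (R := ℝ) (θ α x) (θ β x))
    have h2 := eq_neg_of_add_eq_zero_left (ExteriorAlgebra.ι_add_mul_swap (R := ℝ) (θ α x) (θ ρ x))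
    rw [h1, neg_mul, mul_assoc, h2, mul_neg, neg_neg, mul_assoc]
  let S : g.Cl x := ∑ ρ, ∑ α, ∑ β, riemannCoeff cov e θ ρ μ α β x • t α β ρ
  have h1 : ∑ ρ, cliffordWedge (g.curvatureForm cov e θ ρ μ x) (g.oneForm (θ ρ) x) =
      (1 / 2 : ℝ) • S := by
    simp only [← wedgeHom_apply, curvatureForm, map_smul, map_sum, LinearMap.smul_apply,
      LinearMap.sum_apply, ← Finset.smul_sum]
    rfl
  have hrot (f : ι → ι → ι → g.Cl x) : ∑ ρ, ∑ α, ∑ β, f ρ α β = ∑ ρ, ∑ α, ∑ β, f α β ρ := by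
    symm
    rw [Finset.sum_comm]
    exact Finset.sum_congr rfl fun α _ => Finset.sum_comm
  have h2 : S = ∑ ρ, ∑ α, ∑ β, riemannCoeff cov e θ α μ β ρ x • t α β ρ := by
    refine (hrot _).trans (Finset.sum_congr rfl fun ρ _ => Finset.sum_congr rfl fun α _ =>
      Finset.sum_congr rfl fun β _ => ?_)
    rw [← ht α β ρ]
  have h3 : S = ∑ ρ, ∑ α, ∑ β, riemannCoeff cov e θ β μ ρ α x • t α β ρ := by
    rw [h2, hrot]
    refine Finset.sum_congr rfl fun ρ _ => Finset.sum_congr rfl fun α _ =>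
      Finset.sum_congr rfl fun β _ => ?_
    rw [← ht α β ρ]
  have h4 : (3 : ℝ) • S = 0 := by
    have h5 : (3 : ℝ) • S = S + S + S := by module
    rw [h5]
    nth_rewrite 2 [h2]
    nth_rewrite 2 [h3]
    simp only [S, ← Finset.sum_add_distrib, ← add_smul, riemannCoeff_cyclic hcov h hx, zero_smul,
      Finset.sum_const_zero]
  rw [h1, (smul_eq_zero.1 h4).resolve_left (by norm_num), smul_zero]

theorem ricciOpWedge_coframe (hcov : IsLeviCivita g cov) (h : IsFrameOn U e θ) (hx : x ∈ U)
    (μ : ι) : g.ricciOpWedge cov e θ (g.oneForm (θ μ)) x = 0 := by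
  have h1 := contract_secondCov_coframe hcov h hx μ (g.wedgeHom x)
  simp only [wedgeHom_apply, sum_curvatureForm_wedge hcov h hx, neg_zero] at h1
  exact h1

/-- `(∂ ∧ ∂) θ^μ = R^μ_β θ^β`: the `3`-form part of `- ℛ_ρ^μ θ^ρ` vanishes by the first Bianchi
identity, and the two contractions in its one-form part are equal and give the Ricci tensor. -/
theorem ricciOp_coframe_eq_ricciForm (hcov : IsLeviCivita g cov) (h : IsFrameOn U e θ)
    (hx : x ∈ U) (μ : ι) :
    g.ricciOp cov e θ (g.oneForm (θ μ)) x = g.oneForm (g.ricciForm cov e θ μ) x := by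
  have h1 (ρ : ι) : g.curvatureForm cov e θ ρ μ x * g.oneForm (θ ρ) x =
      cliffordWedge (g.curvatureForm cov e θ ρ μ x) (g.oneForm (θ ρ) x) -
        ∑ β, ∑ α, (g.cometric x (θ ρ x) (θ α x) * riemannCoeff cov e θ ρ μ α β x) •
          g.oneForm (θ β) x := by
    have h3 (α β : ι) : cliffordWedge (g.oneForm (θ α) x) (g.oneForm (θ β) x) * g.oneForm (θ ρ) x =
        cliffordWedge (cliffordWedge (g.oneForm (θ α) x) (g.oneForm (θ β) x)) (g.oneForm (θ ρ) x) +
          (g.cometric x (θ β x) (θ ρ x) • g.oneForm (θ α) x -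
            g.cometric x (θ α x) (θ ρ x) • g.oneForm (θ β) x) :=
      g.wedge_mul_ι x (θ α x) (θ β x) (θ ρ x)
    -- the two contractions of `h3` with the Riemann tensor are `-S` and `S`
    set S := ∑ β, ∑ α, (g.cometric x (θ ρ x) (θ α x) * riemannCoeff cov e θ ρ μ α β x) •
      g.oneForm (θ β) x with hS
    have h4 : ∑ α, ∑ β, riemannCoeff cov e θ ρ μ α β x •
        g.cometric x (θ β x) (θ ρ x) • g.oneForm (θ α) x = -S := by
      rw [hS, ← Finset.sum_neg_distrib]
      refine Finset.sum_congr rfl fun β _ => ?_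
      rw [← Finset.sum_neg_distrib]
      refine Finset.sum_congr rfl fun α _ => ?_
      rw [riemannCoeff_antisymm, g.cometric_comm x (θ α x), smul_smul, ← neg_smul]
      congr 1
      ring
    have h5 : ∑ α, ∑ β, riemannCoeff cov e θ ρ μ α β x •
        g.cometric x (θ α x) (θ ρ x) • g.oneForm (θ β) x = S := by
      rw [hS, Finset.sum_comm]
      refine Finset.sum_congr rfl fun β _ => Finset.sum_congr rfl fun α _ => ?_
      rw [g.cometric_comm x (θ α x), smul_smul, mul_comm]
    have h6 : cliffordWedge (g.curvatureForm cov e θ ρ μ x) (g.oneForm (θ ρ) x) =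
        (1 / 2 : ℝ) • ∑ α, ∑ β, riemannCoeff cov e θ ρ μ α β x •
          cliffordWedge (cliffordWedge (g.oneForm (θ α) x) (g.oneForm (θ β) x))
            (g.oneForm (θ ρ) x) := by
      simp only [← wedgeHom_apply, curvatureForm, map_smul, map_sum, LinearMap.smul_apply,
        LinearMap.sum_apply]
    rw [h6, curvatureForm, smul_mul_assoc]
    simp only [Finset.sum_mul, smul_mul_assoc, h3, smul_add, smul_sub, Finset.sum_add_distrib,
      Finset.sum_sub_distrib, h4, h5]
    module
  rw [ricciOp_coframe hcov h hx, Finset.sum_congr rfl fun ρ _ => h1 ρ, Finset.sum_sub_distrib,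
    sum_curvatureForm_wedge hcov h hx, zero_sub, neg_neg]
  have h2 : g.oneForm (g.ricciForm cov e θ μ) x =
      ∑ β, g.ricciMixed cov e θ μ β x • g.oneForm (θ β) x := by
    rw [oneForm, ricciForm, map_sum]
    simp only [map_smul]
    rfl
  rw [h2, Finset.sum_comm]
  refine Finset.sum_congr rfl fun β _ => ?_
  simp only [ricciMixed_eq hcov h hx, Finset.sum_smul]

/-- The cotetrad is orthonormal too, since `η` is its own inverse. -/
theorem cometric_tetrad {e : Fin 4 → Π x : M, TangentSpace 𝓘(ℝ, E) x}
    {θ : Fin 4 → Π x : M, Cotangent (E := E) x} (h : IsFrameOn U e θ)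
    (he : ∀ x ∈ U, ∀ a b, g.val x (e a x) (e b x) = minkowski a b) (hx : x ∈ U) (a b : Fin 4) :
    g.cometric x (θ a x) (θ b x) = minkowski a b := by
  have h1 : (if a = b then 1 else 0 : ℝ) =
      ∑ ρ, g.cometric x (θ a x) (θ ρ x) * minkowski ρ b := by
    rw [← h.dual x hx, ← g.val_sharp, sharp_eq_sum h hx, map_sum, sum_apply]
    refine Finset.sum_congr rfl fun ρ _ => ?_
    rw [map_smul, smul_apply, he x hx, smul_eq_mul]
  have h2 : ∑ ρ, g.cometric x (θ a x) (θ ρ x) * minkowski ρ b =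
      g.cometric x (θ a x) (θ b x) * minkowski b b := by
    refine Finset.sum_eq_single b (fun ρ _ hρ => ?_) (by simp)
    rw [minkowski, Matrix.diagonal_apply_ne _ hρ, mul_zero]
  have h3 : minkowski b b * minkowski b b = 1 := by
    fin_cases b <;> simp [minkowski]
  rw [h2] at h1
  rw [← mul_one (g.cometric x (θ a x) (θ b x)), ← h3, ← mul_assoc, ← h1]
  by_cases hab : a = b
  · rw [hab, if_pos rfl, one_mul]
  · rw [if_neg hab, zero_mul, minkowski, Matrix.diagonal_apply_ne _ hab]

theorem ricciForm_tetrad {e : Fin 4 → Π x : M, TangentSpace 𝓘(ℝ, E) x}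
    {θ : Fin 4 → Π x : M, Cotangent (E := E) x} (h : IsFrameOn U e θ)
    (he : ∀ x ∈ U, ∀ a b, g.val x (e a x) (e b x) = minkowski a b) (hx : x ∈ U) (a : Fin 4) :
    g.ricciForm cov e θ a x = ∑ b, (minkowski a a * ricciCoeff cov e θ a b x) • θ b x := by
  refine Finset.sum_congr rfl fun b _ => ?_
  congr 1
  refine (Finset.sum_eq_single a (fun ν _ hν => ?_) (by simp)).trans
    (by rw [cometric_tetrad h he hx])
  rw [cometric_tetrad h he hx, minkowski, Matrix.diagonal_apply_ne _ (Ne.symm hν), zero_mul]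

end PseudoRiemannianMetric
open PseudoRiemannianMetric

theorem mainTheorem2
    {E : Type*} [NormedAddCommGroup E] [NormedSpace ℝ E] [FiniteDimensional ℝ E]
    {M : Type*} [TopologicalSpace M] [ChartedSpace E M] [IsManifold 𝓘(ℝ, E) ∞ M]
    (g : PseudoRiemannianMetric E M)
    (cov : CovariantDerivative 𝓘(ℝ, E) E (TangentSpace 𝓘(ℝ, E) : M → Type _))
    (hcov : IsLeviCivita g cov) :
    -- an arbitrary frame `e`, with dual coframe `θ`, on an open set `U`
    (∀ (ι : Type) [Fintype ι] [DecidableEq ι] (U : Set M)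
      (e : ι → Π x : M, TangentSpace 𝓘(ℝ, E) x) (θ : ι → Π x : M, Cotangent (E := E) x),
      IsFrameOn U e θ →
      -- `∂² = θ^α θ^β ∇²_{αβ}`, and `∂ · ∂`, `∂ ∧ ∂` are its `0`-form and `2`-form parts
      (∀ F : Π x : M, g.Cl x, g.SmoothOn F U → ∀ x ∈ U,
        g.dirac cov e θ (g.dirac cov e θ F) x =
          ∑ α, ∑ β, g.oneForm (θ α) x * g.oneForm (θ β) x * g.secondCov cov e θ α β F x ∧
        g.dAlembertian cov e θ F x =
          ∑ α, ∑ β, cliffordGrade 0 (g.oneForm (θ α) x * g.oneForm (θ β) x) *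
            g.secondCov cov e θ α β F x ∧
        g.ricciOp cov e θ F x =
          ∑ α, ∑ β, cliffordGrade 2 (g.oneForm (θ α) x * g.oneForm (θ β) x) *
            g.secondCov cov e θ α β F x ∧
        g.dirac cov e θ (g.dirac cov e θ F) x =
          g.dAlembertian cov e θ F x + g.ricciOp cov e θ F x) ∧
      -- the operators do not depend on the frame
      (∀ (U' : Set M) (e' : ι → Π x : M, TangentSpace 𝓘(ℝ, E) x)
        (θ' : ι → Π x : M, Cotangent (E := E) x), IsFrameOn U' e' θ' →
        ∀ F : Π x : M, g.Cl x, g.SmoothOn F (U ∩ U') → ∀ x ∈ U ∩ U',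
          g.dirac cov e θ F x = g.dirac cov e' θ' F x ∧
          g.dAlembertian cov e θ F x = g.dAlembertian cov e' θ' F x ∧
          g.ricciOp cov e θ F x = g.ricciOp cov e' θ' F x) ∧
      (∀ μ, ∀ x ∈ U,
        -- `(∂ ∧ ∂) θ^μ = ℛ^μ`
        g.ricciOp cov e θ (g.oneForm (θ μ)) x = g.oneForm (g.ricciForm cov e θ μ) x ∧
        -- `R^μ_β = g^{ρα} R_ρ^μ_{αβ}`
        (∀ β, g.ricciMixed cov e θ μ β x =
          ∑ ρ, ∑ α, g.cometric x (θ ρ x) (θ α x) * riemannCoeff cov e θ ρ μ α β x) ∧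
        -- `(∂ ∧ ∂) θ^μ = - ℛ_ρ^μ θ^ρ`, and the `3`-form part vanishes: `ℛ_ρ^μ ∧ θ^ρ = 0`
        g.ricciOp cov e θ (g.oneForm (θ μ)) x =
          -∑ ρ, g.curvatureForm cov e θ ρ μ x * g.oneForm (θ ρ) x ∧
        ∑ ρ, cliffordWedge (g.curvatureForm cov e θ ρ μ x) (g.oneForm (θ ρ) x) = 0 ∧
        g.ricciOpWedge cov e θ (g.oneForm (θ μ)) x = 0 ∧
        cliffordGrade 3 (g.ricciOp cov e θ (g.oneForm (θ μ)) x) = 0)) ∧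
    -- a tetrad `e`, with cotetrad `θ`, on an open set `U`
    (∀ (U : Set M) (e : Fin 4 → Π x : M, TangentSpace 𝓘(ℝ, E) x)
      (θ : Fin 4 → Π x : M, Cotangent (E := E) x),
      IsFrameOn U e θ → (∀ x ∈ U, ∀ a b, g.val x (e a x) (e b x) = minkowski a b) →
      ∀ a, ∀ x ∈ U, g.ricciOp cov e θ (g.oneForm (θ a)) x =
        g.oneForm (fun y => ∑ b, (minkowski a a * ricciCoeff cov e θ a b y) • θ b y) x) := by
  refine ⟨fun ι _ _ U e θ h => ⟨fun F hF x hx => ⟨dirac_dirac cov hcov h hF hx, ?_, ?_, ?_⟩,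
    fun U' e' θ' h' F hF x hx => ⟨dirac_congr_frame cov h h' hF hx,
      dAlembertian_congr_frame cov hcov.smooth h h' hF hx,
      ricciOp_congr_frame cov hcov.smooth h h' hF hx⟩,
    fun μ x hx => ⟨ricciOp_coframe_eq_ricciForm hcov h hx μ, fun β => ricciMixed_eq hcov h hx μ β,
      ricciOp_coframe hcov h hx μ, sum_curvatureForm_wedge hcov h hx μ,
      ricciOpWedge_coframe hcov h hx μ, ?_⟩⟩, fun U e θ h he a x hx => ?_⟩
  · refine Finset.sum_congr rfl fun α _ => Finset.sum_congr rfl fun β _ => ?_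
    rw [oneForm, oneForm, cliffordGrade_zero_ι_mul_ι, Algebra.smul_def]
  · refine Finset.sum_congr rfl fun α _ => Finset.sum_congr rfl fun β _ => ?_
    rw [oneForm, oneForm, cliffordGrade_two_ι_mul_ι]
  · rw [dAlembertian_add_ricciOp, dirac_dirac cov hcov h hF hx]
  · rw [ricciOp_coframe_eq_ricciForm hcov h hx]
    exact g.cliffordGrade_three_ι x _
  · rw [ricciOp_coframe_eq_ricciForm hcov h hx, oneForm, oneForm, ricciForm_tetrad h he hx]

end
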